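/- All graphs are finite and simple, and all drawings are connected drawings in the plane, considered up to homeomorphism of the plane; subdrawings are subgraphs with the inherited drawing. A near-triangulation is a non-null connected drawing in which every finite region is a triangle. Vertices $u,v,w$ *form a triangle in clockwise order* in a drawing if they are the three vertices of a finite triangular region of it, listed clockwise. A drawing is $2$-connected if it has at least three vertices and deleting any one vertex leaves it connected. A *configuration* $K$ consists of a near-triangulation $G(K)$ and a map $\gamma_K:V(G(K))\to\mathbb Z$ such that, with $d(v)$ the degree of $v$ in $G(K)$: (i) for every vertex $v$, $G(K)\setminus v$ has at most two components, and if it has two then $\gamma_K(v)=d(v)+2$; (ii) $\gamma_K(v)=d(v)$ if $v$ is not incident with the infinite region, $\gamma_K(v)>d(v)$ otherwise, and $\gamma_K(v)\ge5$ in either case; (iii) $\sum_v(\gamma_K(v)-d(v)-1)\ge 2$, summed over the vertices $v$ incident with the infinite region such that $G(K)\setminus v$ is connected. A *free completion* of $K$ with ring $R$ is a near-triangulation $S$ whose infinite region is bounded by a circuit $R$ that is an induced subgraph of $S$, such that $G(K)$ is the subdrawing $S\setminus V(R)$ and every $v\in V(G(K))$ has degree $\gamma_K(v)$ in $S$. A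 configuration $K_0$ is a *subconfiguration* of $K$ if $G(K_0)$ is a subdrawing of $G(K)$ and $\gamma_{K_0}$ is the restriction of $\gamma_K$; it is *induced* if moreover $G(K_0)$ is an induced subgraph of $G(K)$. A configuration has *radius at most two* if some vertex is joined to every vertex by a path of at most two edges. An *enhancement* of a configuration $L$ is a drawing $J$ obtained as follows. If $G(L)$ is $2$-connected, $J=G(L)$. If $G(L)$ is not $2$-connected and has a unique vertex $v$ such that $G(L)\setminus v$ is disconnected, then $J$ is the subdrawing of a free completion of $L$ induced by $V(G(L))\cup\{v'\}$, where $v'$ is a neighbour of $v$ in the ring. (Every good configuration, that is, every configuration isomorphic to one of the $633$ configurations of the Robertson–Sanders–Seymour–Thomas proof of the Four-Colour Theorem, has an enhancement.) An *axle of degree* $d$ is a pair $A=(l,u)$ of maps on $\{1,\dots,5d\}$ with $l(i)\le u(i)$, $l(i)\in\{5,6,7,8,9\}$, $u(i)\in\{5,6,7,8,12\}$ for all $i$, and $(l(jd+i),u(jd+i))=(5,12)$ for $j=2,3,4$ whenever $1\le i\le d$ and $l(i)\ne u(i)$. Its *skeleton* is the configuration $K$ whose vertices are a *hub* $0$; *spokes*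 $1,\dots,d$, forming a circuit in this clockwise order around the hub, all adjacent to the hub; *hats* $d+1,\dots,2d$, where $d+i$ is adjacent to the spokes $i$ and $i+1$ (cyclically, so $2d$ is adjacent to $d$ and $1$); and, for each spoke $i$ with $k=u(i)\le 8$, the *fan vertices* $jd+i$ for $2\le j\le k-4$. For each such spoke $i$, the hat between the spokes $i-1$ and $i$, then $2d+i,3d+i,\dots,(k-4)d+i$, then $d+i$ form in order a path, all of whose vertices are adjacent to $i$. The finite regions are the resulting triangles; $\gamma_K(0)=d$ and $\gamma_K(n)=u(n)$ for every other vertex $n$. A subconfiguration $K_0$ of the skeleton is *well-positioned* if for every spoke not in $V(G(K_0))$, at least one of the two hats adjacent to it is not in $V(G(K_0))$. **Theorem.** Let $L,K$ be configurations, let $J$ be an enhancement of $L$, and let $J'$ be a $2$-connected near-triangulation with $V(J')=V(J)$ that is a subdrawing of $J$. Let $f:V(J')\to V(G(K))$ be an injective map such that whenever $u,v,w$ form a triangle in $J'$ in clockwise order, $f(u),f(v),f(w)$ form a triangle in $G(K)$ in clockwise order, and such that $\gamma_L(v)=\gamma_K(f(v))$ for every $v\in V(G(L))$. Then there is a subconfiguration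 $K_0$ of $K$ that is isomorphic to $L$; more precisely, $f$ restricted to $V(G(L))$ is an (orientation-preserving) isomorphism from $L$ onto $K_0$. Moreover, if $L$ has radius at most two, $K$ is the skeleton of an axle of degree at least six, and $K_0$ is well-positioned in $K$, then $K_0$ is an induced subconfiguration of $K$. -/

import Mathlib

/-! ### Drawings in the plane

A connected drawing of a finite simple graph in the plane is described, up to orientation-preserving
homeomorphisms of the plane, by the graph, the cyclic order of the neighbours around each vertex,
and the infinite region; an abstract rotation system arises in this way exactly when Euler's
formula holds.  An ordered pair `(u, v)` of adjacent vertices stands for the edge `uv` traversed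
from `u` to `v`, and it represents the region on its right-hand side. -/

/-- Walking along the boundary of the region to the right of `(u, v)`: after `(u, v)` comes
`(v, w)`, where `w` follows `u` in the counterclockwise order around `v`. -/
def faceNext {α : Type*} (rot : α → Equiv.Perm α) (e : α × α) : α × α :=
  (e.2, rot e.2 e.1)

/-- The boundary walk of the region to the right of `e`. -/
def regionOf {α : Type*} (rot : α → Equiv.Perm α) (e : α × α) : Set (α × α) :=
  {e' | ∃ n : ℕ, (faceNext rot)^[n] e = e'}

/-- The regions that are incident with some edge, each given by its boundary walk. -/
def regions {α : Type*} (G : SimpleGraph α) (rot : α → Equiv.Perm α) : Set (Set (α × α)) :=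
  {r | ∃ u v, G.Adj u v ∧ r = regionOf rot (u, v)}

/-- A (non-null) connected drawing in the plane of a finite simple graph, with vertices in `α`. -/
structure PlaneDrawing (α : Type*) where
  /-- the vertices -/
  verts : Finset α
  /-- adjacency -/
  graph : SimpleGraph α
  mem_verts : ∀ u v, graph.Adj u v → u ∈ verts
  connected : (graph.induce (verts : Set α)).Connected
  /-- `rot v u` is the neighbour that follows `u` in the counterclockwise order around `v` -/
  rot : α → Equiv.Perm α
  rot_cycle : ∀ v, (rot v).IsCycleOn (graph.neighborSet v)
  rot_fixed : ∀ v u, ¬ graph.Adj v u → rot v u = u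
  /-- the edges, traversed with the infinite region on the right -/
  outer : Set (α × α)
  outer_region : (graph = ⊥ ∧ outer = ∅) ∨ outer ∈ regions graph rot
  /-- Euler's formula (a drawing without edges is a single vertex) -/
  euler : graph = ⊥ ∨ verts.card + (regions graph rot).ncard = graph.edgeSet.ncard + 2

namespace PlaneDrawing

variable {α β : Type*}

/-- The degree of a vertex. -/
noncomputable def degree (G : PlaneDrawing α) (v : α) : ℕ := (G.graph.neighborSet v).ncard

/-- The vertex `v` is incident with the infinite region. -/
def OnInfinite (G : PlaneDrawing α) (v : α) : Prop :=
  v ∈ G.verts ∧ ((∃ w, (v, w) ∈ G.outer) ∨ ∀ w, ¬ G.graph.Adj v w)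

/-- The graph `G \ v`. -/
def del (G : PlaneDrawing α) (v : α) : SimpleGraph {u : α // u ∈ G.verts ∧ u ≠ v} :=
  G.graph.comap Subtype.val

/-- `u, v, w` are the vertices of a finite triangular region, listed in clockwise order. -/
def ClockwiseTriangle (G : PlaneDrawing α) (u v w : α) : Prop :=
  G.graph.Adj u v ∧ (u, v) ∉ G.outer ∧
    faceNext G.rot (u, v) = (v, w) ∧ faceNext G.rot (v, w) = (w, u) ∧
    faceNext G.rot (w, u) = (u, v)

/-- Every finite region is a triangle. -/
def NearTriangulation (G : PlaneDrawing α) : Prop :=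
  ∀ u v, G.graph.Adj u v → (u, v) ∉ G.outer → ∃ w, G.ClockwiseTriangle u v w

/-- `G` has at least three vertices and `G \ v` is connected for every vertex `v`. -/
def TwoConnected (G : PlaneDrawing α) : Prop :=
  3 ≤ G.verts.card ∧ ∀ v ∈ G.verts, (G.del v).Preconnected

/-- One step between regions of `G` that lie in the same region of a subgraph `H`: move along the
boundary of a region of `G`, or cross an edge of `G` that is not an edge of `H`. -/
inductive RegionStep (G : PlaneDrawing α) (H : SimpleGraph α) : α × α → α × α → Prop
  | along (u v : α) : G.graph.Adj u v → RegionStep G H (u, v) (faceNext G.rot (u, v))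
  | cross (u v : α) : G.graph.Adj u v → ¬ H.Adj u v → RegionStep G H (u, v) (v, u)

/-- The regions of `G` to the right of `e` and of `e'` lie in the same region of the subgraph
`H`. -/
def SameRegionIn (G : PlaneDrawing α) (H : SimpleGraph α) (e e' : α × α) : Prop :=
  Relation.EqvGen (G.RegionStep H) e e'

/-- `H` is a subdrawing of `G`: a subgraph, with the cyclic orders around its vertices inherited
from `G`, and whose infinite region is the one that includes the infinite region of `G`. -/
structure IsSubdrawing (H G : PlaneDrawing α) : Prop where
  verts_subset : H.verts ⊆ G.verts
  graph_le : H.graph ≤ G.graph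
  /-- `H.rot u v` is the first neighbour of `u` in `H` that is met after `v` when the neighbours
  of `u` in `G` are scanned counterclockwise -/
  rot_eq : ∀ u v, H.graph.Adj u v → ∃ n : ℕ, H.rot u v = (G.rot u ^ (n + 1)) v ∧
    ∀ m < n, ¬ H.graph.Adj u ((G.rot u ^ (m + 1)) v)
  outer_iff : ∀ u v, H.graph.Adj u v →
    ((u, v) ∈ H.outer ↔ ∃ e ∈ G.outer, G.SameRegionIn H.graph (u, v) e)

/-- `H` is an induced subdrawing of `G`. -/
def IsInducedSubdrawing (H G : PlaneDrawing α) : Prop :=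
  H.IsSubdrawing G ∧ ∀ u ∈ H.verts, ∀ v ∈ H.verts, G.graph.Adj u v → H.graph.Adj u v

/-- The restriction of `f` to the vertices of `G` is the vertex map of an orientation-preserving
homeomorphism of the plane that takes `G` to `H`. -/
structure IsIso (f : α → β) (G : PlaneDrawing α) (H : PlaneDrawing β) : Prop where
  bijOn : Set.BijOn f G.verts H.verts
  adj_iff : ∀ u ∈ G.verts, ∀ v ∈ G.verts, (G.graph.Adj u v ↔ H.graph.Adj (f u) (f v))
  map_rot : ∀ u v, G.graph.Adj u v → H.rot (f u) (f v) = f (G.rot u v)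
  outer_iff : ∀ u v, G.graph.Adj u v → ((u, v) ∈ G.outer ↔ (f u, f v) ∈ H.outer)

open Classical in
/-- The ring-size that belongs to a drawing `G` and a function `γ` on its vertices. -/
noncomputable def ringSize (G : PlaneDrawing α) (γ : α → ℕ) : ℕ :=
  ∑ v ∈ G.verts.filter (fun v => G.OnInfinite v ∧ (G.del v).Preconnected),
    (γ v - (G.degree v + 1))

end PlaneDrawing

/-! ### Configurations -/

/-- A configuration: a near-triangulation `G` with a function `γ` on its vertices. -/
structure PlaneConfiguration (α : Type*) where
  /-- the underlying near-triangulation -/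
  G : PlaneDrawing α
  /-- the prescribed degrees (only the values on the vertices of `G` matter) -/
  γ : α → ℕ
  near : G.NearTriangulation
  components_le : ∀ v ∈ G.verts, Nat.card (G.del v).ConnectedComponent ≤ 2
  gamma_cut : ∀ v ∈ G.verts, Nat.card (G.del v).ConnectedComponent = 2 → γ v = G.degree v + 2
  gamma_interior : ∀ v ∈ G.verts, ¬ G.OnInfinite v → γ v = G.degree v
  gamma_infinite : ∀ v ∈ G.verts, G.OnInfinite v → G.degree v < γ v
  five_le_gamma : ∀ v ∈ G.verts, 5 ≤ γ v
  two_le_ringSize : 2 ≤ G.ringSize γ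

namespace PlaneConfiguration

variable {α β : Type*}

/-- `K` is a subconfiguration of `L`. -/
def IsSubconfiguration (K L : PlaneConfiguration α) : Prop :=
  K.G.IsSubdrawing L.G ∧ ∀ v ∈ K.G.verts, K.γ v = L.γ v

/-- `K` is an induced subconfiguration of `L`. -/
def IsInducedSubconfiguration (K L : PlaneConfiguration α) : Prop :=
  K.G.IsInducedSubdrawing L.G ∧ ∀ v ∈ K.G.verts, K.γ v = L.γ v

/-- The restriction of `f` to the vertices of `L` is an (orientation-preserving) isomorphism of
configurations from `L` to `K`. -/
def IsIso (f : α → β) (L : PlaneConfiguration α) (K : PlaneConfiguration β) : Prop :=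
  PlaneDrawing.IsIso f L.G K.G ∧ ∀ v ∈ L.G.verts, K.γ (f v) = L.γ v

/-- `L` has radius at most two. -/
def RadiusAtMostTwo (L : PlaneConfiguration α) : Prop :=
  ∃ v ∈ L.G.verts, ∀ u ∈ L.G.verts, ∃ p : L.G.graph.Walk u v, p.IsPath ∧ p.length ≤ 2

/-- The near-triangulation `S` is a free completion of `L` with ring `R`. -/
structure IsFreeCompletion (L : PlaneConfiguration α) (S : PlaneDrawing α) (R : Finset α) :
    Prop where
  near : S.NearTriangulation
  /-- the infinite region of `S` is bounded by a circuit with vertex set `R` ... -/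
  three_le_card : 3 ≤ R.card
  mem_ring : ∀ v, v ∈ R ↔ ∃ w, (v, w) ∈ S.outer
  outer_unique : ∀ v w w', (v, w) ∈ S.outer → (v, w') ∈ S.outer → w = w'
  /-- ... which is an induced subgraph of `S` -/
  ring_induced : ∀ v ∈ R, ∀ w ∈ R, S.graph.Adj v w → (v, w) ∈ S.outer ∨ (w, v) ∈ S.outer
  /-- the drawing of `L` is obtained from `S` by deleting the ring -/
  induced : L.G.IsInducedSubdrawing S
  verts_iff : ∀ v, v ∈ L.G.verts ↔ v ∈ S.verts ∧ v ∉ R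
  degree_eq : ∀ v ∈ L.G.verts, S.degree v = L.γ v

/-- `J` is an enhancement of `L`: the drawing of `L` if that is 2-connected; otherwise, if `v` is
the unique vertex whose deletion disconnects it, the subdrawing of a free completion of `L` induced
by the vertices of `L` together with one neighbour `v'` of `v` in the ring. -/
def IsEnhancement (L : PlaneConfiguration α) (J : PlaneDrawing α) : Prop :=
  (L.G.TwoConnected ∧ J = L.G) ∨
  (¬ L.G.TwoConnected ∧ ∃ (S : PlaneDrawing α) (R : Finset α) (v v' : α),
    L.IsFreeCompletion S R ∧
    v ∈ L.G.verts ∧ ¬ (L.G.del v).Preconnected ∧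
    (∀ x ∈ L.G.verts, ¬ (L.G.del x).Preconnected → x = v) ∧
    v' ∈ R ∧ S.graph.Adj v v' ∧
    J.IsInducedSubdrawing S ∧ ∀ x, x ∈ J.verts ↔ x ∈ L.G.verts ∨ x = v')

end PlaneConfiguration

/-! ### Axles and their skeletons -/

/-- An axle of degree `d`.  The index `j * d + i` with `j = 0, …, 4` and `1 ≤ i ≤ d` is written
`(j, i)`, with `i` read cyclically modulo `d`; values at `j ≥ 5` are irrelevant. -/
structure Axle (d : ℕ) where
  /-- lower bounds -/
  lower : ℕ → ZMod d → ℕ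
  /-- upper bounds -/
  upper : ℕ → ZMod d → ℕ
  lower_le_upper : ∀ j < 5, ∀ i, lower j i ≤ upper j i
  lower_mem : ∀ j < 5, ∀ i, lower j i ∈ ({5, 6, 7, 8, 9} : Set ℕ)
  upper_mem : ∀ j < 5, ∀ i, upper j i ∈ ({5, 6, 7, 8, 12} : Set ℕ)
  fan_trivial : ∀ i, lower 0 i ≠ upper 0 i →
    ∀ j, 2 ≤ j → j < 5 → lower j i = 5 ∧ upper j i = 12

/-- Names for the vertices of a skeleton: the hub, the spokes `rim 0 i`, the hats `rim 1 i`
(adjacent to the spokes `i` and `i + 1`), and the fan vertices `rim j i`, `j = 2, 3, 4`, over the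
spoke `i`. -/
inductive AxleVertex (d : ℕ) where
  | hub : AxleVertex d
  | rim (j : ℕ) (i : ZMod d) : AxleVertex d

namespace Axle

open AxleVertex

variable {d : ℕ}

/-- The vertices that occur in the skeleton.  A spoke with upper bound `k ≤ 8` has the `k - 5` fan
vertices `rim 2 i, …, rim (k - 4) i`; a spoke with upper bound `12` has none. -/
def skeletonVerts (A : Axle d) : Set (AxleVertex d) :=
  {x | x = hub ∨ ∃ j i, x = rim j i ∧
    (j < 2 ∨ (2 ≤ j ∧ A.upper 0 i ≤ 8 ∧ j + 4 ≤ A.upper 0 i))}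

/-- The finite triangles of the skeleton, in clockwise order.  If the spoke `i` has upper bound
`k ≤ 8`, then its neighbours besides the hub and the spokes `i - 1` and `i + 1` form the path
`rim 1 (i - 1), rim 2 i, …, rim (k - 4) i, rim 1 i`. -/
inductive SkeletonTriangle (A : Axle d) : AxleVertex d → AxleVertex d → AxleVertex d → Prop
  | hub (i : ZMod d) : SkeletonTriangle A hub (rim 0 i) (rim 0 (i + 1))
  | hat (i : ZMod d) : SkeletonTriangle A (rim 0 (i + 1)) (rim 0 i) (rim 1 i)
  | noFan (i : ZMod d) : A.upper 0 i = 5 →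
      SkeletonTriangle A (rim 0 i) (rim 1 (i - 1)) (rim 1 i)
  | fanFirst (i : ZMod d) : 6 ≤ A.upper 0 i → A.upper 0 i ≤ 8 →
      SkeletonTriangle A (rim 0 i) (rim 1 (i - 1)) (rim 2 i)
  | fanMiddle (i : ZMod d) (j : ℕ) : 2 ≤ j → j + 5 ≤ A.upper 0 i → A.upper 0 i ≤ 8 →
      SkeletonTriangle A (rim 0 i) (rim j i) (rim (j + 1) i)
  | fanLast (i : ZMod d) (j : ℕ) : 2 ≤ j → j + 4 = A.upper 0 i → A.upper 0 i ≤ 8 →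
      SkeletonTriangle A (rim 0 i) (rim j i) (rim 1 i)
  | rotate (x y z : AxleVertex d) : SkeletonTriangle A x y z → SkeletonTriangle A y z x

/-- The degrees prescribed by the skeleton. -/
def skeletonGamma (A : Axle d) : AxleVertex d → ℕ
  | hub => d
  | rim j i => A.upper j i

end Axle

/-- The configuration `K` is the skeleton of the axle `A`; `lab` says which vertex of `K` is the
hub, which are the spokes, the hats and the fan vertices. -/
structure IsSkeleton {β : Type*} {d : ℕ} (K : PlaneConfiguration β) (A : Axle d)
    (lab : AxleVertex d → β) : Prop where
  bijOn : Set.BijOn lab A.skeletonVerts K.G.verts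
  adj_iff : ∀ x ∈ A.skeletonVerts, ∀ y ∈ A.skeletonVerts,
    (K.G.graph.Adj (lab x) (lab y) ↔ ∃ z, A.SkeletonTriangle x y z ∨ A.SkeletonTriangle y x z)
  triangle_iff : ∀ x ∈ A.skeletonVerts, ∀ y ∈ A.skeletonVerts, ∀ z ∈ A.skeletonVerts,
    (K.G.ClockwiseTriangle (lab x) (lab y) (lab z) ↔ A.SkeletonTriangle x y z)
  gamma_eq : ∀ x ∈ A.skeletonVerts, K.γ (lab x) = A.skeletonGamma x

/-- A subconfiguration `K₀` of a skeleton with vertices named by `lab` is well-positioned: for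
every spoke that is not in `K₀`, at least one of the two hats adjacent to it is not in `K₀`. -/
def WellPositioned {β : Type*} {d : ℕ} (lab : AxleVertex d → β) (K₀ : PlaneConfiguration β) :
    Prop :=
  ∀ i : ZMod d, lab (.rim 0 i) ∉ K₀.G.verts →
    lab (.rim 1 (i - 1)) ∉ K₀.G.verts ∨ lab (.rim 1 i) ∉ K₀.G.verts

namespace PlaneDrawing

variable {α β : Type*}

/-! ### Walking around vertices and regions -/

/-! The topological input is a Jordan curve theorem over the field with two elements. Euler's
formula makes the sequence regions → edges → vertices exact at the edges, so every even set of edges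
is the boundary of a set of regions (`exists_coloring`). Applied to a path in a connected subgraph
`H` closed up by a chord, this gives a two-colouring of the regions that changes across an edge
outside `H` only at the chord. Normalised to vanish on the infinite region, it says what is inside
the chord (`IsChordColoring`). Only the exterior of `H` matters, that is, the part of the plane in
the infinite region of `H`. There the insides of chords on a common triangle are nested
(`le_of_eq_one`), and the insides of the three sides of a triangle add up to that triangle
(`triangle_sum`). These two facts drive both inductions below.

The first induction shows that `f` respects all finite triangles of `J`, not only those of `J'`
(`clockwiseTriangle_of_spanning`). Take a chord of `J'` with smallest inside containing a bad
triangle. By minimality the bad triangle is the one at the chord itself. At its third vertex `b`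
every other corner is good and finite: since `J'` is 2-connected, `b` has only one corner on the
infinite region of `J'`, and all of this corner is inside the chord. Hence `b` is interior in `J`
and has the prescribed degree. Its image then has too many neighbours to lie on the infinite region
of `K`, so the images of the neighbours of `b` are all the neighbours of `f b`. All but one step of
the rotation there is known, which forces the last step and the last triangle
(`clockwiseTriangle_of_forall_ne`).

Now `K₀` is the image of `L`, and it is a subdrawing because rotations agree up to first returns and
finite triangles go to finite triangles (`isSubdrawing_of_firstHit`).

The second induction shows that `K₀` is induced (`adj_of_forall_not_clockwiseTriangle`). Take a
chord of `K₀` with smallest inside, and the triangle on its inner side. If the third vertex is in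
`K₀`, the other two sides are edges of `K₀` by minimality, and an outer corner of `K₀` is filled by
a finite triangle of `K`; a degree count at that corner excludes this
(`Enhances.not_clockwiseTriangle`). Otherwise the chord encloses a nonempty set of interior vertices
of `K` outside `K₀`. In a skeleton such a set can contain only the hub and spokes.
Well-positionedness excludes the spokes, and the hub is excluded because radius two without the hub
reaches at most five spokes (`eq_empty_of_wellPositioned`). -/

theorem faceNext_injective (rot : α → Equiv.Perm α) : Function.Injective (faceNext rot) := by
  rintro ⟨a, b⟩ ⟨a', b'⟩ h
  simp only [faceNext, Prod.mk.injEq] at h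
  obtain ⟨rfl, h⟩ := h
  rw [(rot b).injective h]

theorem mem_verts_left (G : PlaneDrawing α) {u v : α} (h : G.graph.Adj u v) : u ∈ G.verts :=
  G.mem_verts u v h

theorem mem_verts_right (G : PlaneDrawing α) {u v : α} (h : G.graph.Adj u v) : v ∈ G.verts :=
  G.mem_verts v u h.symm

theorem adj_rot_iff (G : PlaneDrawing α) {u v : α} :
    G.graph.Adj u (G.rot u v) ↔ G.graph.Adj u v :=
  (G.rot_cycle u).apply_mem_iff

theorem adj_rot (G : PlaneDrawing α) {u v : α} (h : G.graph.Adj u v) :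
    G.graph.Adj u (G.rot u v) :=
  G.adj_rot_iff.2 h

theorem adj_faceNext (G : PlaneDrawing α) {u v : α} (h : G.graph.Adj u v) :
    G.graph.Adj (faceNext G.rot (u, v)).1 (faceNext G.rot (u, v)).2 :=
  G.adj_rot h.symm

theorem neighborSet_subset (G : PlaneDrawing α) (u : α) :
    G.graph.neighborSet u ⊆ (G.verts : Set α) :=
  fun _ h => G.mem_verts_right h

theorem neighborSet_finite (G : PlaneDrawing α) (u : α) : (G.graph.neighborSet u).Finite :=
  G.verts.finite_toSet.subset (G.neighborSet_subset u)

theorem exists_rot_pow (G : PlaneDrawing α) {u v w : α} (hv : G.graph.Adj u v)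
    (hw : G.graph.Adj u w) : ∃ n : ℕ, (G.rot u ^ n) v = w :=
  (G.rot_cycle u).exists_pow_eq' (G.neighborSet_finite u) hv hw

theorem adj_rot_pow (G : PlaneDrawing α) {u v : α} (hv : G.graph.Adj u v) (n : ℕ) :
    G.graph.Adj u ((G.rot u ^ n) v) := by
  induction n with
  | zero => simpa using hv
  | succ n ih => rw [pow_succ']; exact G.adj_rot ih

/-- The edges of `G`, each with its two directions of traversal. -/
def darts (G : PlaneDrawing α) : Set (α × α) := {e | G.graph.Adj e.1 e.2}

theorem darts_finite (G : PlaneDrawing α) : G.darts.Finite := by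
  refine (G.verts.finite_toSet.prod G.verts.finite_toSet).subset ?_
  rintro ⟨u, v⟩ h
  exact ⟨G.mem_verts_left h, G.mem_verts_right h⟩

theorem mapsTo_faceNext (G : PlaneDrawing α) :
    Set.MapsTo (faceNext G.rot) G.darts G.darts :=
  fun _ h => G.adj_faceNext h

/-- An injective self-map of the finite set of darts has only periodic points. This makes lying on
the same boundary walk a symmetric relation. -/
theorem exists_period (G : PlaneDrawing α) {e : α × α} (he : e ∈ G.darts) :
    ∃ n > 0, (faceNext G.rot)^[n] e = e := by
  have : Finite G.darts := G.darts_finite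
  have hinj : Function.Injective (G.mapsTo_faceNext.restrict) :=
    G.mapsTo_faceNext.restrict_inj.2 (faceNext_injective _).injOn
  obtain ⟨n, hn, h⟩ := Function.mem_periodicPts.1 (hinj.mem_periodicPts ⟨e, he⟩)
  refine ⟨n, hn, ?_⟩
  have := congrArg Subtype.val h
  rwa [Set.MapsTo.iterate_restrict] at this

theorem mem_regionOf_self (rot : α → Equiv.Perm α) (e : α × α) : e ∈ regionOf rot e := ⟨0, rfl⟩

theorem faceNext_mem_regionOf {rot : α → Equiv.Perm α} {e e' : α × α}
    (h : e' ∈ regionOf rot e) : faceNext rot e' ∈ regionOf rot e := by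
  obtain ⟨n, rfl⟩ := h
  exact ⟨n + 1, by rw [Function.iterate_succ_apply']⟩

theorem mem_darts_of_mem_regionOf (G : PlaneDrawing α) {e e' : α × α} (he : e ∈ G.darts)
    (h : e' ∈ regionOf G.rot e) : e' ∈ G.darts := by
  obtain ⟨n, rfl⟩ := h
  exact G.mapsTo_faceNext.iterate n he

theorem regionOf_subset {rot : α → Equiv.Perm α} {e e' : α × α}
    (h : e' ∈ regionOf rot e) : regionOf rot e' ⊆ regionOf rot e := by
  obtain ⟨n, rfl⟩ := h
  rintro _ ⟨m, rfl⟩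
  exact ⟨m + n, by rw [Function.iterate_add_apply]⟩

theorem mem_regionOf_symm (G : PlaneDrawing α) {e e' : α × α} (he : e ∈ G.darts)
    (h : e' ∈ regionOf G.rot e) : e ∈ regionOf G.rot e' := by
  obtain ⟨n, rfl⟩ := h
  obtain ⟨p, hp, hpe⟩ := G.exists_period he
  have hk : ∀ k, (faceNext G.rot)^[k * p] e = e := by
    intro k
    rw [mul_comm, Function.iterate_mul]
    exact Function.iterate_fixed hpe k
  -- Complete the `n` steps to `n` full periods; `n * p ≥ n` keeps the subtraction honest.
  refine ⟨n * p - n, ?_⟩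
  rw [← Function.iterate_add_apply, Nat.sub_add_cancel (Nat.le_mul_of_pos_right n hp), hk]

theorem regionOf_eq (G : PlaneDrawing α) {e e' : α × α} (he : e ∈ G.darts)
    (h : e' ∈ regionOf G.rot e) : regionOf G.rot e' = regionOf G.rot e :=
  (regionOf_subset h).antisymm (regionOf_subset (G.mem_regionOf_symm he h))

theorem regionOf_faceNext (G : PlaneDrawing α) {e : α × α} (he : e ∈ G.darts) :
    regionOf G.rot (faceNext G.rot e) = regionOf G.rot e :=
  G.regionOf_eq he (faceNext_mem_regionOf (mem_regionOf_self _ _))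

theorem outer_subset_darts (G : PlaneDrawing α) : G.outer ⊆ G.darts := by
  rcases G.outer_region with ⟨-, h⟩ | ⟨u, v, h, h'⟩
  · simp [h]
  · rw [h']
    exact fun e he => G.mem_darts_of_mem_regionOf h he

theorem adj_of_mem_outer (G : PlaneDrawing α) {u v : α} (h : (u, v) ∈ G.outer) :
    G.graph.Adj u v :=
  G.outer_subset_darts h

theorem outer_eq_regionOf (G : PlaneDrawing α) {e : α × α} (he : e ∈ G.outer) :
    G.outer = regionOf G.rot e := by
  rcases G.outer_region with ⟨-, h⟩ | ⟨u, v, h, h'⟩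
  · simp [h] at he
  · rw [h'] at he ⊢
    exact (G.regionOf_eq h he).symm

theorem faceNext_mem_outer (G : PlaneDrawing α) {e : α × α} (he : e ∈ G.outer) :
    faceNext G.rot e ∈ G.outer := by
  rw [G.outer_eq_regionOf he]
  exact faceNext_mem_regionOf (mem_regionOf_self _ _)

theorem mem_outer_of_faceNext (G : PlaneDrawing α) {u v : α} (h : G.graph.Adj u v)
    (he : faceNext G.rot (u, v) ∈ G.outer) : (u, v) ∈ G.outer := by
  rw [G.outer_eq_regionOf he]
  exact G.mem_regionOf_symm (e := (u, v)) h (faceNext_mem_regionOf (mem_regionOf_self _ _))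

theorem outer_nonempty (G : PlaneDrawing α) {u v : α} (h : G.graph.Adj u v) :
    G.outer.Nonempty := by
  rcases G.outer_region with ⟨h', -⟩ | ⟨u, v, -, h'⟩
  · rw [h'] at h
    exact h.elim
  · rw [h']
    exact ⟨_, mem_regionOf_self _ _⟩

/-- Every vertex of a drawing with an edge has a neighbour. -/
theorem exists_adj (G : PlaneDrawing α) (hG : G.graph ≠ ⊥) {v : α} (hv : v ∈ G.verts) :
    ∃ w, G.graph.Adj v w := by
  obtain ⟨a, b, hab⟩ := SimpleGraph.ne_bot_iff_exists_adj.1 hG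
  have ha := G.mem_verts_left hab
  by_cases h : v = a
  · exact ⟨b, h ▸ hab⟩
  · have hr := G.connected.preconnected ⟨v, hv⟩ ⟨a, ha⟩
    obtain ⟨p⟩ := hr
    cases p with
    | nil => exact absurd rfl h
    | cons h' _ => exact ⟨_, h'⟩

namespace ClockwiseTriangle

variable {G : PlaneDrawing α} {u v w : α}

theorem adj (h : G.ClockwiseTriangle u v w) : G.graph.Adj u v := h.1

theorem rot_eq (h : G.ClockwiseTriangle u v w) : G.rot v u = w := by
  have := h.2.2.1
  simpa [faceNext] using this

theorem notMem_outer (h : G.ClockwiseTriangle u v w) : (u, v) ∉ G.outer := h.2.1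

theorem rotate (h : G.ClockwiseTriangle u v w) : G.ClockwiseTriangle v w u := by
  obtain ⟨h1, h2, h3, h4, h5⟩ := h
  have h6 := G.adj_faceNext h1
  rw [h3] at h6
  refine ⟨h6, fun h => h2 ?_, h4, h5, h3⟩
  exact G.mem_outer_of_faceNext h1 (by rwa [h3])

theorem mk' (h1 : G.graph.Adj u v) (h2 : (u, v) ∉ G.outer) (h3 : G.rot v u = w)
    (h4 : G.rot w v = u) (h5 : G.rot u w = v) : G.ClockwiseTriangle u v w :=
  ⟨h1, h2, by simp [faceNext, h3], by simp [faceNext, h4], by simp [faceNext, h5]⟩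

theorem ne (h : G.ClockwiseTriangle u v w) : u ≠ v ∧ v ≠ w ∧ w ≠ u :=
  ⟨h.adj.ne, h.rotate.adj.ne, h.rotate.rotate.adj.ne⟩

theorem mem_regionOf_iff (h : G.ClockwiseTriangle u v w) {e : α × α} :
    e ∈ regionOf G.rot (u, v) ↔ e = (u, v) ∨ e = (v, w) ∨ e = (w, u) := by
  constructor
  · rintro ⟨n, rfl⟩
    induction n with
    | zero => simp
    | succ n ih =>
      rw [Function.iterate_succ_apply']
      rcases ih with ih | ih | ih <;> rw [ih]
      · exact .inr (.inl h.2.2.1)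
      · exact .inr (.inr h.2.2.2.1)
      · exact .inl h.2.2.2.2
  · have h1 := mem_regionOf_self G.rot (u, v)
    have h2 := faceNext_mem_regionOf h1
    have h3 := faceNext_mem_regionOf h2
    rw [h.2.2.1] at h2 h3
    rw [h.2.2.2.1] at h3
    rintro (rfl | rfl | rfl) <;> assumption

end ClockwiseTriangle

theorem NearTriangulation.triangle {G : PlaneDrawing α} (hG : G.NearTriangulation) {u v : α}
    (h : G.graph.Adj u v) (h' : (u, v) ∉ G.outer) : G.ClockwiseTriangle u v (G.rot v u) := by
  obtain ⟨w, hw⟩ := hG u v h h'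
  rwa [hw.rot_eq]

/-- A vertex with a neighbour lies on the infinite region when some dart into it does. -/
theorem onInfinite_of_mem_outer (G : PlaneDrawing α) {u v : α} (h : (u, v) ∈ G.outer) :
    G.OnInfinite v :=
  ⟨G.mem_verts_right (G.adj_of_mem_outer h), .inl ⟨_, G.faceNext_mem_outer h⟩⟩

theorem not_onInfinite_iff (G : PlaneDrawing α) {v : α} (hG : G.graph ≠ ⊥) (hv : v ∈ G.verts) :
    ¬ G.OnInfinite v ↔ ∀ u, (u, v) ∉ G.outer := by
  constructor
  · exact fun h u hu => h (G.onInfinite_of_mem_outer hu)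
  · rintro h ⟨-, ⟨w, hw⟩ | hw⟩
    · apply h ((G.rot v).symm w)
      have had := G.adj_of_mem_outer hw
      refine G.mem_outer_of_faceNext ?_ (by simpa [faceNext] using hw)
      exact (G.adj_rot_iff.1 (by simpa using had)).symm
    · obtain ⟨w, hw'⟩ := G.exists_adj hG hv
      exact hw w hw'

end PlaneDrawing

namespace PlaneDrawing

variable {α β : Type*}

/-! ### Euler's formula as exactness -/

/-- A function of the vertices that agrees at the ends of every edge is constant. -/
theorem eq_of_forall_adj (G : PlaneDrawing α) {γ : Type*} (φ : α → γ)
    (h : ∀ u v, G.graph.Adj u v → φ u = φ v) {u v : α} (hu : u ∈ G.verts) (hv : v ∈ G.verts) :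
    φ u = φ v := by
  obtain ⟨p⟩ := G.connected.preconnected ⟨u, hu⟩ ⟨v, hv⟩
  have : ∀ x y : (G.verts : Set α), (G.graph.induce (G.verts : Set α)).Walk x y →
      φ x = φ y := by
    intro x y p
    induction p with
    | nil => rfl
    | cons h' _ ih => exact (h _ _ h').trans ih
  exact this _ _ p

/-- A function on the darts that is constant along the boundaries of regions and across edges is
constant. -/
theorem eq_of_forall_dart (G : PlaneDrawing α) {γ : Type*} (φ : α × α → γ)
    (h1 : ∀ u v, G.graph.Adj u v → φ (faceNext G.rot (u, v)) = φ (u, v))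
    (h2 : ∀ u v, G.graph.Adj u v → φ (u, v) = φ (v, u))
    {e e' : α × α} (he : e ∈ G.darts) (he' : e' ∈ G.darts) : φ e = φ e' := by
  classical
  have hpow : ∀ u v, G.graph.Adj u v → ∀ n : ℕ, φ (u, (G.rot u ^ n) v) = φ (u, v) := by
    intro u v huv n
    induction n with
    | zero => rfl
    | succ n ih =>
      rw [← ih, pow_succ']
      have := G.adj_rot_pow huv n
      rw [h2 _ _ this, ← h1 _ _ this.symm]
      rfl
  have hv : ∀ u v w, G.graph.Adj u v → G.graph.Adj u w → φ (u, v) = φ (u, w) := by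
    intro u v w huv huw
    obtain ⟨n, rfl⟩ := G.exists_rot_pow huv huw
    exact (hpow u v huv n).symm
  -- All darts leaving `u` have the same value, so `φ` descends to vertices and connectedness
  -- applies. The value at isolated vertices is irrelevant.
  let ψ : α → γ := fun u => if h : ∃ v, G.graph.Adj u v then φ (u, h.choose) else φ e
  have hψ : ∀ u v, G.graph.Adj u v → ψ u = φ (u, v) := by
    intro u v huv
    have h : ∃ v, G.graph.Adj u v := ⟨v, huv⟩
    simp only [ψ, dif_pos h]
    exact hv _ _ _ h.choose_spec huv
  have := G.eq_of_forall_adj ψ (fun u v huv => by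
    rw [hψ u v huv, hψ v u huv.symm, h2 u v huv]) (G.mem_verts_left he) (G.mem_verts_left he')
  rwa [hψ _ _ he, hψ _ _ he'] at this

theorem finite_edgeSet (G : PlaneDrawing α) : G.graph.edgeSet.Finite := by
  refine (G.darts_finite.image (fun e => s(e.1, e.2))).subset ?_
  intro e
  induction e with
  | _ u v => exact fun h => ⟨(u, v), h, rfl⟩

theorem finite_regions (G : PlaneDrawing α) : (regions G.graph G.rot).Finite := by
  refine (G.darts_finite.image (fun e => regionOf G.rot e)).subset ?_
  rintro _ ⟨u, v, h, rfl⟩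
  exact ⟨(u, v), h, rfl⟩

open Classical in
/-- The vertex-edge incidence matrix. -/
noncomputable def incidence (G : PlaneDrawing α) :
    Matrix G.verts G.graph.edgeSet (ZMod 2) :=
  fun v e => if (v : α) ∈ (e : Sym2 α) then 1 else 0

/-- The boundary of a chain of regions. -/
noncomputable def regionBoundary (G : PlaneDrawing α) :
    (regions G.graph G.rot → ZMod 2) →ₗ[ZMod 2] (G.graph.edgeSet → ZMod 2) where
  toFun g e := g ⟨regionOf G.rot ((e : Sym2 α).out), by
      refine ⟨_, _, ?_, rfl⟩
      have := e.2
      rwa [← Quot.out_eq (e : Sym2 α)] at this⟩ +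
    g ⟨regionOf G.rot ((e : Sym2 α).out.swap), by
      refine ⟨_, _, ?_, rfl⟩
      have := e.2
      rw [← Quot.out_eq (e : Sym2 α)] at this
      exact G.graph.symm.symm _ _ this⟩
  map_add' g g' := by
    ext e
    simp only [Pi.add_apply]
    ring
  map_smul' c g := by
    ext e
    simp only [Pi.smul_apply, smul_eq_mul, RingHom.id_apply]
    ring

/-- The orientation of the edge chosen by `out` does not matter, since the two sides enter
symmetrically. -/
theorem regionBoundary_apply (G : PlaneDrawing α) (g : regions G.graph G.rot → ZMod 2)
    {u v : α} (h : G.graph.Adj u v) :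
    G.regionBoundary g ⟨s(u, v), h⟩ =
      g ⟨regionOf G.rot (u, v), u, v, h, rfl⟩ + g ⟨regionOf G.rot (v, u), v, u, h.symm, rfl⟩ := by
  have h1 : s((s(u, v)).out.1, (s(u, v)).out.2) = s(u, v) := Quot.out_eq _
  rw [Sym2.eq_iff] at h1
  simp only [regionBoundary, LinearMap.coe_mk, AddHom.coe_mk]
  have e1 : (s(u, v)).out = ((s(u, v)).out.1, (s(u, v)).out.2) := rfl
  rcases h1 with ⟨h1, h2⟩ | ⟨h1, h2⟩
  · congr
    · rw [e1, h1, h2]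
    · rw [e1, h1, h2]; rfl
  · rw [add_comm]
    congr
    · rw [e1, h1, h2]; rfl
    · rw [e1, h1, h2]

/-- This lets chains of edges be handled as functions of two vertices, with the boundary at a vertex
a plain sum over all vertices. -/
theorem sum_incident (G : PlaneDrawing α) [Fintype G.graph.edgeSet] (c : α → α → ZMod 2)
    (hc : ∀ u v, c u v ≠ 0 → G.graph.Adj u v)
    (x : G.graph.edgeSet → ZMod 2) (hx : ∀ u v, ∀ h : G.graph.Adj u v, x ⟨s(u, v), h⟩ = c u v)
    (v : G.verts) : (G.incidence.mulVec x) v = ∑ w ∈ G.verts, c v w := by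
  classical
  simp only [Matrix.mulVec, dotProduct, incidence, ite_mul, one_mul, zero_mul]
  rw [← Finset.sum_filter]
  have : ∑ w ∈ G.verts, c v w = ∑ w ∈ G.verts with G.graph.Adj v w, c v w := by
    rw [Finset.sum_filter]
    refine Finset.sum_congr rfl fun w _ => ?_
    split_ifs with h
    · rfl
    · by_contra h'
      exact h (hc _ _ h')
  rw [this]
  symm
  refine Finset.sum_bij (fun w hw => ⟨s((v : α), w), (Finset.mem_filter.1 hw).2⟩) ?_ ?_ ?_ ?_
  · intro w hw
    simp
  · intro w hw w' hw' h
    have := congrArg Subtype.val h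
    exact Sym2.congr_right.1 this
  · rintro ⟨e, he⟩ h
    simp only [Finset.mem_filter, Finset.mem_univ, true_and] at h
    obtain ⟨w, rfl⟩ := h
    exact ⟨w, Finset.mem_filter.2 ⟨G.mem_verts_right he, he⟩, rfl⟩
  · intro w hw
    rw [hx]

/-- Boundaries are cycles: each passage of a region through `v` enters along one dart `(w, v)` and
leaves along `(v, G.rot v w)`, so contributions at `v` cancel in pairs. -/
theorem incidence_regionBoundary (G : PlaneDrawing α) [Fintype G.graph.edgeSet]
    (g : regions G.graph G.rot → ZMod 2) : G.incidence.mulVec (G.regionBoundary g) = 0 := by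
  classical
  let g' : α × α → ZMod 2 := fun e =>
    if h : G.graph.Adj e.1 e.2 then g ⟨regionOf G.rot e, e.1, e.2, h, rfl⟩ else 0
  have hg' : ∀ u v, ∀ h : G.graph.Adj u v, g' (u, v) = g ⟨regionOf G.rot (u, v), u, v, h, rfl⟩ :=
    fun u v h => dif_pos h
  funext v
  rw [G.sum_incident (fun u v => if G.graph.Adj u v then g' (u, v) + g' (v, u) else 0)
    (fun u v h => by
      by_contra h'
      simp [h'] at h) _ (fun u v h => by
        rw [G.regionBoundary_apply g h, if_pos h, hg' u v h, hg' v u h.symm])]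
  rw [← Finset.sum_filter, Finset.sum_add_distrib]
  have : ∑ w ∈ G.verts with G.graph.Adj v w, g' (w, v) =
      ∑ w ∈ G.verts with G.graph.Adj v w, g' (v, w) := by
    refine Finset.sum_bij (fun w _ => G.rot v w) ?_ ?_ ?_ ?_
    · intro w hw
      have := G.adj_rot (Finset.mem_filter.1 hw).2
      exact Finset.mem_filter.2 ⟨G.mem_verts_right this, this⟩
    · intro w _ w' _ h
      exact (G.rot v).injective h
    · intro w hw
      have h1 := (Finset.mem_filter.1 hw).2
      have h2 : G.graph.Adj v ((G.rot v).symm w) := G.adj_rot_iff.1 (by simpa using h1)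
      exact ⟨_, Finset.mem_filter.2 ⟨G.mem_verts_right h2, h2⟩, by simp⟩
    · intro w hw
      have h1 := (Finset.mem_filter.1 hw).2
      rw [hg' _ _ h1.symm, hg' _ _ (G.adj_rot h1)]
      congr 2
      exact (G.regionOf_faceNext (e := (w, (v : α))) h1.symm).symm
  rw [this]
  exact CharTwo.add_self_eq_zero _

/-- The combinatorial Jordan curve theorem. Boundaries of region chains are cycles, and Euler's
formula leaves no room for further cycles, so the cycle `c` bounds a set of regions; `h` is its
indicator, spread over the darts. -/
theorem exists_coloring (G : PlaneDrawing α) (c : α → α → ZMod 2)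
    (hsymm : ∀ u v, c u v = c v u) (hc : ∀ u v, c u v ≠ 0 → G.graph.Adj u v)
    (hbd : ∀ u ∈ G.verts, ∑ w ∈ G.verts, c u w = 0) :
    ∃ h : α × α → ZMod 2,
      (∀ u v, G.graph.Adj u v → h (faceNext G.rot (u, v)) = h (u, v)) ∧
      ∀ u v, G.graph.Adj u v → h (u, v) + h (v, u) = c u v := by
  classical
  by_cases hbot : G.graph = ⊥
  · exact ⟨0, by simp [hbot], by simp [hbot]⟩
  have euler := G.euler.resolve_left hbot
  have := G.finite_edgeSet.fintype
  have := G.finite_regions.fintype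
  rw [Set.ncard_eq_toFinset_card', Set.ncard_eq_toFinset_card', Set.toFinset_card,
    Set.toFinset_card] at euler
  let T := G.incidence.mulVecLin
  let D := G.incidence.transpose.mulVecLin
  have hdart : ∃ u v, G.graph.Adj u v := SimpleGraph.ne_bot_iff_exists_adj.1 hbot
  -- the kernel of the coboundary consists of the constants
  have hkerD : Module.finrank (ZMod 2) (LinearMap.ker D) ≤ 1 := by
    obtain ⟨a, b, hab⟩ := hdart
    refine finrank_le_one (⟨fun _ => 1, ?_⟩ : LinearMap.ker D) ?_
    · rw [LinearMap.mem_ker]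
      funext ⟨e, he⟩
      induction e with
      | _ u v =>
        have huv : G.graph.Adj u v := he
        simp only [D, Matrix.mulVecLin_apply, Matrix.mulVec, dotProduct, Matrix.transpose_apply,
          incidence, mul_one, Pi.zero_apply]
        rw [Finset.sum_coe_sort G.verts (fun x => if x ∈ s(u, v) then (1 : ZMod 2) else 0)]
        have : ∀ x, (if x ∈ s(u, v) then (1 : ZMod 2) else 0) =
            (if x = u then 1 else 0) + (if x = v then 1 else 0) := by
          intro x
          have := huv.ne
          by_cases h1 : x = u
          · simp [h1, this]
          · by_cases h2 : x = v <;> simp [h1, h2, this.symm]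
        simp only [this, Finset.sum_add_distrib, Finset.sum_ite_eq', G.mem_verts_left huv,
          G.mem_verts_right huv, if_true]
        exact CharTwo.add_self_eq_zero _
    · rintro ⟨φ, hφ⟩
      rw [LinearMap.mem_ker] at hφ
      let φ' : α → ZMod 2 := fun x => if h : x ∈ G.verts then φ ⟨x, h⟩ else 0
      have hconst : ∀ u v, G.graph.Adj u v → φ' u = φ' v := by
        intro u v huv
        have h1 := congrFun hφ ⟨s(u, v), huv⟩
        simp only [D, Matrix.mulVecLin_apply, Matrix.mulVec, dotProduct, Matrix.transpose_apply,
          incidence, Pi.zero_apply] at h1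
        have h2 : ∀ x : G.verts, (if (x : α) ∈ s(u, v) then (1 : ZMod 2) else 0) * φ x =
            (fun x => (if x = u then φ' x else 0) + (if x = v then φ' x else 0)) (x : α) := by
          rintro ⟨x, hx⟩
          have e : φ ⟨x, hx⟩ = φ' x := by simp [φ', hx]
          simp only [Sym2.mem_iff, e]
          have := huv.ne
          by_cases h1 : x = u
          · have h2 : x ≠ v := fun h => this (h1.symm.trans h)
            simp [h1, this]
          · by_cases h2 : x = v <;> simp [h1, h2, this.symm]
        simp only [h2] at h1
        rw [Finset.sum_coe_sort G.verts
          (fun x => (if x = u then φ' x else 0) + (if x = v then φ' x else 0))] at h1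
        simp only [Finset.sum_add_distrib, Finset.sum_ite_eq', G.mem_verts_left huv,
          G.mem_verts_right huv, if_true] at h1
        exact CharTwo.add_eq_zero.1 h1
      refine ⟨φ' a, Subtype.ext ?_⟩
      funext ⟨x, hx⟩
      have := G.eq_of_forall_adj φ' hconst (G.mem_verts_left hab) hx
      simp [this, φ', hx]
  -- the kernel of the boundary of regions consists of the constants
  have hkerB : Module.finrank (ZMod 2) (LinearMap.ker G.regionBoundary) ≤ 1 := by
    obtain ⟨a, b, hab⟩ := hdart
    refine finrank_le_one (⟨fun _ => 1, ?_⟩ : LinearMap.ker G.regionBoundary) ?_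
    · rw [LinearMap.mem_ker]
      funext ⟨e, he⟩
      induction e with
      | _ u v =>
        rw [G.regionBoundary_apply _ he]
        exact CharTwo.add_self_eq_zero _
    · rintro ⟨g, hg⟩
      rw [LinearMap.mem_ker] at hg
      let g' : α × α → ZMod 2 := fun e =>
        if h : G.graph.Adj e.1 e.2 then g ⟨regionOf G.rot e, e.1, e.2, h, rfl⟩ else 0
      have hg' : ∀ u v, ∀ h : G.graph.Adj u v,
          g' (u, v) = g ⟨regionOf G.rot (u, v), u, v, h, rfl⟩ := fun u v h => dif_pos h
      refine ⟨g' (a, b), Subtype.ext ?_⟩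
      funext ⟨r, u, v, huv, hr⟩
      subst hr
      have := G.eq_of_forall_dart g' (e := (a, b)) (e' := (u, v)) (fun u v huv => by
        have h2 := G.adj_faceNext huv
        simp only [g']
        rw [dif_pos h2, dif_pos huv]
        congr 2
        exact G.regionOf_faceNext (e := (u, v)) huv) (fun u v huv => by
        have h1 := congrFun hg ⟨s(u, v), huv⟩
        rw [G.regionBoundary_apply _ huv, ← hg' _ _ huv, ← hg' _ _ huv.symm] at h1
        exact CharTwo.add_eq_zero.1 h1) hab huv
      simp [this, hg' u v huv]
  -- Row rank equals column rank, so connectedness, which bounds the kernel of the coboundary,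
  -- bounds the cycle space from above.
  have hT : Module.finrank (ZMod 2) (LinearMap.range T) =
      Module.finrank (ZMod 2) (LinearMap.range D) := (Matrix.rank_transpose G.incidence).symm
  have r1 := LinearMap.finrank_range_add_finrank_ker T
  have r2 := LinearMap.finrank_range_add_finrank_ker D
  have r3 := LinearMap.finrank_range_add_finrank_ker G.regionBoundary
  simp only [Module.finrank_fintype_fun_eq_card, Fintype.card_coe] at r1 r2 r3
  have hle : LinearMap.range G.regionBoundary ≤ LinearMap.ker T := by
    rintro _ ⟨g, rfl⟩
    exact G.incidence_regionBoundary g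
  -- With V vertices, E edges and R regions, the cycle space has dimension at most E - V + 1, which
  -- is R - 1 by Euler's formula, and the boundaries have dimension at least R - 1.
  have heq := Submodule.eq_of_le_of_finrank_le hle (by omega)
  let x : G.graph.edgeSet → ZMod 2 := fun e => c (e : Sym2 α).out.1 (e : Sym2 α).out.2
  have hx : ∀ u v, ∀ h : G.graph.Adj u v, x ⟨s(u, v), h⟩ = c u v := by
    intro u v h
    have h1 : s((s(u, v)).out.1, (s(u, v)).out.2) = s(u, v) := Quot.out_eq _
    rw [Sym2.eq_iff] at h1
    simp only [x]
    rcases h1 with ⟨h1, h2⟩ | ⟨h1, h2⟩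
    · rw [h1, h2]
    · rw [h1, h2, hsymm]
  have hxT : x ∈ LinearMap.ker T := by
    rw [LinearMap.mem_ker]
    funext v
    exact (G.sum_incident c hc x hx v).trans (hbd v v.2)
  rw [← heq] at hxT
  obtain ⟨g, hg⟩ := hxT
  let g' : α × α → ZMod 2 := fun e =>
    if h : G.graph.Adj e.1 e.2 then g ⟨regionOf G.rot e, e.1, e.2, h, rfl⟩ else 0
  have hg' : ∀ u v, ∀ h : G.graph.Adj u v,
      g' (u, v) = g ⟨regionOf G.rot (u, v), u, v, h, rfl⟩ := fun u v h => dif_pos h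
  refine ⟨g', fun u v huv => ?_, fun u v huv => ?_⟩
  · have h2 := G.adj_faceNext huv
    simp only [g']
    rw [dif_pos h2, dif_pos huv]
    congr 2
    exact G.regionOf_faceNext (e := (u, v)) huv
  · rw [hg' _ _ huv, hg' _ _ huv.symm, ← G.regionBoundary_apply g huv, hg, hx]

end PlaneDrawing

namespace PlaneDrawing

variable {α β : Type*}

/-! ### Cycles and the regions they separate -/

open Classical in
theorem sum_edge_indicator (V : Finset α) {x y : α} (hx : x ∈ V) (hy : y ∈ V) (hne : x ≠ y)
    (u : α) : ∑ w ∈ V, (if s(u, w) = s(x, y) then (1 : ZMod 2) else 0) =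
      (if u = x then 1 else 0) + (if u = y then 1 else 0) := by
  have : ∀ w, (if s(u, w) = s(x, y) then (1 : ZMod 2) else 0) =
      (if w = y then if u = x then 1 else 0 else 0) +
      (if w = x then if u = y then 1 else 0 else 0) := by
    intro w
    simp only [Sym2.eq_iff]
    by_cases h1 : u = x
    · have h2 : u ≠ y := fun h => hne (h1.symm.trans h)
      simp [h1, hne]
    · by_cases h2 : u = y <;> simp [h1, h2, hne.symm]
  simp only [this, Finset.sum_add_distrib, Finset.sum_ite_eq', hx, hy, if_true]

-- A path from `a` to `b`, taken mod 2: each step adds one edge and moves one end of the boundary.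
-- Only the support and the boundary of the chain are needed, so the path need not be simple.
open Classical in
theorem exists_chain (V : Finset α) (R : α → α → Prop)
    (hR : ∀ u v, R u v → u ∈ V ∧ v ∈ V ∧ u ≠ v) {a b : α} (h : Relation.ReflTransGen R a b) :
    ∃ c : α → α → ZMod 2, (∀ u v, c u v = c v u) ∧ (∀ u v, c u v ≠ 0 → R u v ∨ R v u) ∧
      ∀ u, ∑ w ∈ V, c u w = (if u = a then 1 else 0) + (if u = b then 1 else 0) := by
  induction h with
  | refl => exact ⟨0, by simp, by simp, fun u => by simp [CharTwo.add_self_eq_zero]⟩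
  | @tail x y _ hxy ih =>
    obtain ⟨c, h1, h2, h3⟩ := ih
    obtain ⟨hx, hy, hne⟩ := hR _ _ hxy
    refine ⟨fun u v => c u v + if s(u, v) = s(x, y) then 1 else 0, fun u v => ?_,
      fun u v h => ?_, fun u => ?_⟩
    · simp only [h1 u v, Sym2.eq_swap (a := u)]
    · by_cases hs : s(u, v) = s(x, y)
      · rcases Sym2.eq_iff.1 hs with ⟨rfl, rfl⟩ | ⟨rfl, rfl⟩
        · exact .inl hxy
        · exact .inr hxy
      · exact h2 u v (by simpa [hs] using h)
    · rw [Finset.sum_add_distrib, h3, add_assoc, sum_edge_indicator V hx hy hne,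
        ← add_assoc (if u = x then (1 : ZMod 2) else 0), CharTwo.add_self_eq_zero, zero_add]

theorem reflTransGen_adj (G : PlaneDrawing α) {u v : α} (hu : u ∈ G.verts) (hv : v ∈ G.verts) :
    Relation.ReflTransGen G.graph.Adj u v := by
  have := G.connected.preconnected ⟨u, hu⟩ ⟨v, hv⟩
  rw [SimpleGraph.reachable_iff_reflTransGen] at this
  exact this.lift Subtype.val fun _ _ h => h

open Classical in
/-- A chord `ac` of a connected subgraph `H` separates the regions of `G` into two classes, so that
an edge that is not in `H` lies between the two classes only if it is the chord. -/
theorem exists_chord_coloring (G H : PlaneDrawing α) (hle : H.graph ≤ G.graph) {a c : α}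
    (ha : a ∈ H.verts) (hc : c ∈ H.verts) (hac : G.graph.Adj a c) (hn : ¬ H.graph.Adj a c) :
    ∃ h : α × α → ZMod 2,
      (∀ u v, G.graph.Adj u v → h (faceNext G.rot (u, v)) = h (u, v)) ∧
      ∀ u v, G.graph.Adj u v → ¬ H.graph.Adj u v →
        h (u, v) + h (v, u) = if s(u, v) = s(a, c) then 1 else 0 := by
  obtain ⟨z, h1, h2, h3⟩ := exists_chain G.verts H.graph.Adj (fun u v h =>
    ⟨G.mem_verts_left (hle h), G.mem_verts_right (hle h), h.ne⟩) (H.reflTransGen_adj ha hc)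
  have h2' : ∀ u v, z u v ≠ 0 → H.graph.Adj u v := fun u v h =>
    (h2 u v h).elim id fun h => h.symm
  obtain ⟨h, ha, hb⟩ := G.exists_coloring (fun u v => z u v + if s(u, v) = s(a, c) then 1 else 0)
    (fun u v => by rw [h1, Sym2.eq_swap]) (fun u v h => by
      by_cases hs : s(u, v) = s(a, c)
      · rcases Sym2.eq_iff.1 hs with ⟨rfl, rfl⟩ | ⟨rfl, rfl⟩
        · exact hac
        · exact hac.symm
      · exact hle (h2' u v (by simpa [hs] using h))) (fun u _ => by
      rw [Finset.sum_add_distrib, h3,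
        sum_edge_indicator G.verts (G.mem_verts_left hac) (G.mem_verts_right hac) hac.ne]
      exact CharTwo.add_self_eq_zero _)
  refine ⟨h, ha, fun u v huv hn => ?_⟩
  rw [hb u v huv, add_eq_right]
  by_contra h
  exact hn (h2' u v h)

/-- A vertex whose deletion does not disconnect the drawing occurs only once on the boundary of
each region. -/
theorem eq_of_regionOf_eq (G : PlaneDrawing α) {b v v' : α} (hb : (G.del b).Preconnected)
    (hv : G.graph.Adj v b) (hv' : G.graph.Adj v' b)
    (h : regionOf G.rot (v, b) = regionOf G.rot (v', b)) : v = v' := by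
  classical
  by_contra hne
  have hr := hb ⟨v', G.mem_verts_left hv', hv'.ne⟩ ⟨v, G.mem_verts_left hv, hv.ne⟩
  rw [SimpleGraph.reachable_iff_reflTransGen] at hr
  have hr : Relation.ReflTransGen (fun x y => G.graph.Adj x y ∧ x ≠ b ∧ y ≠ b) v' v :=
    hr.lift Subtype.val fun x y h => ⟨h, x.2.2, y.2.2⟩
  obtain ⟨z, h1, h2, h3⟩ := exists_chain G.verts _ (fun u v h =>
    ⟨G.mem_verts_left h.1, G.mem_verts_right h.1, h.1.ne⟩) hr
  have h2' : ∀ u v, z u v ≠ 0 → G.graph.Adj u v ∧ u ≠ b := fun u v h =>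
    (h2 u v h).elim (fun h => ⟨h.1, h.2.1⟩) fun h => ⟨h.1.symm, h.2.2⟩
  have hmb := G.mem_verts_right hv
  -- The closed curve goes from `v'` to `v` avoiding `b` and returns through `b`. It separates the
  -- two corners at `b`, which would be impossible if they belonged to one region.
  obtain ⟨g, ha, hb⟩ := G.exists_coloring (fun x y => z x y +
      ((if s(x, y) = s(b, v) then 1 else 0) + if s(x, y) = s(b, v') then 1 else 0))
    (fun u v => by rw [h1, Sym2.eq_swap]) (fun x y h => by
      by_cases hs : s(x, y) = s(b, v)
      · rcases Sym2.eq_iff.1 hs with ⟨rfl, rfl⟩ | ⟨rfl, rfl⟩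
        · exact hv.symm
        · exact hv
      · by_cases hs' : s(x, y) = s(b, v')
        · rcases Sym2.eq_iff.1 hs' with ⟨rfl, rfl⟩ | ⟨rfl, rfl⟩
          · exact hv'.symm
          · exact hv'
        · exact (h2' x y (by simpa [hs, hs'] using h)).1) (fun u _ => by
      rw [Finset.sum_add_distrib, Finset.sum_add_distrib, h3,
        sum_edge_indicator G.verts hmb (G.mem_verts_left hv) hv.ne.symm,
        sum_edge_indicator G.verts hmb (G.mem_verts_left hv') hv'.ne.symm]
      generalize (if u = v' then (1 : ZMod 2) else 0) = p
      generalize (if u = v then (1 : ZMod 2) else 0) = q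
      generalize (if u = b then (1 : ZMod 2) else 0) = r
      revert p q r
      decide)
  have hconst : ∀ e e', G.graph.Adj e.1 e.2 → e' ∈ regionOf G.rot e → g e' = g e := by
    rintro e _ he ⟨n, rfl⟩
    induction n with
    | zero => rfl
    | succ n ih =>
      rw [← ih, Function.iterate_succ_apply']
      exact ha _ _ (G.mem_darts_of_mem_regionOf he ⟨n, rfl⟩)
  have heq : g (v, b) = g (v', b) := by
    symm
    apply hconst _ _ hv
    rw [h]
    exact mem_regionOf_self _ _
  -- Turning around `b`, the colour changes only on crossing `bv` or `bv'`, as the rest of the curve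
  -- avoids `b`.
  have hstep : ∀ x, G.graph.Adj b x → g (G.rot b x, b) =
      g (x, b) + ((if G.rot b x = v then 1 else 0) + if G.rot b x = v' then 1 else 0) := by
    intro x hx
    have e1 := ha x b hx.symm
    have e2 := hb _ _ (G.adj_rot hx)
    have e3 : z b (G.rot b x) = 0 := by
      by_contra h
      exact (h2' _ _ h).2 rfl
    simp only [faceNext] at e1
    simp only [e3, Sym2.congr_right, zero_add, e1] at e2
    rw [← e2, ← add_assoc, CharTwo.add_self_eq_zero, zero_add]
  obtain ⟨n, hn⟩ := G.exists_rot_pow hv.symm hv'.symm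
  have hex : ∃ n : ℕ, (G.rot b ^ n) v = v' := ⟨n, hn⟩
  let k := Nat.find hex
  have hk : (G.rot b ^ k) v = v' := Nat.find_spec hex
  have hmin : ∀ m < k, (G.rot b ^ m) v ≠ v' := fun m hm => Nat.find_min hex hm
  -- A return to `v` before the first visit to `v'` would give an earlier visit. So the sweep from
  -- `v` to `v'` crosses the curve exactly once, at its last step.
  have hmin' : ∀ m, 0 < m → m ≤ k → (G.rot b ^ m) v ≠ v := by
    intro m h0 hm h
    apply hmin (k - m) (by omega)
    conv_lhs => rw [← h]
    rw [← Equiv.Perm.mul_apply, ← pow_add, Nat.sub_add_cancel hm, hk]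
  have hval : ∀ m < k, g ((G.rot b ^ m) v, b) = g (v, b) := by
    intro m
    induction m with
    | zero => intro _; rfl
    | succ m ih =>
      intro hm
      rw [← ih (by omega)]
      have e := hstep _ (G.adj_rot_pow hv.symm m)
      rw [← Equiv.Perm.mul_apply, ← pow_succ'] at e
      rw [e, if_neg (hmin' _ (by omega) (by omega)), if_neg (hmin _ hm), add_zero, add_zero]
  have hk0 : k ≠ 0 := by
    intro h0
    rw [h0] at hk
    exact hne hk
  obtain ⟨m, hm⟩ := Nat.exists_eq_succ_of_ne_zero hk0
  have e := hstep _ (G.adj_rot_pow hv.symm m)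
  rw [← Equiv.Perm.mul_apply, ← pow_succ', ← Nat.succ_eq_add_one, ← hm, hk,
    hval m (by omega), heq, if_neg (Ne.symm hne), if_pos rfl, zero_add] at e
  exact one_ne_zero (left_eq_add.1 e)

/-- All outer darts lie on one boundary walk, which passes a non-cut vertex only once. This is the
form in which 2-connectedness is mostly used. -/
theorem TwoConnected.eq_of_mem_outer {G : PlaneDrawing α} (hG : G.TwoConnected) {b v v' : α}
    (hv : (v, b) ∈ G.outer) (hv' : (v', b) ∈ G.outer) : v = v' := by
  have h := G.adj_of_mem_outer hv
  refine G.eq_of_regionOf_eq (hG.2 b (G.mem_verts_right h)) h (G.adj_of_mem_outer hv') ?_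
  rw [← G.outer_eq_regionOf hv, ← G.outer_eq_regionOf hv']

theorem TwoConnected.ne_bot {G : PlaneDrawing α} (hG : G.TwoConnected) : G.graph ≠ ⊥ := by
  intro h
  obtain ⟨a, ha, b, hb, hab⟩ := Finset.one_lt_card.1 (show 1 < G.verts.card by have := hG.1; omega)
  exact hab (G.eq_of_forall_adj id (by simp [h]) ha hb)

/-- In a 2-connected drawing, no vertex has just one neighbour. -/
theorem TwoConnected.rot_ne {G : PlaneDrawing α} (hG : G.TwoConnected) {u v : α}
    (h : G.graph.Adj u v) : G.rot u v ≠ v := by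
  classical
  intro hr
  have hu := G.mem_verts_left h
  have hv := G.mem_verts_right h
  have hN : ∀ w, G.graph.Adj u w → w = v := by
    intro w hw
    obtain ⟨n, rfl⟩ := G.exists_rot_pow h hw
    exact Function.IsFixedPt.perm_pow hr n
  obtain ⟨w, hw, hwu, hwv⟩ : ∃ w ∈ G.verts, w ≠ u ∧ w ≠ v := by
    by_contra! hcon
    have : G.verts ⊆ {u, v} := by
      intro w hw
      by_cases h : w = u
      · simp [h]
      · simp [hcon w hw h]
    have := (Finset.card_le_card this).trans Finset.card_le_two
    have := hG.1
    omega
  have hp := hG.2 v hv ⟨u, hu, h.ne⟩ ⟨w, hw, hwv⟩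
  obtain ⟨p⟩ := hp
  cases p with
  | nil => exact hwu rfl
  | @cons _ x _ h' _ => exact x.2.2 (hN x h')

/-- In a 2-connected drawing, every edge lies on at most one side on the infinite region. -/
theorem TwoConnected.notMem_outer {G : PlaneDrawing α} (hG : G.TwoConnected) {u v : α}
    (h : (u, v) ∈ G.outer) : (v, u) ∉ G.outer := by
  intro h'
  have had := G.adj_of_mem_outer h
  -- The boundary walk enters `v` just before `(v, u)`. By uniqueness of the outer corner it enters
  -- along `(u, v)`, so `u` would be the only neighbour of `v`.
  have : ((G.rot v).symm u, v) ∈ G.outer := by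
    refine G.mem_outer_of_faceNext ?_ (by simpa [faceNext] using h')
    exact (G.adj_rot_iff.1 (by simpa using had.symm)).symm
  have := hG.eq_of_mem_outer this h
  rw [Equiv.symm_apply_eq] at this
  exact hG.rot_ne had.symm this.symm

end PlaneDrawing

/-! ### First returns of a permutation to a set -/

/-- `w` is the first element of `N` that `σ` meets after `v`. -/
inductive FirstHit {α : Type*} (σ : Equiv.Perm α) (N : Set α) : α → α → Prop
  | hit (v : α) : σ v ∈ N → FirstHit σ N v (σ v)
  | skip (v w : α) : σ v ∉ N → FirstHit σ N (σ v) w → FirstHit σ N v w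

/-- `z` is the last element of `N` that `σ` meets up to `v`. -/
inductive LastHit {α : Type*} (σ : Equiv.Perm α) (N : Set α) (z : α) : α → Prop
  | base : z ∈ N → LastHit σ N z z
  | step (v : α) : LastHit σ N z v → σ v ∉ N → LastHit σ N z (σ v)

namespace FirstHit

variable {α β : Type*} {σ τ : Equiv.Perm α} {M N : Set α} {v w w' : α}

theorem mem (h : FirstHit σ N v w) : w ∈ N := by
  induction h with
  | hit v h => exact h
  | skip v w _ _ ih => exact ih

theorem unique (h : FirstHit σ N v w) (h' : FirstHit σ N v w') : w = w' := by
  induction h with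
  | hit v h =>
    cases h' with
    | hit _ _ => rfl
    | skip _ _ h1 _ => exact absurd h h1
  | skip v w h1 _ ih =>
    cases h' with
    | hit _ h => exact absurd h h1
    | skip _ _ _ h2 => exact ih h2

theorem iff_exists_pow : FirstHit σ N v w ↔
    ∃ n : ℕ, w = (σ ^ (n + 1)) v ∧ w ∈ N ∧ ∀ m < n, (σ ^ (m + 1)) v ∉ N := by
  constructor
  · intro h
    induction h with
    | hit v h => exact ⟨0, by simp, h, by simp⟩
    | skip v w h1 _ ih =>
      obtain ⟨n, h2, h3, h4⟩ := ih
      refine ⟨n + 1, by rw [h2, pow_succ _ (n + 1)]; rfl, h3, fun m hm => ?_⟩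
      cases m with
      | zero => simpa using h1
      | succ m =>
        rw [pow_succ]
        exact h4 m (by omega)
  · rintro ⟨n, h1, h2, h3⟩
    induction n generalizing v with
    | zero =>
      rw [h1] at h2 ⊢
      exact hit v (by simpa using h2)
    | succ n ih =>
      refine skip v w (by simpa using h3 0 (by omega)) (ih ?_ ?_)
      · rw [h1, pow_succ _ (n + 1)]; rfl
      · intro m hm
        have := h3 (m + 1) (by omega)
        rwa [pow_succ] at this

theorem exists_of_pow {n : ℕ} (hn : 0 < n) (h : (σ ^ n) v ∈ N) : ∃ w, FirstHit σ N v w := by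
  induction n generalizing v with
  | zero => omega
  | succ n ih =>
    by_cases h' : σ v ∈ N
    · exact ⟨_, hit v h'⟩
    · rcases Nat.eq_zero_or_pos n with rfl | hn'
      · simp only [zero_add, pow_one] at h
        exact absurd h h'
      · rw [pow_succ] at h
        obtain ⟨w, hw⟩ := ih hn' h
        exact ⟨w, skip v w h' hw⟩

theorem mono (hMN : M ⊆ N) (h : FirstHit σ N v w) (hw : w ∈ M) : FirstHit σ M v w := by
  induction h with
  | hit v h => exact hit v hw
  | skip v w h1 _ ih => exact skip v w (fun h => h1 (hMN h)) (ih hw)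

theorem trans (hMN : M ⊆ N) (h : FirstHit σ N v w) (hw : w ∉ M) (h' : FirstHit σ M w w') :
    FirstHit σ M v w' := by
  induction h with
  | hit v h => exact skip v w' hw h'
  | skip v w h1 _ ih => exact skip v w' (fun h => h1 (hMN h)) (ih hw h')

/-- A skipped step would make the predecessor of `w` an element outside `N`. -/
theorem eq_of_symm_mem (h : FirstHit σ N v w) (hw : σ.symm w ∈ N) : σ v = w := by
  induction h with
  | hit v h => rfl
  | skip v w h1 _ ih =>
    rw [← ih hw, Equiv.symm_apply_apply] at hw
    exact absurd hw h1

/-- If `τ` is the first return of `σ` to `N`, then first hits of a smaller set under `σ` are first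
hits under `τ`. -/
theorem of_subset (hMN : M ⊆ N) (hτ : ∀ x ∈ N, FirstHit σ N x (τ x)) (hv : v ∈ N)
    (h : FirstHit σ M v w) : FirstHit τ M v w := by
  -- The induction passes through points outside `N`, where `τ` is not controlled; there the
  -- progress of `τ` is recorded by the next element `y` of `N`.
  have key : ∀ x w, FirstHit σ M x w → ∀ y, FirstHit σ N x y →
      y = w ∨ (y ∉ M ∧ FirstHit τ M y w) := by
    intro x w h
    induction h with
    | hit x h =>
      intro y hy
      exact .inl (hy.unique (hit x (hMN h)))
    | skip x w h1 h2 ih =>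
      intro y hy
      by_cases hx : σ x ∈ N
      · have hyx := hy.unique (hit x hx)
        subst hyx
        refine .inr ⟨h1, ?_⟩
        rcases ih _ (hτ _ hx) with h | ⟨h, h'⟩
        · rw [← h]
          exact hit _ (by rw [h]; exact h2.mem)
        · exact skip _ _ h h'
      · cases hy with
        | hit _ h => exact absurd h hx
        | skip _ _ _ h => exact ih y h
  rcases key v w h _ (hτ v hv) with h' | ⟨h', h''⟩
  · rw [← h']
    exact hit _ (by rw [h']; exact h.mem)
  · exact skip _ _ h' h''

/-- First hits under `τ` are mapped to first hits under `σ` when steps of `τ` are. -/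
theorem map {f : α → β} {σ : Equiv.Perm β} (hMN : M ⊆ N) (hf : Set.InjOn f N)
    (hτ : ∀ x ∈ N, τ x ∈ N) (hτσ : ∀ x ∈ N, FirstHit σ (f '' N) (f x) (f (τ x))) (hv : v ∈ N)
    (h : FirstHit τ M v w) : FirstHit σ (f '' M) (f v) (f w) := by
  induction h with
  | hit v h => exact (hτσ v hv).mono (Set.image_mono hMN) ⟨_, h, rfl⟩
  | skip v w h1 _ ih =>
    refine (hτσ v hv).trans (Set.image_mono hMN) ?_ (ih (hτ v hv))
    rintro ⟨x, hx, hxe⟩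
    exact h1 (hf (hMN hx) (hτ v hv) hxe ▸ hx)

end FirstHit

namespace LastHit

variable {α : Type*} {σ : Equiv.Perm α} {N : Set α} {z z' v : α}

theorem mem (h : LastHit σ N z v) : z ∈ N := by
  induction h with
  | base h => exact h
  | step v _ _ ih => exact ih

theorem eq_of_mem (h : LastHit σ N z v) (hv : v ∈ N) : z = v := by
  cases h with
  | base h => rfl
  | step v _ h => exact absurd hv h

theorem unique (h : LastHit σ N z v) (h' : LastHit σ N z' v) : z = z' := by
  induction h with
  | base h => exact (h'.eq_of_mem h).symm
  | step v h1 h2 ih =>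
    generalize hx : σ v = x at h'
    cases h' with
    | base h => exact absurd (hx ▸ h) h2
    | step y h _ =>
      rw [σ.injective.eq_iff] at hx
      exact ih (hx ▸ h)

theorem exists_of_pow (n : ℕ) (hz : z ∈ N) : ∃ z', LastHit σ N z' ((σ ^ n) z) := by
  induction n with
  | zero => exact ⟨z, base hz⟩
  | succ n ih =>
    rw [pow_succ']
    by_cases h : (σ * σ ^ n) z ∈ N
    · exact ⟨_, base h⟩
    · obtain ⟨z', h'⟩ := ih
      exact ⟨z', step _ h' h⟩

theorem exists_pow (h : LastHit σ N z v) :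
    ∃ k : ℕ, v = (σ ^ k) z ∧ ∀ m, 0 < m → m ≤ k → (σ ^ m) z ∉ N := by
  induction h with
  | base h => exact ⟨0, rfl, fun m _ _ => by omega⟩
  | step v h1 h2 ih =>
    obtain ⟨k, rfl, hk⟩ := ih
    refine ⟨k + 1, by rw [pow_succ']; rfl, fun m h0 hm => ?_⟩
    rcases Nat.lt_or_ge k m with h | h
    · obtain rfl : m = k + 1 := by omega
      rw [pow_succ']
      exact h2
    · exact hk m h0 h

end LastHit

namespace PlaneDrawing

variable {α β : Type*}

/-! ### Regions of subdrawings -/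

theorem SameRegionIn.symm {G : PlaneDrawing α} {H : SimpleGraph α} {e e' : α × α}
    (h : G.SameRegionIn H e e') : G.SameRegionIn H e' e :=
  Relation.EqvGen.symm _ _ h

theorem SameRegionIn.trans {G : PlaneDrawing α} {H : SimpleGraph α} {e e' e'' : α × α}
    (h : G.SameRegionIn H e e') (h' : G.SameRegionIn H e' e'') : G.SameRegionIn H e e'' :=
  Relation.EqvGen.trans _ _ _ h h'

theorem SameRegionIn.eq_of_invariant {G : PlaneDrawing α} {H : SimpleGraph α} {γ : Type*}
    (φ : α × α → γ) (h1 : ∀ u v, G.graph.Adj u v → φ (faceNext G.rot (u, v)) = φ (u, v))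
    (h2 : ∀ u v, G.graph.Adj u v → ¬ H.Adj u v → φ (u, v) = φ (v, u)) {e e' : α × α}
    (h : G.SameRegionIn H e e') : φ e = φ e' := by
  induction h with
  | rel x y h =>
    cases h with
    | along u v h => exact (h1 u v h).symm
    | cross u v h h' => exact h2 u v h h'
  | refl x => rfl
  | symm x y _ ih => exact ih.symm
  | trans x y z _ _ ih ih' => exact ih.trans ih'

/-- A region of `G` bounded entirely by edges of `H` cannot be left, so it is already a whole region
of `H`. -/
theorem SameRegionIn.mem_regionOf {G : PlaneDrawing α} {H : SimpleGraph α} {e e' : α × α}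
    (he : e ∈ G.darts)
    (hr : ∀ u v, (u, v) ∈ regionOf G.rot e → H.Adj u v) (h : G.SameRegionIn H e e') :
    e' ∈ regionOf G.rot e := by
  have := h.eq_of_invariant (fun x => x ∈ regionOf G.rot e) (fun u v huv => propext ⟨fun h => ?_,
    faceNext_mem_regionOf⟩) (fun u v huv hn => propext ⟨fun h => absurd (hr u v h) hn,
    fun h => absurd (hr v u h).symm hn⟩)
  · exact this.mp (mem_regionOf_self _ _)
  · rw [← G.regionOf_eq he h]
    refine G.mem_regionOf_symm (e := (u, v)) huv ?_
    exact faceNext_mem_regionOf (mem_regionOf_self _ _)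

theorem SameRegionIn.along {G : PlaneDrawing α} {H : SimpleGraph α} {u v : α}
    (h : G.graph.Adj u v) : G.SameRegionIn H (u, v) (v, G.rot v u) :=
  .rel _ _ (.along u v h)

theorem SameRegionIn.cross {G : PlaneDrawing α} {H : SimpleGraph α} {u v : α}
    (h : G.graph.Adj u v) (h' : ¬ H.Adj u v) : G.SameRegionIn H (u, v) (v, u) :=
  .rel _ _ (.cross u v h h')

/-- The sweep around `b` up to the next neighbour in `H` crosses only edges outside `H`. Hence a
step of the boundary walk of `H` stays in one region of `H`. -/
theorem SameRegionIn.of_firstHit {G : PlaneDrawing α} {H : SimpleGraph α} {b v w : α}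
    (hv : G.graph.Adj b v) (h : FirstHit (G.rot b) (H.neighborSet b) v w) :
    G.SameRegionIn H (v, b) (b, w) := by
  induction h with
  | hit v h => exact .along hv.symm
  | skip v w h1 _ ih =>
    have := G.adj_rot hv
    exact ((SameRegionIn.along hv.symm).trans (.cross this h1)).trans (ih this)

theorem LastHit.adj {G : PlaneDrawing α} {N : Set α} {b z v : α}
    (hN : N ⊆ G.graph.neighborSet b) (h : LastHit (G.rot b) N z v) : G.graph.Adj b v := by
  induction h with
  | base h => exact hN h
  | step v _ _ ih => exact G.adj_rot ih

theorem SameRegionIn.of_lastHit {G : PlaneDrawing α} {H : SimpleGraph α} {b z v : α}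
    (hle : H ≤ G.graph) (h : LastHit (G.rot b) (H.neighborSet b) z v) :
    G.SameRegionIn H (z, b) (v, b) := by
  induction h with
  | base h => exact .refl _
  | step v h1 h2 ih =>
    have hv := LastHit.adj (fun _ h => hle h) h1
    exact (ih.trans (.along hv.symm)).trans (.cross (G.adj_rot hv) h2)

/-- This locates the corner of `H` at `b` that contains the corner of `G` at `(v, b)`; the corner is
named by its entering dart `(z, b)`. -/
theorem exists_lastHit (G : PlaneDrawing α) {H : SimpleGraph α} (hle : H ≤ G.graph) {b v y : α}
    (hv : G.graph.Adj b v) (hy : H.Adj b y) :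
    ∃ z, LastHit (G.rot b) (H.neighborSet b) z v := by
  obtain ⟨n, rfl⟩ := G.exists_rot_pow (hle hy) hv
  exact LastHit.exists_of_pow n hy

/-- At a vertex without edges of `H` one can turn freely, so all its corners lie in one region of
`H`. -/
theorem SameRegionIn.of_forall_not_adj {G : PlaneDrawing α} {H : SimpleGraph α} {x y y' : α}
    (hx : ∀ w, ¬ H.Adj x w) (hy : G.graph.Adj x y) (hy' : G.graph.Adj x y') :
    G.SameRegionIn H (x, y) (x, y') := by
  obtain ⟨n, rfl⟩ := G.exists_rot_pow hy hy'
  clear hy'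
  induction n with
  | zero => exact .refl _
  | succ n ih =>
    have := G.adj_rot_pow hy n
    rw [pow_succ']
    exact (ih.trans (.cross this (hx _))).trans (.along this.symm)

/-- Every region of `G` lies in the same region of `H` as a region of `G` that is incident with an
edge of `H`. -/
theorem exists_sameRegionIn_dart (G H : PlaneDrawing α) (hle : H.graph ≤ G.graph)
    (hH : H.graph ≠ ⊥) {e : α × α} (he : e ∈ G.darts) :
    ∃ d ∈ H.darts, G.SameRegionIn H.graph e d := by
  obtain ⟨a, b, hab⟩ := SimpleGraph.ne_bot_iff_exists_adj.1 hH
  have base : ∀ x y y', G.graph.Adj x y → H.graph.Adj x y' →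
      ∃ d ∈ H.darts, G.SameRegionIn H.graph (x, y) d := by
    intro x y y' hy hy'
    have h1 : G.graph.Adj x ((G.rot x).symm y) := G.adj_rot_iff.1 (by simpa using hy)
    obtain ⟨z, hz⟩ := G.exists_lastHit hle h1 hy'
    refine ⟨(z, x), hz.mem.symm, ?_⟩
    have h2 := SameRegionIn.along (G := G) (H := H.graph) h1.symm
    rw [Equiv.apply_symm_apply] at h2
    exact (h2.symm).trans ((SameRegionIn.of_lastHit hle hz).symm)
  have main : ∀ x, Relation.ReflTransGen G.graph.Adj a x → ∀ y, G.graph.Adj x y →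
      ∃ d ∈ H.darts, G.SameRegionIn H.graph (x, y) d := by
    intro x hx
    induction hx with
    | refl => exact fun y hy => base a y b hy hab
    | @tail w x _ hwx ih =>
      intro y hy
      by_cases hx : ∃ y', H.graph.Adj x y'
      · obtain ⟨y', hy'⟩ := hx
        exact base x y y' hy hy'
      · push Not at hx
        obtain ⟨d, hd, h⟩ := ih x hwx
        exact ⟨d, hd, ((SameRegionIn.of_forall_not_adj hx hy hwx.symm).trans (.cross hwx.symm (hx w))).trans h⟩
  have ha := G.mem_verts_left (hle hab)
  exact main e.1 (G.reflTransGen_adj ha (G.mem_verts_left he)) e.2 he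

/-- The region of `G` to the right of `e` lies in the same region of `H` as the infinite region. -/
def Exterior (G : PlaneDrawing α) (H : SimpleGraph α) (e : α × α) : Prop :=
  ∃ o ∈ G.outer, G.SameRegionIn H e o

theorem SameRegionIn.of_mem_regionOf {G : PlaneDrawing α} {H : SimpleGraph α} {e e' : α × α}
    (he : e ∈ G.darts) (h : e' ∈ regionOf G.rot e) : G.SameRegionIn H e e' := by
  obtain ⟨n, rfl⟩ := h
  induction n with
  | zero => exact .refl _
  | succ n ih =>
    rw [Function.iterate_succ_apply']
    exact ih.trans (.rel _ _ (.along _ _ (G.mem_darts_of_mem_regionOf he ⟨n, rfl⟩)))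

theorem Exterior.of_mem_outer {G : PlaneDrawing α} {H : SimpleGraph α} {e : α × α}
    (h : e ∈ G.outer) : G.Exterior H e :=
  ⟨e, h, .refl _⟩

theorem Exterior.congr {G : PlaneDrawing α} {H : SimpleGraph α} {e e' : α × α}
    (h : G.Exterior H e) (h' : G.SameRegionIn H e e') : G.Exterior H e' := by
  obtain ⟨o, ho, h⟩ := h
  exact ⟨o, ho, h'.symm.trans h⟩

/-- A function that is constant along regions and across the edges outside `H`, and that vanishes
on the infinite region, vanishes on the whole exterior of `H`. -/
theorem Exterior.eq_zero {G : PlaneDrawing α} {H : SimpleGraph α} {γ : Type*} [Zero γ]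
    (φ : α × α → γ) (h1 : ∀ u v, G.graph.Adj u v → φ (faceNext G.rot (u, v)) = φ (u, v))
    (h2 : ∀ u v, G.graph.Adj u v → ¬ H.Adj u v → φ (u, v) = φ (v, u))
    (h0 : ∀ o ∈ G.outer, φ o = 0) {e : α × α} (he : G.Exterior H e) : φ e = 0 := by
  obtain ⟨o, ho, h⟩ := he
  rw [h.eq_of_invariant φ h1 h2, h0 o ho]

namespace IsSubdrawing

variable {H G : PlaneDrawing α}

theorem firstHit (h : H.IsSubdrawing G) {u v : α} (huv : H.graph.Adj u v) :
    FirstHit (G.rot u) (H.graph.neighborSet u) v (H.rot u v) := by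
  obtain ⟨n, h1, h2⟩ := h.rot_eq u v huv
  exact FirstHit.iff_exists_pow.2 ⟨n, h1, H.adj_rot huv, h2⟩

theorem rot_eq_of_adj (h : H.IsSubdrawing G) {u v : α} (huv : H.graph.Adj u v)
    (h' : H.graph.Adj u (G.rot u v)) : H.rot u v = G.rot u v :=
  (h.firstHit huv).unique (.hit v h')

theorem mem_outer_iff (h : H.IsSubdrawing G) {u v : α} (huv : H.graph.Adj u v) :
    (u, v) ∈ H.outer ↔ G.Exterior H.graph (u, v) :=
  h.outer_iff u v huv

theorem mem_outer (h : H.IsSubdrawing G) {u v : α} (huv : H.graph.Adj u v)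
    (ho : (u, v) ∈ G.outer) : (u, v) ∈ H.outer :=
  (h.mem_outer_iff huv).2 (.of_mem_outer ho)

/-- A finite triangle of `G` whose edges are in `H` is a finite triangle of `H`. -/
theorem clockwiseTriangle (h : H.IsSubdrawing G) {u v w : α} (ht : G.ClockwiseTriangle u v w)
    (h1 : H.graph.Adj u v) (h2 : H.graph.Adj v w) (h3 : H.graph.Adj w u) :
    H.ClockwiseTriangle u v w := by
  have ht' := ht.rotate
  have ht'' := ht'.rotate
  refine .mk' h1 ?_ ?_ ?_ ?_
  · rw [h.mem_outer_iff h1]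
    rintro ⟨o, ho, hs⟩
    exact ht.notMem_outer (by
      rw [G.outer_eq_regionOf ho]
      exact G.mem_regionOf_symm ht.adj (hs.mem_regionOf ht.adj (by
        intro x y hxy
        rcases ht.mem_regionOf_iff.1 hxy with hxy | hxy | hxy <;> cases hxy <;> assumption)))
  · rw [h.rot_eq_of_adj h1.symm (by rwa [ht.rot_eq]), ht.rot_eq]
  · rw [h.rot_eq_of_adj h2.symm (by rwa [ht'.rot_eq]), ht'.rot_eq]
  · rw [h.rot_eq_of_adj h3.symm (by rwa [ht''.rot_eq]), ht''.rot_eq]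

end IsSubdrawing

end PlaneDrawing

theorem ZMod.two_eq_zero_or_one : ∀ x : ZMod 2, x = 0 ∨ x = 1 := by decide

namespace PlaneDrawing

variable {α β : Type*}

/-! ### Chords of a subdrawing -/

theorem eq_of_mem_regionOf_of_along {G : PlaneDrawing α} {γ : Type*} {φ : α × α → γ}
    (h1 : ∀ u v, G.graph.Adj u v → φ (faceNext G.rot (u, v)) = φ (u, v)) {e e' : α × α}
    (he : e ∈ G.darts) (h : e' ∈ regionOf G.rot e) : φ e' = φ e := by
  obtain ⟨n, rfl⟩ := h
  induction n with
  | zero => rfl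
  | succ n ih =>
    rw [← ih, Function.iterate_succ_apply']
    exact h1 _ _ (G.mem_darts_of_mem_regionOf he ⟨n, rfl⟩)

/-- Both ends of a chord of `H` lie in the same region of `H`: they are in corners of the same
region. -/
theorem IsSubdrawing.mem_regionOf_of_chord {G H : PlaneDrawing α} (hsub : H.IsSubdrawing G)
    {a c z z' : α} (hac : G.graph.Adj a c) (hn : ¬ H.graph.Adj a c)
    (hz : LastHit (G.rot c) (H.graph.neighborSet c) z a)
    (hz' : LastHit (G.rot a) (H.graph.neighborSet a) z' c) :
    (z', a) ∈ regionOf H.rot (z, c) := by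
  classical
  have hle := hsub.graph_le
  obtain ⟨φ, h1, h2⟩ := exists_chord_coloring G H hle (H.mem_verts_left hz'.mem)
    (H.mem_verts_left hz.mem) hac hn
  by_contra hcon
  -- within a corner of `H` that does not contain an end of the chord, `φ` is constant
  have const : ∀ p q x y, G.graph.Adj q x → LastHit (G.rot q) (H.graph.neighborSet q) p x →
      (∀ v, LastHit (G.rot q) (H.graph.neighborSet q) p v → ¬ H.graph.Adj q v →
        s(q, v) ≠ s(a, c)) → FirstHit (G.rot q) (H.graph.neighborSet q) x y →
      φ (q, y) = φ (x, q) := by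
    intro p q x y hx hp hv h
    induction h with
    | hit x h => exact h1 x q hx.symm
    | skip x y h3 _ ih =>
      have hp' := LastHit.step x hp h3
      have hx' := G.adj_rot hx
      rw [ih hx' hp']
      have e := h2 _ _ hx' h3
      rw [if_neg (hv _ hp' h3), CharTwo.add_eq_zero] at e
      rw [← e]
      exact h1 x q hx.symm
  -- The corner of `H` at `c` that contains the chord is swept across the chord exactly once.
  have jump : φ (c, H.rot c z) = φ (z, c) + 1 := by
    obtain ⟨n, e1, e2, e3⟩ := FirstHit.iff_exists_pow.1 (hsub.firstHit hz.mem)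
    obtain ⟨k, e4, e5⟩ := hz.exists_pow
    have hk0 : k ≠ 0 := by
      rintro rfl
      apply hn
      rw [e4]
      exact (show H.graph.Adj c z from hz.mem).symm
    have hkn : k ≤ n := by
      by_contra h
      refine e5 (n + 1) (by omega) (by omega) ?_
      rw [← e1]
      exact e2
    -- A repetition would mean that the sweep has returned to `z`, a neighbour in `H`, before the
    -- first hit. Hence the chord is met only at `k`.
    have e6 : ∀ i j, i < j → j ≤ n → (G.rot c ^ i) z ≠ (G.rot c ^ j) z := by
      intro i j hij hj h
      have : (G.rot c ^ (j - i)) z = z := by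
        apply (G.rot c ^ i).injective
        rw [h, ← Equiv.Perm.mul_apply, ← pow_add, Nat.add_sub_cancel' hij.le]
      have h' := e3 (j - i - 1) (by omega)
      rw [Nat.sub_add_cancel (by omega), this] at h'
      exact h' hz.mem
    have hadj : ∀ m, G.graph.Adj c ((G.rot c ^ m) z) := fun m => G.adj_rot_pow (hle hz.mem) m
    have e7 : ∀ m ≤ n, φ ((G.rot c ^ m) z, c) = φ (z, c) + if k ≤ m then 1 else 0 := by
      intro m
      induction m with
      | zero =>
        intro _
        rw [if_neg (by omega), add_zero]
        rfl
      | succ m ih =>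
        intro hm
        have s1 := h1 _ _ (hadj m).symm
        have s2 := h2 _ _ (hadj (m + 1)) (e3 m (by omega))
        have s3 : faceNext G.rot ((G.rot c ^ m) z, c) = (c, (G.rot c ^ (m + 1)) z) := by
          rw [pow_succ']
          rfl
        rw [s3, ih (by omega)] at s1
        rw [s1, e4] at s2
        simp only [Sym2.eq_swap (a := (G.rot c ^ k) z), Sym2.congr_right] at s2
        by_cases hmk : m + 1 = k
        · rw [if_neg (by omega), if_pos (by rw [hmk])] at s2
          rw [if_pos (by omega), ← s2, add_zero, ← add_assoc, CharTwo.add_self_eq_zero, zero_add]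
        · have hne : ¬ (G.rot c ^ (m + 1)) z = (G.rot c ^ k) z := by
            rcases Nat.lt_or_gt_of_ne hmk with h | h
            · exact e6 _ _ h hkn
            · exact (e6 _ _ h hm).symm
          rw [if_neg hne, CharTwo.add_eq_zero] at s2
          rw [← s2]
          congr 1
          by_cases h : k ≤ m
          · rw [if_pos h, if_pos (by omega)]
          · rw [if_neg h, if_neg (by omega)]
    have s1 := h1 _ _ (hadj n).symm
    have s3 : faceNext G.rot ((G.rot c ^ n) z, c) = (c, (G.rot c ^ (n + 1)) z) := by
      rw [pow_succ']
      rfl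
    rw [s3, e7 n le_rfl, if_pos hkn, ← e1] at s1
    exact s1
  have hx0 : (z, c) ∈ H.darts := (show H.graph.Adj c z from hz.mem).symm
  -- If the walk never used the corner at `a` that contains the chord, the colour would flip once
  -- per full turn, at `(z, c)` only, and could not return to its starting value.
  have step : ∀ e ∈ regionOf H.rot (z, c), e ≠ (z, c) → φ (faceNext H.rot e) = φ e := by
    rintro ⟨p, q⟩ he hne
    have hpq : H.graph.Adj p q := H.mem_darts_of_mem_regionOf hx0 he
    refine const p q p _ (hle hpq.symm) (.base hpq.symm) ?_ (hsub.firstHit hpq.symm)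
    intro v hv _ hs
    rcases Sym2.eq_iff.1 hs with ⟨rfl, rfl⟩ | ⟨rfl, rfl⟩
    · exact hcon (hv.unique hz' ▸ he)
    · exact hne (by rw [hv.unique hz])
  obtain ⟨n, hn0, hn1⟩ := H.exists_period hx0
  have hex : ∃ n, 0 < n ∧ (faceNext H.rot)^[n] (z, c) = (z, c) := ⟨n, hn0, hn1⟩
  have hmin : ∀ m, 0 < m → m < Nat.find hex → (faceNext H.rot)^[m] (z, c) ≠ (z, c) :=
    fun m h0 hm h => Nat.find_min hex hm ⟨h0, h⟩
  have hval : ∀ m, 0 < m → m ≤ Nat.find hex →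
      φ ((faceNext H.rot)^[m] (z, c)) = φ (z, c) + 1 := by
    intro m
    induction m with
    | zero => omega
    | succ m ih =>
      intro _ hm
      rw [Function.iterate_succ_apply']
      rcases Nat.eq_zero_or_pos m with rfl | h0
      · exact jump
      · rw [step _ ⟨m, rfl⟩ (hmin m h0 (by omega)), ih h0 (by omega)]
  have := hval _ (Nat.find_spec hex).1 le_rfl
  rw [(Nat.find_spec hex).2] at this
  exact one_ne_zero (left_eq_add.1 this)

/-- The finite triangles of a subdrawing with the same vertices are finite triangles. -/
theorem IsSubdrawing.clockwiseTriangle_of_verts_eq {G H : PlaneDrawing α}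
    (hsub : H.IsSubdrawing G) (hV : H.verts = G.verts) {u v w : α}
    (ht : H.ClockwiseTriangle u v w) : G.ClockwiseTriangle u v w := by
  have hle := hsub.graph_le
  have key : ∀ u v w, H.ClockwiseTriangle u v w → G.rot v u = w := by
    intro u v w ht
    by_cases h : H.graph.Adj v (G.rot v u)
    · rw [← hsub.rot_eq_of_adj ht.adj.symm h, ht.rot_eq]
    -- Otherwise the next edge at `v` is a chord drawn inside the triangle of `H`. As `H` is
    -- spanning, its other end is a vertex of `H`, hence one of `u, v, w`, and none of these is
    -- possible.
    · exfalso
      have hvx : G.graph.Adj v (G.rot v u) := G.adj_rot (hle ht.adj.symm)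
      have hz : LastHit (G.rot v) (H.graph.neighborSet v) u (G.rot v u) :=
        .step _ (.base ht.adj.symm) h
      have hxV : G.rot v u ∈ H.verts := hV ▸ G.mem_verts_right hvx
      obtain ⟨y, hy⟩ := H.exists_adj (SimpleGraph.ne_bot_iff_exists_adj.2 ⟨_, _, ht.adj⟩) hxV
      obtain ⟨z', hz'⟩ := G.exists_lastHit hle hvx.symm hy
      have hmem := hsub.mem_regionOf_of_chord hvx.symm (fun h' => h h'.symm) hz hz'
      rcases ht.mem_regionOf_iff.1 hmem with h' | h' | h'
      · exact hvx.ne (congrArg Prod.snd h').symm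
      · exact h (by rw [show G.rot v u = w from congrArg Prod.snd h']; exact ht.rotate.adj)
      · exact h (by rw [show G.rot v u = u from congrArg Prod.snd h']; exact ht.adj.symm)
  exact .mk' (hle ht.adj) (fun h => ht.notMem_outer (hsub.mem_outer ht.adj h)) (key _ _ _ ht)
    (key _ _ _ ht.rotate) (key _ _ _ ht.rotate.rotate)

open Classical in
/-- `φ` is the indicator function of the regions of `G` that are separated from the infinite region
by the chord `e` of `H`, as far as the exterior of `H` is concerned. -/
structure IsChordColoring (G : PlaneDrawing α) (H : SimpleGraph α) (e : α × α)
    (φ : α × α → ZMod 2) : Prop where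
  along : ∀ u v, G.graph.Adj u v → φ (faceNext G.rot (u, v)) = φ (u, v)
  cross : ∀ u v, G.graph.Adj u v → ¬ H.Adj u v →
    φ (u, v) + φ (v, u) = if s(u, v) = s(e.1, e.2) then 1 else 0
  outer : ∀ o ∈ G.outer, φ o = 0

theorem IsSubdrawing.exists_isChordColoring {G H : PlaneDrawing α} (hsub : H.IsSubdrawing G)
    {e : α × α} (he : e ∈ G.darts) (h1 : e.1 ∈ H.verts) (h2 : e.2 ∈ H.verts) :
    ∃ φ, G.IsChordColoring H.graph e φ := by
  by_cases h : H.graph.Adj e.1 e.2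
  -- An edge of `H` counts as a chord with empty inside, so that the three sides of a triangle can
  -- be treated alike.
  · refine ⟨0, by simp, fun u v _ hn => ?_, by simp⟩
    rw [if_neg]
    · simp
    · intro hs
      rcases Sym2.eq_iff.1 hs with ⟨rfl, rfl⟩ | ⟨rfl, rfl⟩
      · exact hn h
      · exact hn h.symm
  · obtain ⟨φ, ha, hb⟩ := exists_chord_coloring G H hsub.graph_le h1 h2 he h
    obtain ⟨o, ho⟩ := G.outer_nonempty he
    -- Adding a constant makes the infinite region have colour 0.
    refine ⟨fun x => φ x + φ o, fun u v huv => by rw [ha u v huv], fun u v huv hn => ?_, ?_⟩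
    · rw [← hb u v huv hn]
      have : ∀ p q r : ZMod 2, p + q + (r + q) = p + r := by decide
      exact this _ _ _
    · intro o' ho'
      rw [G.outer_eq_regionOf ho] at ho'
      rw [eq_of_mem_regionOf_of_along ha (G.outer_subset_darts ho) ho']
      exact CharTwo.add_self_eq_zero _

namespace IsChordColoring

variable {G : PlaneDrawing α} {H : SimpleGraph α} {e e' : α × α} {φ φ' : α × α → ZMod 2}

theorem cross_eq (h : G.IsChordColoring H e φ) {u v : α} (huv : G.graph.Adj u v)
    (hn : ¬ H.Adj u v) (hs : s(u, v) ≠ s(e.1, e.2)) : φ (u, v) = φ (v, u) := by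
  have := h.cross u v huv hn
  rwa [if_neg hs, CharTwo.add_eq_zero] at this

theorem eq_of_mem_regionOf (h : G.IsChordColoring H e φ) {x y : α × α} (hx : x ∈ G.darts)
    (hy : y ∈ regionOf G.rot x) : φ y = φ x :=
  eq_of_mem_regionOf_of_along h.along hx hy

/-- The jump of a product at an edge where only one factor jumps is that jump times the other
factor. At the chord `e` the other factor is `φ' e`, and at `e'` it is `φ e' = φ e = 1`, because
both chords border the same region. -/
theorem product_cross (h : G.IsChordColoring H e φ) (h' : G.IsChordColoring H e' φ')
    (he : e ∈ G.darts) (hee' : e' ∈ regionOf G.rot e) (hs : s(e.1, e.2) ≠ s(e'.1, e'.2)) (hφ : φ e = 1)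
    {u v : α} (huv : G.graph.Adj u v) (hn : ¬ H.Adj u v) :
    φ (u, v) * φ' (u, v) + φ (v, u) * φ' (v, u) =
      φ' e * (φ (u, v) + φ (v, u)) + (φ' (u, v) + φ' (v, u)) := by
  have he' := G.mem_darts_of_mem_regionOf he hee'
  have c1 := h.cross u v huv hn
  have c2 := h'.cross u v huv hn
  by_cases hs1 : s(u, v) = s(e.1, e.2)
  · rw [if_neg (hs1 ▸ hs), CharTwo.add_eq_zero] at c2
    have : φ' (v, u) = φ' e := by
      rcases Sym2.eq_iff.1 hs1 with ⟨rfl, rfl⟩ | ⟨rfl, rfl⟩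
      · exact c2.symm
      · rfl
    rw [c2, this]
    generalize φ' e = p
    generalize φ (u, v) = q
    generalize φ (v, u) = r
    revert p q r
    decide
  · rw [if_neg hs1, CharTwo.add_eq_zero] at c1
    by_cases hs2 : s(u, v) = s(e'.1, e'.2)
    · have hφ' : φ e' = 1 := (h.eq_of_mem_regionOf he hee').trans hφ
      have : φ (v, u) = 1 := by
        rcases Sym2.eq_iff.1 hs2 with ⟨rfl, rfl⟩ | ⟨rfl, rfl⟩
        · exact c1.symm.trans hφ'
        · exact hφ'
      rw [c1, this]
      generalize φ' e = p
      generalize φ' (u, v) = q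
      generalize φ' (v, u) = r
      revert p q r
      decide
    · rw [if_neg hs2, CharTwo.add_eq_zero] at c2
      rw [c1, c2]
      generalize φ' e = p
      generalize φ' (v, u) = q
      generalize φ (v, u) = r
      revert p q r
      decide

/-- Two chords on the boundary of the same region: if the region is inside the first, then it is
outside the second. -/
theorem eq_zero_of_eq_one (h : G.IsChordColoring H e φ) (h' : G.IsChordColoring H e' φ')
    (he : e ∈ G.darts) (hee' : e' ∈ regionOf G.rot e) (hs : s(e.1, e.2) ≠ s(e'.1, e'.2))
    (hext : G.Exterior H e) (hφ : φ e = 1) : φ' e = 0 := by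
  by_contra hne
  have h1 : φ' e = 1 := (ZMod.two_eq_zero_or_one _).resolve_left hne
  -- This is the indicator of the union of the two insides. If both contained the common region, it
  -- would have no jumps in the exterior and would vanish there.
  have := hext.eq_zero (fun x => φ x * φ' x + (φ x + φ' x))
    (fun u v huv => by simp only [h.along u v huv, h'.along u v huv])
    (fun u v huv hn => by
      have := h.product_cross h' he hee' hs hφ huv hn
      rw [h1, one_mul] at this
      rw [← CharTwo.add_eq_zero]
      have alg : ∀ a b p q r s : ZMod 2, a + b = p + q + (r + s) →
        a + (p + r) + (b + (q + s)) = 0 := by decide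
      exact alg _ _ _ _ _ _ this)
    (fun o ho => by simp only [h.outer o ho, h'.outer o ho]; rfl)
  simp only [hφ, h1] at this
  exact absurd this (by decide)

/-- Two chords on the boundary of the same region: if the region is inside the first, then what is
inside the second is inside the first. -/
theorem le_of_eq_one (h : G.IsChordColoring H e φ) (h' : G.IsChordColoring H e' φ')
    (he : e ∈ G.darts) (hee' : e' ∈ regionOf G.rot e) (hs : s(e.1, e.2) ≠ s(e'.1, e'.2))
    (hext : G.Exterior H e) (hφ : φ e = 1) {x : α × α} (hx : G.Exterior H x) (hx' : φ' x = 1) : φ x = 1 := by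
  have h0 := h.eq_zero_of_eq_one h' he hee' hs hext hφ
  -- This is the indicator of what is inside the second chord but not the first. It has no jumps
  -- because `φ' e = 0`.
  have := hx.eq_zero (fun x => φ x * φ' x + φ' x)
    (fun u v huv => by simp only [h.along u v huv, h'.along u v huv])
    (fun u v huv hn => by
      have := h.product_cross h' he hee' hs hφ huv hn
      rw [h0, zero_mul, zero_add] at this
      rw [← CharTwo.add_eq_zero]
      have alg : ∀ a b r s : ZMod 2, a + b = r + s → a + r + (b + s) = 0 := by decide
      exact alg _ _ _ _ this)
    (fun o ho => by simp only [h'.outer o ho]; simp)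
  simp only [hx', mul_one, CharTwo.add_eq_zero] at this
  exact this

open Classical in
/-- The exterior regions inside the three edges of a finite triangle, seen from outside, are all
but that triangle. -/
theorem triangle_sum {u v w : α} (ht : G.ClockwiseTriangle u v w) {φ₁ φ₂ φ₃ : α × α → ZMod 2}
    (h₁ : G.IsChordColoring H (u, v) φ₁) (h₂ : G.IsChordColoring H (v, w) φ₂)
    (h₃ : G.IsChordColoring H (w, u) φ₃) {x : α × α} (hx : G.Exterior H x) :
    φ₁ x + φ₂ x + φ₃ x = (if x = (u, v) then 1 else 0) + (if x = (v, w) then 1 else 0) +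
      (if x = (w, u) then 1 else 0) := by
  -- The right-hand side of the claim jumps across each side of the triangle just as the sum of the
  -- colourings does, and both vanish on the infinite region.
  have ind : ∀ p q a b : α, a ≠ b → (if s(p, q) = s(a, b) then (1 : ZMod 2) else 0) =
      (if (p, q) = (a, b) then 1 else 0) + (if (q, p) = (a, b) then 1 else 0) := by
    intro p q a b hab
    simp only [Sym2.eq_iff, Prod.mk.injEq]
    by_cases h1 : p = a
    · have h2 : p ≠ b := fun h => hab (h1.symm.trans h)
      simp [h1, hab]
    · by_cases h2 : q = a <;> simp [h1, h2, and_comm]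
  have nxt : ∀ e f : α × α, faceNext G.rot e = f → ∀ x,
      (if faceNext G.rot x = f then (1 : ZMod 2) else 0) = if x = e then 1 else 0 := by
    rintro e _ rfl x
    simp only [(faceNext_injective G.rot).eq_iff]
  have := hx.eq_zero (fun x => φ₁ x + φ₂ x + φ₃ x + ((if x = (u, v) then 1 else 0) +
      (if x = (v, w) then 1 else 0) + (if x = (w, u) then 1 else 0)))
    (fun p q hpq => by
      simp only [h₁.along p q hpq, h₂.along p q hpq, h₃.along p q hpq,
        nxt _ _ ht.2.2.1, nxt _ _ ht.2.2.2.1, nxt _ _ ht.2.2.2.2]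
      ring)
    (fun p q hpq hn => by
      have c1 := h₁.cross p q hpq hn
      have c2 := h₂.cross p q hpq hn
      have c3 := h₃.cross p q hpq hn
      rw [ind _ _ _ _ ht.ne.1] at c1
      rw [ind _ _ _ _ ht.ne.2.1] at c2
      rw [ind _ _ _ _ ht.ne.2.2] at c3
      rw [← CharTwo.add_eq_zero]
      have := congrArg₂ (· + ·) (congrArg₂ (· + ·) c1 c2) c3
      rw [← CharTwo.add_eq_zero] at this
      refine Eq.trans ?_ this
      ring)
    (fun o ho => by
      have hne : ∀ e, e ∈ regionOf G.rot (u, v) → o ≠ e := by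
        rintro e he rfl
        apply ht.notMem_outer
        rw [G.outer_eq_regionOf ho]
        exact G.mem_regionOf_symm ht.adj he
      simp only [h₁.outer o ho, h₂.outer o ho, h₃.outer o ho,
        if_neg (hne _ (ht.mem_regionOf_iff.2 (.inl rfl))),
        if_neg (hne _ (ht.mem_regionOf_iff.2 (.inr (.inl rfl)))),
        if_neg (hne _ (ht.mem_regionOf_iff.2 (.inr (.inr rfl))))]
      rfl)
  exact CharTwo.add_eq_zero.1 this

end IsChordColoring

end PlaneDrawing

namespace LastHit

variable {α : Type*} {σ : Equiv.Perm α} {N : Set α} {z v : α}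

theorem eq_of_apply_mem (h : LastHit σ N z v) (hz : σ z ∈ N) : v = z := by
  obtain ⟨k, rfl, hk⟩ := h.exists_pow
  cases k with
  | zero => rfl
  | succ k => exact absurd (by simpa using hz) (hk 1 one_pos (by omega))

end LastHit

namespace PlaneDrawing

variable {α β : Type*}

namespace IsChordColoring

variable {G : PlaneDrawing α} {H : SimpleGraph α} {e : α × α} {φ : α × α → ZMod 2}

open Classical in
theorem swap {a c : α} (h : G.IsChordColoring H (a, c) φ) : G.IsChordColoring H (c, a) φ := by
  refine ⟨h.along, fun u v huv hn => ?_, h.outer⟩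
  rw [h.cross u v huv hn]
  have : s(a, c) = s(c, a) := Sym2.eq_swap
  exact if_congr (iff_of_eq (congrArg (s(u, v) = ·) this)) rfl rfl

theorem eq_zero_of_adj (h : G.IsChordColoring H e φ) (he : H.Adj e.1 e.2) {x : α × α}
    (hx : G.Exterior H x) : φ x = 0 := by
  refine hx.eq_zero φ h.along (fun u v huv hn => h.cross_eq huv hn ?_) h.outer
  intro hs
  rcases Sym2.eq_iff.1 hs with ⟨rfl, rfl⟩ | ⟨rfl, rfl⟩
  · exact hn he
  · exact hn he.symm

/-- Turning inside one corner of `H` at a vertex that is not an end of the chord never crosses the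
chord. -/
theorem eq_of_lastHit (h : G.IsChordColoring H e φ) (hle : H ≤ G.graph) {b z v : α}
    (h1 : b ≠ e.1) (h2 : b ≠ e.2) (hz : LastHit (G.rot b) (H.neighborSet b) z v) :
    φ (z, b) = φ (v, b) := by
  induction hz with
  | base h => rfl
  | step v h3 h4 ih =>
    have hv := LastHit.adj (fun _ h => hle h) h3
    rw [ih, ← h.along v b hv.symm]
    refine h.cross_eq (G.adj_rot hv) h4 ?_
    intro hs
    rcases Sym2.eq_iff.1 hs with ⟨h, -⟩ | ⟨h, -⟩
    · exact h1 h
    · exact h2 h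

end IsChordColoring

end PlaneDrawing

/-! ### Extending triangle preservation from a spanning subdrawing -/

namespace PlaneConfiguration

variable {α β : Type*}

open PlaneDrawing

/-- If `f` preserves all but one of the triangles around a vertex that is not on the infinite
region, and the degree of this vertex is right, then `f` preserves the remaining triangle. -/
theorem clockwiseTriangle_of_forall_ne (K : PlaneConfiguration β) {J : PlaneDrawing α}
    {f : α → β} (hmaps : Set.MapsTo f J.verts K.G.verts) (hinj : Set.InjOn f J.verts) {b c : α}
    (hbc : J.graph.Adj b c) (hdeg : J.degree b = K.γ (f b)) (hne : J.rot b c ≠ c)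
    (hgood : ∀ v, J.graph.Adj b v → v ≠ c →
      K.G.ClockwiseTriangle (f v) (f b) (f (J.rot b v))) :
    K.G.ClockwiseTriangle (f c) (f b) (f (J.rot b c)) := by
  have hb := J.mem_verts_left hbc
  have hsub : f '' J.graph.neighborSet b ⊆ K.G.graph.neighborSet (f b) := by
    rintro _ ⟨v, hv, rfl⟩
    -- The vertex `c` is reached from the triangle of its predecessor around `b`, which differs from
    -- `c` because `b` has another neighbour.
    by_cases h : v = c
    · subst h
      have hp : J.graph.Adj b ((J.rot b).symm v) := J.adj_rot_iff.1 (by simpa using hv)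
      have := hgood _ hp (fun h => hne (by rw [Equiv.symm_apply_eq] at h; exact h.symm))
      rw [Equiv.apply_symm_apply] at this
      exact this.rotate.adj
    · exact (hgood v hv h).adj.symm
  have hcard : (f '' J.graph.neighborSet b).ncard = K.γ (f b) := by
    rw [(hinj.mono (J.neighborSet_subset b)).ncard_image, ← hdeg]
    rfl
  have hle := Set.ncard_le_ncard hsub (K.G.neighborSet_finite _)
  -- On the infinite region the degree would be below `K.γ (f b)`, but that many neighbours have
  -- just been found.
  have hint : ¬ K.G.OnInfinite (f b) := by
    intro h
    have := K.gamma_infinite _ (hmaps hb) h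
    rw [← hcard] at this
    exact absurd hle (by simpa [PlaneDrawing.degree] using this)
  have heq : f '' J.graph.neighborSet b = K.G.graph.neighborSet (f b) := by
    refine Set.eq_of_subset_of_ncard_le hsub ?_ (K.G.neighborSet_finite _)
    rw [hcard, K.gamma_interior _ (hmaps hb) hint]
    rfl
  have hadj : K.G.graph.Adj (f b) (f c) := hsub ⟨c, hbc, rfl⟩
  -- Two permutations of one finite set that agree at all points but one agree there too.
  have hrot : K.G.rot (f b) (f c) = f (J.rot b c) := by
    obtain ⟨x, hx, hxe⟩ : K.G.rot (f b) (f c) ∈ f '' J.graph.neighborSet b := by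
      rw [heq]
      exact K.G.adj_rot hadj
    have hp : J.graph.Adj b ((J.rot b).symm x) := J.adj_rot_iff.1 (by simpa using hx)
    by_cases h : (J.rot b).symm x = c
    · rw [← h, Equiv.apply_symm_apply, hxe, h]
    · have := (hgood _ hp h).rot_eq
      rw [Equiv.apply_symm_apply, hxe, (K.G.rot (f b)).injective.eq_iff] at this
      exact absurd (hinj (J.mem_verts_right hp) (J.mem_verts_right hbc) this) h
  have := K.near.triangle hadj.symm fun h => hint (K.G.onInfinite_of_mem_outer h)
  rwa [hrot] at this

/-- If `f` preserves the finite triangles of a 2-connected spanning subdrawing `J'` of a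
near-triangulation `J`, then it preserves those of `J`, provided that the degrees of the vertices
that are not on the infinite region are right. -/
theorem clockwiseTriangle_of_spanning (K : PlaneConfiguration β) {J J' : PlaneDrawing α}
    (hsub : J'.IsSubdrawing J) (hV : J'.verts = J.verts) (hnear : J.NearTriangulation)
    (hnear' : J'.NearTriangulation) (hconn : J'.TwoConnected) {f : α → β}
    (hmaps : Set.MapsTo f J.verts K.G.verts) (hinj : Set.InjOn f J.verts)
    (hdeg : ∀ b ∈ J.verts, ¬ J.OnInfinite b → J.degree b = K.γ (f b))
    (hf : ∀ u v w, J'.ClockwiseTriangle u v w → K.G.ClockwiseTriangle (f u) (f v) (f w)) :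
    ∀ u v w, J.ClockwiseTriangle u v w → K.G.ClockwiseTriangle (f u) (f v) (f w) := by
  have hle := hsub.graph_le
  have hcol : ∀ e : α × α, ∃ φ, e ∈ J.darts → J.IsChordColoring J'.graph e φ := by
    intro e
    by_cases he : e ∈ J.darts
    · obtain ⟨φ, hφ⟩ := hsub.exists_isChordColoring he (hV ▸ J.mem_verts_left he)
        (hV ▸ J.mem_verts_right he)
      exact ⟨φ, fun _ => hφ⟩
    · exact ⟨0, fun h => absurd h he⟩
  choose φ hφ using hcol
  let Bad : α × α → Prop := fun e => e ∈ J.darts ∧ e ∉ J.outer ∧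
    ¬ K.G.ClockwiseTriangle (f e.1) (f e.2) (f (J.rot e.2 e.1))
  let inside : α × α → Set (α × α) := fun e =>
    {x | x ∈ J.darts ∧ J.Exterior J'.graph x ∧ φ e x = 1}
  -- Every corner of `J` either is a corner of a finite triangle of `J'`, hence good, or lies in an
  -- outer corner of `J'`. Bad triangles are therefore exterior to `J'`, where the colourings give
  -- information.
  have corner : ∀ v b, J.graph.Adj b v →
      (J.ClockwiseTriangle v b (J.rot b v) ∧ J'.graph.Adj b v ∧
        K.G.ClockwiseTriangle (f v) (f b) (f (J.rot b v))) ∨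
      ∃ z, LastHit (J.rot b) (J'.graph.neighborSet b) z v ∧ (z, b) ∈ J'.outer := by
    intro v b hbv
    obtain ⟨y, hy⟩ := J'.exists_adj hconn.ne_bot (hV ▸ J.mem_verts_left hbv)
    obtain ⟨z, hz⟩ := J.exists_lastHit hle hbv hy
    by_cases ho : (z, b) ∈ J'.outer
    · exact .inr ⟨z, hz, ho⟩
    · have hzb : J'.graph.Adj b z := hz.mem
      have ht' := hnear'.triangle hzb.symm ho
      have ht := hsub.clockwiseTriangle_of_verts_eq hV ht'
      have hvz : v = z := hz.eq_of_apply_mem (by rw [ht.rot_eq]; exact ht'.rotate.adj)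
      subst hvz
      have := hf _ _ _ ht'
      rw [← ht.rot_eq] at this
      exact .inl ⟨by rwa [ht.rot_eq], hzb, this⟩
  have cornerExt : ∀ z v b, LastHit (J.rot b) (J'.graph.neighborSet b) z v → (z, b) ∈ J'.outer →
      J.Exterior J'.graph (v, b) := fun z v b hz ho =>
    ((hsub.mem_outer_iff (J'.adj_of_mem_outer ho)).1 ho).congr (.of_lastHit hle hz)
  have badExt : ∀ x, Bad x → J.Exterior J'.graph x := by
    rintro ⟨v, b⟩ ⟨h1, h2, h3⟩
    rcases corner v b h1.symm with ⟨-, -, h⟩ | ⟨z, hz, ho⟩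
    · exact absurd h h3
    · exact cornerExt z v b hz ho
  have chordExt : ∀ v b, J.graph.Adj v b → ¬ J'.graph.Adj v b → J.Exterior J'.graph (v, b) := by
    intro v b h1 h2
    rcases corner v b h1.symm with ⟨-, h, -⟩ | ⟨z, hz, ho⟩
    · exact absurd h.symm h2
    · exact cornerExt z v b hz ho
  have badRot : ∀ u v w, J.ClockwiseTriangle u v w → Bad (u, v) → Bad (v, w) := by
    rintro u v w ht ⟨-, -, h3⟩
    refine ⟨ht.rotate.adj, ht.rotate.notMem_outer, fun h => h3 ?_⟩
    simp only [ht.rotate.rot_eq] at h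
    simp only [ht.rot_eq]
    exact h.rotate.rotate
  -- Induction on the number of exterior darts inside the chord: nothing inside a chord is bad.
  have main : ∀ n a c, J.graph.Adj a c → ¬ J'.graph.Adj a c → (inside (a, c)).ncard = n →
      ∀ x ∈ inside (a, c), ¬ Bad x := by
    intro n
    induction n using Nat.strong_induction_on with
    | _ n ih =>
    -- the case of a chord with its inside on the right
    have oriented : ∀ ψ a c, J.graph.Adj a c → ¬ J'.graph.Adj a c →
        J.IsChordColoring J'.graph (a, c) ψ → ψ (a, c) = 1 →
        {x | x ∈ J.darts ∧ J.Exterior J'.graph x ∧ ψ x = 1}.ncard = n →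
        ∀ x ∈ J.darts, J.Exterior J'.graph x → ψ x = 1 → ¬ Bad x := by
      intro ψ a c hac hn hψ h1 hcard x hx hxe hx1 hbad
      have hext := chordExt a c hac hn
      have ht := hnear.triangle hac (fun h => by
        rw [hψ.outer _ h] at h1
        exact absurd h1 (by decide))
      generalize J.rot c a = b at ht
      have hmem := fun e => ht.mem_regionOf_iff (e := e)
      -- The other two sides of the triangle have smaller insides: these are nested in that of `ac`
      -- and omit `(a, c)` itself. A side that is an edge of `J'` has empty inside.
      have sub : ∀ e : α × α, e ∈ regionOf J.rot (a, c) → s(a, c) ≠ s(e.1, e.2) →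
          ∀ x ∈ J.darts, J.Exterior J'.graph x → φ e x = 1 → ¬ Bad x := by
        intro e he hs x hx hxe hx1
        have hed := J.mem_darts_of_mem_regionOf (e := (a, c)) hac he
        have hch : ¬ J'.graph.Adj e.1 e.2 := by
          intro h
          rw [(hφ e hed).eq_zero_of_adj h hxe] at hx1
          exact absurd hx1 (by decide)
        refine ih _ ?_ e.1 e.2 hed hch rfl x ⟨hx, hxe, hx1⟩
        rw [← hcard]
        refine Set.ncard_lt_ncard ⟨?_, ?_⟩ (J.darts_finite.subset fun _ h => h.1)
        · rintro y ⟨hy1, hy2, hy3⟩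
          exact ⟨hy1, hy2, hψ.le_of_eq_one (hφ e hed) hac he hs hext h1 hy2 hy3⟩
        · intro h
          have : φ e (a, c) = 1 := (h ⟨hac, hext, h1⟩).2.2
          have h' := hψ.eq_zero_of_eq_one (hφ e hed) hac he hs hext h1
          rw [h'] at this
          exact absurd this (by decide)
      obtain ⟨n1, n2, n3⟩ := ht.ne
      have hs2 : s(a, c) ≠ s(c, b) := by
        rw [Sym2.eq_swap, Ne, Sym2.congr_right]
        exact n3.symm
      have hs3 : s(a, c) ≠ s(b, a) := by
        rw [Sym2.eq_swap (a := b), Ne, Sym2.congr_right]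
        exact n2
      have inTriangle : ∀ x ∈ J.darts, J.Exterior J'.graph x → ψ x = 1 → Bad x →
          x = (a, c) ∨ x = (c, b) ∨ x = (b, a) := by
        intro x hx hxe hx1 hbad
        by_contra hcon
        push Not at hcon
        have sum := hψ.triangle_sum ht (hφ _ ht.rotate.adj) (hφ _ ht.rotate.rotate.adj) hxe
        rw [if_neg hcon.1, if_neg hcon.2.1, if_neg hcon.2.2, hx1] at sum
        have alg : ∀ p q : ZMod 2, 1 + p + q = 0 + 0 + 0 → p = 1 ∨ q = 1 := by decide
        rcases alg _ _ sum with h | h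
        · exact sub _ ((hmem _).2 (.inr (.inl rfl))) hs2 x hx hxe h hbad
        · exact sub _ ((hmem _).2 (.inr (.inr rfl))) hs3 x hx hxe h hbad
      have hcb : Bad (c, b) := by
        rcases inTriangle x hx hxe hx1 hbad with rfl | rfl | rfl
        · exact badRot _ _ _ ht hbad
        · exact hbad
        · exact badRot _ _ _ ht (badRot _ _ _ ht.rotate.rotate hbad)
      have hψcb : ψ (c, b) = 1 :=
        (hψ.eq_of_mem_regionOf hac ((hmem _).2 (.inr (.inl rfl)))).trans h1
      obtain ⟨z, hz, hzo⟩ := (corner c b ht.rotate.adj.symm).resolve_left fun h => hcb.2.2 h.2.2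
      -- Other corners at `b` that are not finite in `J'` share the unique outer corner of `J'` at
      -- `b` with `(c, b)`. As `b` is not an end of the chord, they are inside it, and there only
      -- the triangle itself can be bad.
      have around : ∀ v, J.graph.Adj b v → v ≠ c → (v, b) ∉ J.outer ∧
          K.G.ClockwiseTriangle (f v) (f b) (f (J.rot b v)) := by
        intro v hv hvc
        rcases corner v b hv with ⟨h, -, h'⟩ | ⟨z', hz', hzo'⟩
        · exact ⟨h.notMem_outer, h'⟩
        · obtain rfl := hconn.eq_of_mem_outer hzo hzo'
          have hψv : ψ (v, b) = 1 := by
            rw [← hψ.eq_of_lastHit hle n3 n2.symm hz', hψ.eq_of_lastHit hle n3 n2.symm hz, hψcb]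
          have ho : (v, b) ∉ J.outer := fun h => by
            rw [hψ.outer _ h] at hψv
            exact absurd hψv (by decide)
          refine ⟨ho, ?_⟩
          by_contra hK
          rcases inTriangle (v, b) hv.symm (cornerExt _ v b hz' hzo) hψv ⟨hv.symm, ho, hK⟩
            with h | h | h
          · exact n2 (congrArg Prod.snd h).symm
          · exact hvc (congrArg Prod.fst h)
          · exact n3 (congrArg Prod.snd h)
      have hint : ¬ J.OnInfinite b := by
        rw [J.not_onInfinite_iff (SimpleGraph.ne_bot_iff_exists_adj.2 ⟨_, _, hac⟩)
          (J.mem_verts_right ht.rotate.adj)]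
        intro u hu
        by_cases huc : u = c
        · exact ht.rotate.notMem_outer (huc ▸ hu)
        · exact (around u (J.adj_of_mem_outer hu).symm huc).1 hu
      refine hcb.2.2 (K.clockwiseTriangle_of_forall_ne hmaps hinj ht.rotate.adj.symm
        (hdeg b (J.mem_verts_right ht.rotate.adj) hint) ?_ fun v hv hvc => (around v hv hvc).2)
      rw [ht.rotate.rot_eq]
      exact n1
    intro a c hac hn hcard x ⟨hx, hxe, hx1⟩
    have hcross := (hφ (a, c) hac).cross a c hac hn
    rw [if_pos rfl] at hcross
    have alg : ∀ p q : ZMod 2, p + q = 1 → p = 1 ∨ q = 1 := by decide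
    -- The colour changes across the chord, so exactly one of its sides is inside.
    rcases alg _ _ hcross with h | h
    · exact oriented _ a c hac hn (hφ (a, c) hac) h hcard x hx hxe hx1
    · exact oriented _ c a hac.symm (fun h => hn h.symm) (hφ (a, c) hac).swap h hcard x hx hxe hx1
  intro u v w ht
  by_contra hK
  have hbad : Bad (u, v) := ⟨ht.adj, ht.notMem_outer, by rwa [ht.rot_eq]⟩
  have hxe := badExt _ hbad
  obtain ⟨n1, n2, n3⟩ := ht.ne
  -- A bad triangle is not inside any edge, yet by `triangle_sum` it is inside one of its own sides.
  have fin : ∀ e ∈ J.darts, φ e (u, v) ≠ 1 := by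
    intro e he h1
    by_cases h : J'.graph.Adj e.1 e.2
    · rw [(hφ e he).eq_zero_of_adj h hxe] at h1
      exact absurd h1 (by decide)
    · exact main _ e.1 e.2 he h rfl (u, v) ⟨ht.adj, hxe, h1⟩ hbad
  have sum := (hφ _ ht.adj).triangle_sum ht (hφ _ ht.rotate.adj) (hφ _ ht.rotate.rotate.adj) hxe
  rw [if_pos rfl, if_neg (fun h => n1 (congrArg Prod.fst h)),
    if_neg (fun h => n3 (congrArg Prod.fst h).symm)] at sum
  have alg : ∀ p q r : ZMod 2, p + q + r = 1 + 0 + 0 → p = 1 ∨ q = 1 ∨ r = 1 := by decide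
  rcases alg _ _ _ sum with h | h | h
  · exact fin _ ht.adj h
  · exact fin _ ht.rotate.adj h
  · exact fin _ ht.rotate.rotate.adj h

end PlaneConfiguration

/-! ### Enhancements and free completions -/

namespace PlaneDrawing

variable {α β : Type*}

/-- If every vertex outside an induced subdrawing `H` is on the infinite region, then the finite
regions of `H` are regions of the whole drawing. -/
theorem IsInducedSubdrawing.triangle {H S : PlaneDrawing α} (h : H.IsInducedSubdrawing S)
    (hS : S.NearTriangulation) (hout : ∀ y ∈ S.verts, y ∉ H.verts → ∃ w, (y, w) ∈ S.outer)
    {u v : α} (huv : H.graph.Adj u v) (ho : (u, v) ∉ H.outer) :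
    S.ClockwiseTriangle u v (S.rot v u) ∧ H.ClockwiseTriangle u v (S.rot v u) := by
  have hle := h.1.graph_le
  have ht := hS.triangle (hle huv) (fun h' => ho (h.1.mem_outer huv h'))
  generalize S.rot v u = w at ht
  -- A third vertex outside `H` is on the infinite region of the whole drawing and has no edges of
  -- `H`, so its triangle would belong to the infinite region of `H`.
  have hw : w ∈ H.verts := by
    by_contra hw
    obtain ⟨x, hx⟩ := hout w (S.mem_verts_right ht.rotate.adj) hw
    apply ho
    rw [h.1.mem_outer_iff huv]
    refine (Exterior.of_mem_outer hx).congr ?_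
    refine (SameRegionIn.of_forall_not_adj (fun y hy => hw (H.mem_verts_left hy))
      (S.adj_of_mem_outer hx) ht.rotate.rotate.adj).trans ?_
    exact (SameRegionIn.of_mem_regionOf ht.adj (ht.mem_regionOf_iff.2 (.inr (.inr rfl)))).symm
  exact ⟨ht, h.1.clockwiseTriangle ht huv
    (h.2 _ (H.mem_verts_right huv) _ hw ht.rotate.adj)
    (h.2 _ hw _ (H.mem_verts_left huv) ht.rotate.rotate.adj)⟩

theorem TwoConnected.mono {H G : PlaneDrawing α} (hH : H.TwoConnected) (hle : H.graph ≤ G.graph)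
    (hV : H.verts = G.verts) : G.TwoConnected := by
  refine ⟨hV ▸ hH.1, fun v hv => ?_⟩
  have h := hH.2 v (hV ▸ hv)
  intro x y
  have hiff : ∀ z, z ∈ H.verts ↔ z ∈ G.verts := fun z => by rw [hV]
  let φ : H.del v →g G.del v := ⟨fun z => ⟨z.1, (hiff _).1 z.2.1, z.2.2⟩, fun h => hle h⟩
  exact (h ⟨x.1, (hiff _).2 x.2.1, x.2.2⟩ ⟨y.1, (hiff _).2 y.2.1, y.2.2⟩).map φ

end PlaneDrawing

namespace PlaneConfiguration

variable {α β : Type*}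

open PlaneDrawing

/-- The properties of an enhancement `J` of `L` that do not mention a free completion. -/
structure Enhances (L : PlaneConfiguration α) (J : PlaneDrawing α) : Prop where
  near : J.NearTriangulation
  verts_subset : L.G.verts ⊆ J.verts
  adj_iff : ∀ u ∈ L.G.verts, ∀ v ∈ L.G.verts, (L.G.graph.Adj u v ↔ J.graph.Adj u v)
  interior : ∀ b ∈ J.verts, ¬ J.OnInfinite b → b ∈ L.G.verts ∧ J.degree b = L.γ b
  firstHit : ∀ u v, L.G.graph.Adj u v →
    FirstHit (J.rot u) (L.G.graph.neighborSet u) v (L.G.rot u v)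
  triangle_iff : ∀ u ∈ L.G.verts, ∀ v ∈ L.G.verts, ∀ w ∈ L.G.verts,
    (L.G.ClockwiseTriangle u v w ↔ J.ClockwiseTriangle u v w)
  notMem_outer : ∀ b ∈ L.G.verts, J.degree b = L.γ b → ∀ x, (x, b) ∈ L.G.outer →
    (x, b) ∉ J.outer

theorem IsEnhancement.enhances {L : PlaneConfiguration α} {J : PlaneDrawing α}
    (h : L.IsEnhancement J) : L.Enhances J := by
  rcases h with ⟨-, rfl⟩ | ⟨-, S, R, v, v', hS, -, -, -, hv'R, -, hJ, hJV⟩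
  · refine ⟨L.near, subset_rfl, fun _ _ _ _ => Iff.rfl,
      fun b hb h => ⟨hb, (L.gamma_interior b hb h).symm⟩, ?_, fun _ _ _ _ _ _ => Iff.rfl, ?_⟩
    · exact fun u v huv => .hit v (L.G.adj_rot huv)
    · intro b hb hdeg x hx
      have := L.gamma_infinite b hb (L.G.onInfinite_of_mem_outer hx)
      omega
  · have hL := hS.induced
    have hLJ : L.G.verts ⊆ J.verts := fun x hx => (hJV x).2 (.inl hx)
    have outL : ∀ y ∈ S.verts, y ∉ L.G.verts → ∃ w, (y, w) ∈ S.outer := fun y hy hy' => by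
      rw [← hS.mem_ring]
      by_contra h
      exact hy' ((hS.verts_iff y).2 ⟨hy, h⟩)
    have outJ : ∀ y ∈ S.verts, y ∉ J.verts → ∃ w, (y, w) ∈ S.outer := fun y hy hy' =>
      outL y hy fun h => hy' (hLJ h)
    have hadj : ∀ u ∈ L.G.verts, ∀ v ∈ L.G.verts, (L.G.graph.Adj u v ↔ J.graph.Adj u v) :=
      fun u hu v hv => ⟨fun h => hJ.2 u (hLJ hu) v (hLJ hv) (hL.1.graph_le h),
        fun h => hL.2 u hu v hv (hJ.1.graph_le h)⟩
    refine ⟨?_, hLJ, hadj, ?_, ?_, ?_, ?_⟩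
    · exact fun u v huv ho => ⟨_, (hJ.triangle hS.near outJ huv ho).2⟩
    · intro b hb hint
      have hex : ∃ w, J.graph.Adj b w := by
        by_contra! h
        exact hint ⟨hb, .inr h⟩
      obtain ⟨w, hw⟩ := hex
      rw [J.not_onInfinite_iff (SimpleGraph.ne_bot_iff_exists_adj.2 ⟨_, _, hw⟩) hb] at hint
      -- Every corner of `J` at `b` is a finite triangle of `S`, so the neighbours of `b` in `J` are
      -- closed under the rotation of `S`.
      have hN : S.graph.neighborSet b = J.graph.neighborSet b := by
        refine Set.Subset.antisymm ?_ fun x hx => hJ.1.graph_le hx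
        intro x hx
        obtain ⟨n, rfl⟩ := S.exists_rot_pow (hJ.1.graph_le hw) hx
        clear hx
        induction n with
        | zero => exact hw
        | succ n ih =>
          rw [pow_succ']
          exact (hJ.triangle hS.near outJ (show J.graph.Adj b _ from ih).symm (hint _)).2.rotate.adj
      -- A ring vertex has an outer edge in `S`. Here that edge would be in `J`, and outer there as
      -- well.
      have hbL : b ∈ L.G.verts := by
        by_contra hbL
        obtain ⟨x, hx⟩ := outL b (hJ.1.verts_subset hb) hbL
        have hxJ : J.graph.Adj b x := by
          have : x ∈ S.graph.neighborSet b := S.adj_of_mem_outer hx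
          rwa [hN] at this
        have := hJ.1.mem_outer hxJ hx
        apply hint ((J.rot b).symm x)
        refine J.mem_outer_of_faceNext ?_ (by simpa [faceNext] using this)
        exact (J.adj_rot_iff.1 (by simpa using hxJ)).symm
      refine ⟨hbL, ?_⟩
      rw [← hS.degree_eq b hbL]
      simp only [PlaneDrawing.degree, hN]
    · intro u v huv
      refine FirstHit.of_subset (N := J.graph.neighborSet u) (fun x hx => ?_)
        (fun x hx => hJ.1.firstHit hx) ?_ (hL.1.firstHit huv)
      · exact (hadj u (L.G.mem_verts_left hx) x (L.G.mem_verts_right hx)).1 hx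
      · exact (hadj u (L.G.mem_verts_left huv) v (L.G.mem_verts_right huv)).1 huv
    · intro u hu v hv w hw
      constructor
      · intro ht
        have ht' := hL.triangle hS.near outL ht.adj ht.notMem_outer
        have : S.rot v u = w := ht'.2.rot_eq.symm.trans ht.rot_eq
        rw [this] at ht'
        exact hJ.1.clockwiseTriangle ht'.1 ((hadj u hu v hv).1 ht.adj)
          ((hadj v hv w hw).1 ht.rotate.adj) ((hadj w hw u hu).1 ht.rotate.rotate.adj)
      · intro ht
        have ht' := hJ.triangle hS.near outJ ht.adj ht.notMem_outer
        have : S.rot v u = w := ht'.2.rot_eq.symm.trans ht.rot_eq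
        rw [this] at ht'
        exact hL.1.clockwiseTriangle ht'.1 ((hadj u hu v hv).2 ht.adj)
          ((hadj v hv w hw).2 ht.rotate.adj) ((hadj w hw u hu).2 ht.rotate.rotate.adj)
    · intro b hb hdeg x hx ho
      rw [← hS.degree_eq b hb] at hdeg
      -- By the degree count, `J` contains all neighbours of `b` in `S`. As `b` is not in the ring,
      -- its corners in `S` are finite triangles, and these survive in the induced `J`.
      have hN : J.graph.neighborSet b = S.graph.neighborSet b :=
        Set.eq_of_subset_of_ncard_le (fun x hx => hJ.1.graph_le hx) hdeg.ge
          (S.neighborSet_finite b)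
      have hxb := J.adj_of_mem_outer ho
      have hxS : (x, b) ∉ S.outer := fun h =>
        ((hS.verts_iff b).1 hb).2 ((hS.mem_ring b).2 ⟨_, S.faceNext_mem_outer h⟩)
      have ht := hS.near.triangle (hJ.1.graph_le hxb) hxS
      have hy : S.rot b x ∈ J.graph.neighborSet b := by
        rw [hN]
        exact ht.rotate.adj
      exact (hJ.1.clockwiseTriangle ht hxb hy (hJ.2 _ (J.mem_verts_right hy) _
        (J.mem_verts_left hxb) ht.rotate.rotate.adj)).notMem_outer ho

end PlaneConfiguration

namespace PlaneDrawing

variable {α β : Type*}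

/-! ### Transport along an injective map of the vertices -/

theorem exists_rot_image (G : PlaneDrawing α) {f : α → β} (hf : Set.InjOn f G.verts) (u : α) :
    ∃ σ : Equiv.Perm β, (∀ v, G.graph.Adj u v → σ (f v) = f (G.rot u v)) ∧
      (∀ y ∉ f '' G.graph.neighborSet u, σ y = y) ∧
      σ.IsCycleOn (f '' G.graph.neighborSet u) := by
  classical
  have hinj := hf.mono (G.neighborSet_subset u)
  let p : β → Prop := fun y => y ∈ f '' G.graph.neighborSet u
  let e : G.graph.neighborSet u ≃ Subtype p := Equiv.Set.imageOfInjOn f _ hinj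
  let τ : Equiv.Perm (G.graph.neighborSet u) :=
    (G.rot u).subtypePerm fun _ => (G.rot_cycle u).apply_mem_iff
  have he : ∀ v, ∀ hv : v ∈ G.graph.neighborSet u, ((e ⟨v, hv⟩ : Subtype p) : β) = f v :=
    fun _ _ => rfl
  refine ⟨τ.extendDomain e, ?_, ?_, ?_⟩
  · intro v hv
    rw [← he v hv, Equiv.Perm.extendDomain_apply_image]
    rfl
  · intro y hy
    exact Equiv.Perm.extendDomain_apply_not_subtype _ _ hy
  · have := (G.rot_cycle u).subtypePerm.extendDomain e
    convert this using 1
    ext y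
    simp only [Set.mem_image, Set.mem_univ, true_and, Function.comp_apply, Subtype.exists]
    exact ⟨fun ⟨v, hv, h⟩ => ⟨v, hv, h⟩, fun ⟨v, hv, h⟩ => ⟨v, hv, h⟩⟩

theorem exists_isIso (G : PlaneDrawing α) {f : α → β} (hf : Set.InjOn f G.verts) :
    ∃ H : PlaneDrawing β, IsIso f G H := by
  classical
  choose σ h1 h2 h3 using G.exists_rot_image hf
  -- `f` is injective on the vertices only, so the rotation is read off from a chosen preimage among
  -- them, and is trivial at other points.
  let r : β → Equiv.Perm β := fun x =>
    if h : ∃ u, u ∈ G.verts ∧ f u = x then σ h.choose else 1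
  have hr : ∀ u ∈ G.verts, r (f u) = σ u := by
    intro u hu
    have h : ∃ v, v ∈ G.verts ∧ f v = f u := ⟨u, hu, rfl⟩
    have : h.choose = u := hf h.choose_spec.1 hu h.choose_spec.2
    simp only [r, dif_pos h, this]
  let F : SimpleGraph β :=
    { Adj := fun x y => ∃ u v, G.graph.Adj u v ∧ f u = x ∧ f v = y
      symm := ⟨fun x y ⟨u, v, h, hu, hv⟩ => ⟨v, u, h.symm, hv, hu⟩⟩
      loopless := ⟨by
        rintro x ⟨u, v, h, rfl, hv⟩
        exact h.ne (hf (G.mem_verts_left h) (G.mem_verts_right h) hv.symm)⟩ }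
  have hadj : ∀ u ∈ G.verts, ∀ v ∈ G.verts, G.graph.Adj u v ↔ F.Adj (f u) (f v) := by
    intro u hu v hv
    constructor
    · exact fun h => ⟨u, v, h, rfl, rfl⟩
    · rintro ⟨u', v', h, hu', hv'⟩
      rwa [hf (G.mem_verts_left h) hu hu', hf (G.mem_verts_right h) hv hv'] at h
  have hN : ∀ u ∈ G.verts, F.neighborSet (f u) = f '' G.graph.neighborSet u := by
    intro u hu
    ext y
    constructor
    · rintro ⟨u', v, h, hu', rfl⟩
      rw [hf (G.mem_verts_left h) hu hu'] at h
      exact ⟨v, h, rfl⟩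
    · rintro ⟨v, h, rfl⟩
      exact ⟨u, v, h, rfl, rfl⟩
  have hN' : ∀ x, (∀ u ∈ G.verts, f u ≠ x) → F.neighborSet x = ∅ := by
    intro x hx
    ext y
    simp only [SimpleGraph.mem_neighborSet, Set.mem_empty_iff_false, iff_false]
    rintro ⟨u, v, h, hu, -⟩
    exact hx u (G.mem_verts_left h) hu
  -- On darts `m` is injective and commutes with the boundary walks, so regions and edges are
  -- counted alike and Euler's formula carries over.
  let m : α × α → β × β := Prod.map f f
  have hminj : Set.InjOn m ((G.verts : Set α) ×ˢ (G.verts : Set α)) := hf.prodMap hf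
  have hdarts : G.darts ⊆ (G.verts : Set α) ×ˢ (G.verts : Set α) :=
    fun _ h => ⟨G.mem_verts_left h, G.mem_verts_right h⟩
  have hnext : ∀ e ∈ G.darts, faceNext r (m e) = m (faceNext G.rot e) := by
    rintro ⟨u, v⟩ h
    simp only [m, faceNext, Prod.map, hr v (G.mem_verts_right h), h1 v u (SimpleGraph.Adj.symm h)]
  have hreg : ∀ e ∈ G.darts, regionOf r (m e) = m '' regionOf G.rot e := by
    intro e he
    have : ∀ n : ℕ, (faceNext r)^[n] (m e) = m ((faceNext G.rot)^[n] e) := by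
      intro n
      induction n with
      | zero => rfl
      | succ n ih =>
        rw [Function.iterate_succ_apply', Function.iterate_succ_apply', ih,
          hnext _ (G.mapsTo_faceNext.iterate n he)]
    ext x
    constructor
    · rintro ⟨n, rfl⟩
      exact ⟨_, ⟨n, rfl⟩, (this n).symm⟩
    · rintro ⟨_, ⟨n, rfl⟩, rfl⟩
      exact ⟨n, this n⟩
  have hregs : regions F r = (fun s => m '' s) '' regions G.graph G.rot := by
    ext s
    constructor
    · rintro ⟨x, y, ⟨u, v, h, rfl, rfl⟩, rfl⟩
      exact ⟨_, ⟨u, v, h, rfl⟩, (hreg (u, v) h).symm⟩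
    · rintro ⟨_, ⟨u, v, h, rfl⟩, rfl⟩
      exact ⟨f u, f v, ⟨u, v, h, rfl, rfl⟩, (hreg (u, v) h).symm⟩
  have hregsub : ∀ s ∈ regions G.graph G.rot, s ⊆ (G.verts : Set α) ×ˢ (G.verts : Set α) := by
    rintro _ ⟨u, v, h, rfl⟩
    exact fun e he => hdarts (G.mem_darts_of_mem_regionOf h he)
  have hcardreg : (regions F r).ncard = (regions G.graph G.rot).ncard := by
    rw [hregs, Set.InjOn.ncard_image]
    intro s hs t ht hst
    exact hminj.image_eq_image_iff (hregsub s hs) (hregsub t ht) |>.1 hst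
  have hedges : F.edgeSet = Sym2.map f '' G.graph.edgeSet := by
    ext e
    induction e with
    | _ x y =>
      constructor
      · rintro ⟨u, v, h, rfl, rfl⟩
        exact ⟨s(u, v), h, rfl⟩
      · rintro ⟨e, he, hxy⟩
        induction e with
        | _ u v =>
          rw [Sym2.map_mk, Sym2.eq_iff] at hxy
          rcases hxy with ⟨rfl, rfl⟩ | ⟨rfl, rfl⟩
          · exact ⟨u, v, he, rfl, rfl⟩
          · exact ⟨v, u, SimpleGraph.Adj.symm he, rfl, rfl⟩
  have hcardedge : F.edgeSet.ncard = G.graph.edgeSet.ncard := by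
    rw [hedges, Set.InjOn.ncard_image]
    intro e he e' he' hee
    induction e with
    | _ u v =>
      induction e' with
      | _ u' v' =>
        rw [Sym2.map_mk, Sym2.map_mk, Sym2.eq_iff] at hee
        have hu : u ∈ G.verts := G.mem_verts_left he
        have hv : v ∈ G.verts := G.mem_verts_right he
        have hu' : u' ∈ G.verts := G.mem_verts_left he'
        have hv' : v' ∈ G.verts := G.mem_verts_right he'
        rcases hee with ⟨a, b⟩ | ⟨a, b⟩
        · rw [hf hu hu' a, hf hv hv' b]
        · rw [hf hu hv' a, hf hv hu' b, Sym2.eq_swap]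
  have hbot : G.graph = ⊥ → F = ⊥ := by
    intro h
    ext x y
    simp [F, h]
  have hconn : (F.induce ((G.verts.image f : Finset β) : Set β)).Connected := by
    let φ : G.graph.induce (G.verts : Set α) →g
        F.induce ((G.verts.image f : Finset β) : Set β) :=
      ⟨fun x => ⟨f x, by simpa using ⟨x.1, x.2, rfl⟩⟩, fun {x y} h => ⟨x, y, h, rfl, rfl⟩⟩
    refine G.connected.map φ ?_
    rintro ⟨y, hy⟩
    simp only [Finset.coe_image, Set.mem_image] at hy
    obtain ⟨x, hx, rfl⟩ := hy
    exact ⟨⟨x, hx⟩, rfl⟩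
  refine ⟨{ verts := G.verts.image f
            graph := F
            mem_verts := ?_
            connected := hconn
            rot := r
            rot_cycle := ?_
            rot_fixed := ?_
            outer := m '' G.outer
            outer_region := ?_
            euler := ?_ }, ?_⟩
  · rintro x y ⟨u, v, h, rfl, rfl⟩
    exact Finset.mem_image_of_mem f (G.mem_verts_left h)
  · intro x
    by_cases hx : ∃ u ∈ G.verts, f u = x
    · obtain ⟨u, hu, rfl⟩ := hx
      rw [hN u hu, hr u hu]
      exact h3 u
    · push Not at hx
      rw [hN' x hx]
      exact Equiv.Perm.isCycleOn_empty
  · intro x y hxy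
    by_cases hx : ∃ u ∈ G.verts, f u = x
    · obtain ⟨u, hu, rfl⟩ := hx
      rw [hr u hu]
      apply h2
      rwa [← hN u hu]
    · simp only [r]
      rw [dif_neg hx]
      rfl
  · rcases G.outer_region with ⟨h, h'⟩ | h
    · exact .inl ⟨hbot h, by simp [h']⟩
    · refine .inr ?_
      rw [hregs]
      exact ⟨_, h, rfl⟩
  · rcases G.euler with h | h
    · exact .inl (hbot h)
    · refine .inr ?_
      rw [hcardreg, hcardedge, Finset.card_image_of_injOn hf, h]
  · refine ⟨?_, hadj, ?_, ?_⟩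
    · rw [Finset.coe_image]
      exact hf.bijOn_image
    · intro u v huv
      simp only
      rw [hr u (G.mem_verts_left huv), h1 u v huv]
    · intro u v huv
      simp only
      constructor
      · exact fun h => ⟨(u, v), h, rfl⟩
      · rintro ⟨e, he, hee⟩
        rwa [← hminj (hdarts (G.outer_subset_darts he)) (hdarts (a := (u, v)) huv) hee]

namespace IsIso

variable {G : PlaneDrawing α} {H : PlaneDrawing β} {f : α → β}

theorem adj (h : IsIso f G H) {u v : α} (huv : G.graph.Adj u v) : H.graph.Adj (f u) (f v) :=
  (h.adj_iff u (G.mem_verts_left huv) v (G.mem_verts_right huv)).1 huv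

theorem exists_of_adj (h : IsIso f G H) {x y : β} (hxy : H.graph.Adj x y) :
    ∃ u v, G.graph.Adj u v ∧ f u = x ∧ f v = y := by
  obtain ⟨u, hu, rfl⟩ := h.bijOn.surjOn (H.mem_verts_left hxy)
  obtain ⟨v, hv, rfl⟩ := h.bijOn.surjOn (H.mem_verts_right hxy)
  exact ⟨u, v, (h.adj_iff u hu v hv).2 hxy, rfl, rfl⟩

theorem neighborSet_eq (h : IsIso f G H) {u : α} (hu : u ∈ G.verts) :
    H.graph.neighborSet (f u) = f '' G.graph.neighborSet u := by
  ext y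
  constructor
  · intro hy
    obtain ⟨v, hv, rfl⟩ := h.bijOn.surjOn (H.mem_verts_right hy)
    exact ⟨v, (h.adj_iff u hu v hv).2 hy, rfl⟩
  · rintro ⟨v, hv, rfl⟩
    exact h.adj hv

theorem degree_eq (h : IsIso f G H) {u : α} (hu : u ∈ G.verts) :
    H.degree (f u) = G.degree u := by
  unfold degree
  rw [h.neighborSet_eq hu, (h.bijOn.injOn.mono (G.neighborSet_subset u)).ncard_image]

theorem onInfinite_iff (h : IsIso f G H) {u : α} (hu : u ∈ G.verts) :
    H.OnInfinite (f u) ↔ G.OnInfinite u := by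
  unfold OnInfinite
  refine and_congr ⟨fun _ => hu, fun _ => h.bijOn.mapsTo hu⟩ (or_congr ⟨?_, ?_⟩ ⟨?_, ?_⟩)
  · rintro ⟨y, hy⟩
    have hadj := H.adj_of_mem_outer hy
    obtain ⟨v, hv, rfl⟩ := h.bijOn.surjOn (H.mem_verts_right hadj)
    exact ⟨v, (h.outer_iff u v ((h.adj_iff u hu v hv).2 hadj)).2 hy⟩
  · rintro ⟨v, hv⟩
    exact ⟨f v, (h.outer_iff u v (G.adj_of_mem_outer hv)).1 hv⟩
  · exact fun h' v hv => h' _ (h.adj hv)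
  · intro h' y hy
    obtain ⟨v, hv, rfl⟩ := h.bijOn.surjOn (H.mem_verts_right hy)
    exact h' v ((h.adj_iff u hu v hv).2 hy)

theorem clockwiseTriangle (h : IsIso f G H) {u v w : α} (ht : G.ClockwiseTriangle u v w) :
    H.ClockwiseTriangle (f u) (f v) (f w) := by
  refine .mk' (h.adj ht.adj) (fun h' => ht.notMem_outer ((h.outer_iff u v ht.adj).2 h')) ?_ ?_ ?_
  · rw [h.map_rot _ _ ht.adj.symm, ht.rot_eq]
  · rw [h.map_rot _ _ ht.rotate.adj.symm, ht.rotate.rot_eq]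
  · rw [h.map_rot _ _ ht.rotate.rotate.adj.symm, ht.rotate.rotate.rot_eq]

theorem nearTriangulation (h : IsIso f G H) (hG : G.NearTriangulation) : H.NearTriangulation := by
  intro x y hxy ho
  obtain ⟨u, v, huv, rfl, rfl⟩ := h.exists_of_adj hxy
  exact ⟨_, h.clockwiseTriangle (hG.triangle huv fun h' => ho ((h.outer_iff u v huv).1 h'))⟩

theorem nonempty_del_iso (h : IsIso f G H) {v : α} (hv : v ∈ G.verts) :
    Nonempty (G.del v ≃g H.del (f v)) := by
  let φ : {u : α // u ∈ G.verts ∧ u ≠ v} → {u : β // u ∈ H.verts ∧ u ≠ f v} := fun x =>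
    ⟨f x.1, h.bijOn.mapsTo x.2.1, fun h' => x.2.2 (h.bijOn.injOn x.2.1 hv h')⟩
  have hφ : Function.Bijective φ := by
    constructor
    · intro x y hxy
      exact Subtype.ext (h.bijOn.injOn x.2.1 y.2.1 (congrArg Subtype.val hxy))
    · rintro ⟨y, hy, hy'⟩
      obtain ⟨x, hx, rfl⟩ := h.bijOn.surjOn hy
      exact ⟨⟨x, hx, fun h => hy' (h ▸ rfl)⟩, rfl⟩
  exact ⟨⟨Equiv.ofBijective φ hφ, fun {x y} => (h.adj_iff x.1 x.2.1 y.1 y.2.1).symm⟩⟩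

theorem ringSize_eq (h : IsIso f G H) {γ : α → ℕ} {γ' : β → ℕ}
    (hγ : ∀ v ∈ G.verts, γ' (f v) = γ v) : H.ringSize γ' = G.ringSize γ := by
  classical
  unfold ringSize
  symm
  refine Finset.sum_bij (fun v _ => f v) ?_ ?_ ?_ ?_
  · intro v hv
    obtain ⟨h1, h2, h3⟩ := Finset.mem_filter.1 hv
    obtain ⟨e⟩ := h.nonempty_del_iso h1
    exact Finset.mem_filter.2 ⟨h.bijOn.mapsTo h1, (h.onInfinite_iff h1).2 h2,
      e.preconnected_iff.1 h3⟩
  · intro u hu v hv huv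
    exact h.bijOn.injOn (Finset.mem_filter.1 hu).1 (Finset.mem_filter.1 hv).1 huv
  · intro y hy
    obtain ⟨h1, h2, h3⟩ := Finset.mem_filter.1 hy
    obtain ⟨v, hv, rfl⟩ := h.bijOn.surjOn h1
    obtain ⟨e⟩ := h.nonempty_del_iso hv
    exact ⟨v, Finset.mem_filter.2 ⟨hv, (h.onInfinite_iff hv).1 h2, e.preconnected_iff.2 h3⟩, rfl⟩
  · intro v hv
    have hv := (Finset.mem_filter.1 hv).1
    rw [hγ v hv, h.degree_eq hv]

end IsIso

end PlaneDrawing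

namespace PlaneConfiguration

variable {α β : Type*}

open PlaneDrawing

/-- The image of a configuration under an injective map of its vertices. -/
theorem exists_isIso (L : PlaneConfiguration α) {f : α → β} (hf : Set.InjOn f L.G.verts)
    (γ : β → ℕ) (hγ : ∀ v ∈ L.G.verts, γ (f v) = L.γ v) :
    ∃ K₀ : PlaneConfiguration β, PlaneConfiguration.IsIso f L K₀ ∧ K₀.γ = γ := by
  obtain ⟨H, h⟩ := L.G.exists_isIso hf
  have hcc : ∀ v ∈ L.G.verts, Nat.card (H.del (f v)).ConnectedComponent =
      Nat.card (L.G.del v).ConnectedComponent := by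
    intro v hv
    obtain ⟨e⟩ := h.nonempty_del_iso hv
    exact (Nat.card_congr e.connectedComponentEquiv).symm
  refine ⟨{ G := H
            γ := γ
            near := h.nearTriangulation L.near
            components_le := ?_
            gamma_cut := ?_
            gamma_interior := ?_
            gamma_infinite := ?_
            five_le_gamma := ?_
            two_le_ringSize := ?_ }, ⟨h, hγ⟩, rfl⟩
  · intro x hx
    obtain ⟨v, hv, rfl⟩ := h.bijOn.surjOn hx
    rw [hcc v hv]
    exact L.components_le v hv
  · intro x hx hc
    obtain ⟨v, hv, rfl⟩ := h.bijOn.surjOn hx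
    rw [hcc v hv] at hc
    rw [hγ v hv, h.degree_eq hv]
    exact L.gamma_cut v hv hc
  · intro x hx hc
    obtain ⟨v, hv, rfl⟩ := h.bijOn.surjOn hx
    rw [h.onInfinite_iff hv] at hc
    rw [hγ v hv, h.degree_eq hv]
    exact L.gamma_interior v hv hc
  · intro x hx hc
    obtain ⟨v, hv, rfl⟩ := h.bijOn.surjOn hx
    rw [h.onInfinite_iff hv] at hc
    rw [hγ v hv, h.degree_eq hv]
    exact L.gamma_infinite v hv hc
  · intro x hx
    obtain ⟨v, hv, rfl⟩ := h.bijOn.surjOn hx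
    rw [hγ v hv]
    exact L.five_le_gamma v hv
  · rw [h.ringSize_eq hγ]
    exact L.two_le_ringSize

end PlaneConfiguration

/-! ### Embedding the image of a configuration as a subdrawing -/

namespace PlaneDrawing

variable {α β : Type*}

theorem neighborSet_subset_of_closed (G : PlaneDrawing α) {b x : α} {N : Set α}
    (hx : G.graph.Adj b x) (hxN : x ∈ N) (hN : ∀ v ∈ N, G.rot b v ∈ N) :
    G.graph.neighborSet b ⊆ N := by
  intro y hy
  obtain ⟨n, rfl⟩ := G.exists_rot_pow hx hy
  clear hy
  induction n with
  | zero => exact hxN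
  | succ n ih =>
    rw [pow_succ']
    exact hN _ ih

theorem exists_firstHit (G : PlaneDrawing α) {b x : α} {N : Set α}
    (hx : G.graph.Adj b x) (hxN : x ∈ N) : ∃ y, FirstHit (G.rot b) N x y := by
  -- At the latest, a full turn comes back to `x`. The turn starts at the successor of `x`, because
  -- a first hit needs at least one step.
  obtain ⟨n, hn⟩ := G.exists_rot_pow (G.adj_rot hx) hx
  refine FirstHit.exists_of_pow (n := n + 1) n.succ_pos ?_
  rw [pow_succ, Equiv.Perm.mul_apply, hn]
  exact hxN

/-- A criterion for being a subdrawing, for drawings whose finite regions are triangles of the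
larger drawing. -/
theorem isSubdrawing_of_firstHit {H G : PlaneDrawing α} (hV : H.verts ⊆ G.verts)
    (hle : H.graph ≤ G.graph)
    (hrot : ∀ u v, H.graph.Adj u v →
      FirstHit (G.rot u) (H.graph.neighborSet u) v (H.rot u v))
    (htri : ∀ u v, H.graph.Adj u v → (u, v) ∉ H.outer →
      ∃ w, H.ClockwiseTriangle u v w ∧ G.ClockwiseTriangle u v w) : H.IsSubdrawing G := by
  have finite : ∀ u v, H.graph.Adj u v → (u, v) ∉ H.outer → ¬ G.Exterior H.graph (u, v) := by
    rintro u v huv ho ⟨o, ho', hs⟩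
    obtain ⟨w, h1, h2⟩ := htri u v huv ho
    apply h2.notMem_outer
    rw [G.outer_eq_regionOf ho']
    refine G.mem_regionOf_symm h2.adj (hs.mem_regionOf h2.adj ?_)
    intro x y hxy
    rcases h2.mem_regionOf_iff.1 hxy with h | h | h <;> cases h
    · exact h1.adj
    · exact h1.rotate.adj
    · exact h1.rotate.rotate.adj
  refine ⟨hV, hle, ?_, ?_⟩
  · intro u v huv
    obtain ⟨n, h1, -, h2⟩ := FirstHit.iff_exists_pow.1 (hrot u v huv)
    exact ⟨n, h1, h2⟩
  · intro u v huv
    refine ⟨fun ho => ?_, fun h => by_contra fun ho => finite u v huv ho h⟩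
    obtain ⟨o, ho'⟩ := G.outer_nonempty (hle huv)
    -- Some dart of `H` is exterior, and it must be outer in `H` since finite triangles of `H` are
    -- not exterior. The boundary walk carries exteriority from it to every outer dart.
    obtain ⟨⟨p, q⟩, hd, hs⟩ := exists_sameRegionIn_dart G H hle
      (SimpleGraph.ne_bot_iff_exists_adj.2 ⟨_, _, huv⟩) (G.outer_subset_darts ho')
    have hpq : (p, q) ∈ H.outer := by
      by_contra h
      exact finite p q hd h ⟨o, ho', hs.symm⟩
    have hmem : (u, v) ∈ regionOf H.rot (p, q) := by rwa [← H.outer_eq_regionOf hpq]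
    have same : ∀ e ∈ regionOf H.rot (p, q), G.SameRegionIn H.graph (p, q) e := by
      rintro _ ⟨n, rfl⟩
      induction n with
      | zero => exact .refl _
      | succ n ih =>
        rw [Function.iterate_succ_apply']
        have had := H.mem_darts_of_mem_regionOf (e := (p, q)) hd ⟨n, rfl⟩
        generalize (faceNext H.rot)^[n] (p, q) = e at ih had
        exact ih.trans (.of_firstHit (hle (SimpleGraph.Adj.symm had))
          (hrot _ _ (SimpleGraph.Adj.symm had)))
    exact ⟨o, ho', (hs.trans (same _ hmem)).symm⟩

end PlaneDrawing

namespace PlaneConfiguration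

variable {α β : Type*}

open PlaneDrawing

variable {K : PlaneConfiguration β} {J : PlaneDrawing α} {f : α → β}

/-- By 2-connectedness every edge has a finite triangle on at least one side. -/
theorem adj_of_clockwiseTriangle (hnear : J.NearTriangulation) (hconn : J.TwoConnected)
    (hf : ∀ u v w, J.ClockwiseTriangle u v w → K.G.ClockwiseTriangle (f u) (f v) (f w))
    {u v : α} (huv : J.graph.Adj u v) : K.G.graph.Adj (f u) (f v) := by
  by_cases h : (u, v) ∈ J.outer
  · exact (hf _ _ _ (hnear.triangle huv.symm (hconn.notMem_outer h))).adj.symm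
  · exact (hf _ _ _ (hnear.triangle huv h)).adj

/-- Away from the single outer corner at `u`, the rotations agree step by step. The first return of
the rotation at `f u` to the image of the neighbours is injective, so at the outer corner only the
right value is left. -/
theorem firstHit_of_clockwiseTriangle (hnear : J.NearTriangulation) (hconn : J.TwoConnected)
    (hinj : Set.InjOn f J.verts)
    (hf : ∀ u v w, J.ClockwiseTriangle u v w → K.G.ClockwiseTriangle (f u) (f v) (f w))
    {u v : α} (huv : J.graph.Adj u v) :
    FirstHit (K.G.rot (f u)) (f '' J.graph.neighborSet u) (f v) (f (J.rot u v)) := by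
  have fin : ∀ z, J.graph.Adj u z → (z, u) ∉ J.outer → K.G.rot (f u) (f z) = f (J.rot u z) :=
    fun z hz ho => (hf _ _ _ (hnear.triangle hz.symm ho)).rot_eq
  have hmem : f (J.rot u v) ∈ f '' J.graph.neighborSet u := ⟨_, J.adj_rot huv, rfl⟩
  by_cases ho : (v, u) ∈ J.outer
  · obtain ⟨y, hy⟩ := K.G.exists_firstHit (adj_of_clockwiseTriangle hnear hconn hf huv)
      (N := f '' J.graph.neighborSet u) ⟨v, huv, rfl⟩
    obtain ⟨x, hx, hxy⟩ := hy.mem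
    have hz : J.graph.Adj u ((J.rot u).symm x) := J.adj_rot_iff.1 (by simpa using hx)
    by_cases hzv : (J.rot u).symm x = v
    · rw [← hzv, Equiv.apply_symm_apply, hxy, hzv]
      exact hy
    · exfalso
      have h1 := fin _ hz fun h => hzv (hconn.eq_of_mem_outer h ho)
      rw [Equiv.apply_symm_apply, hxy] at h1
      have h2 := hy.eq_of_symm_mem (by
        rw [← h1, Equiv.symm_apply_apply]
        exact ⟨_, hz, rfl⟩)
      rw [← h1, (K.G.rot (f u)).injective.eq_iff] at h2
      exact hzv (hinj (J.mem_verts_right hz) (J.mem_verts_right huv) h2.symm)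
  · rw [← fin v huv ho] at hmem ⊢
    exact .hit _ hmem

variable {L : PlaneConfiguration α}

/-- A map of an enhancement of `L` that preserves triangles takes `L` to a subdrawing. -/
theorem Enhances.isSubdrawing {K₀ : PlaneConfiguration β} (hE : L.Enhances J)
    (hconn : J.TwoConnected) (hinj : Set.InjOn f J.verts) (hmaps : Set.MapsTo f J.verts K.G.verts)
    (hf : ∀ u v w, J.ClockwiseTriangle u v w → K.G.ClockwiseTriangle (f u) (f v) (f w))
    (hiso : PlaneDrawing.IsIso f L.G K₀.G) : K₀.G.IsSubdrawing K.G := by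
  have hLJ : ∀ {u v}, L.G.graph.Adj u v → J.graph.Adj u v := fun h =>
    (hE.adj_iff _ (L.G.mem_verts_left h) _ (L.G.mem_verts_right h)).1 h
  refine isSubdrawing_of_firstHit ?_ ?_ ?_ ?_
  · intro x hx
    obtain ⟨u, hu, rfl⟩ := hiso.bijOn.surjOn hx
    exact hmaps (hE.verts_subset hu)
  · intro x y hxy
    obtain ⟨u, v, huv, rfl, rfl⟩ := hiso.exists_of_adj hxy
    exact adj_of_clockwiseTriangle hE.near hconn hf (hLJ huv)
  · intro x y hxy
    obtain ⟨u, v, huv, rfl, rfl⟩ := hiso.exists_of_adj hxy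
    rw [hiso.neighborSet_eq (L.G.mem_verts_left huv), hiso.map_rot _ _ huv]
    exact FirstHit.map (N := J.graph.neighborSet u) (fun _ h => hLJ h)
      (hinj.mono (J.neighborSet_subset u)) (fun _ h => J.adj_rot h)
      (fun _ h => firstHit_of_clockwiseTriangle hE.near hconn hinj hf h) (hLJ huv)
      (hE.firstHit u v huv)
  · intro x y hxy ho
    obtain ⟨u, v, huv, rfl, rfl⟩ := hiso.exists_of_adj hxy
    have ht := L.near.triangle huv fun h => ho ((hiso.outer_iff u v huv).1 h)
    exact ⟨_, hiso.clockwiseTriangle ht, hf _ _ _ ((hE.triangle_iff _ (L.G.mem_verts_left huv) _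
      (L.G.mem_verts_right huv) _ (L.G.mem_verts_right ht.rotate.adj)).1 ht)⟩

/-- The corners of `L` on its infinite region are not mapped to corners of finite regions. -/
theorem Enhances.not_clockwiseTriangle (hE : L.Enhances J)
    (hconn : J.TwoConnected) (hinj : Set.InjOn f J.verts) (hmaps : Set.MapsTo f J.verts K.G.verts)
    (hf : ∀ u v w, J.ClockwiseTriangle u v w → K.G.ClockwiseTriangle (f u) (f v) (f w))
    (hγ : ∀ v ∈ L.G.verts, L.γ v = K.γ (f v)) {x b : α} (hxb : (x, b) ∈ L.G.outer) :
    ¬ K.G.ClockwiseTriangle (f x) (f b) (f (L.G.rot b x)) := by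
  intro ht
  have hadj := L.G.adj_of_mem_outer hxb
  have hxL := L.G.mem_verts_left hadj
  have hbL := L.G.mem_verts_right hadj
  have hyadj := L.G.adj_rot hadj.symm
  have hyL := L.G.mem_verts_right hyadj
  have hbx := ((hE.adj_iff _ hbL _ hxL).1 hadj.symm)
  have hby := ((hE.adj_iff _ hbL _ hyL).1 hyadj)
  -- The assumed triangle puts the image of `L.G.rot b x` directly after that of `x`, so nothing of
  -- `J` lies between them.
  have hrot : J.rot b x = L.G.rot b x := by
    have h1 := firstHit_of_clockwiseTriangle hE.near hconn hinj hf hbx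
    have h2 := h1.unique (.hit _ (by rw [ht.rot_eq]; exact ⟨_, hby, rfl⟩))
    rw [ht.rot_eq] at h2
    exact hinj (J.mem_verts_right (J.adj_rot hbx)) (J.mem_verts_right hby) h2
  have ho : (x, b) ∈ J.outer := by
    by_contra ho
    have := hE.near.triangle hbx.symm ho
    rw [hrot] at this
    exact ((hE.triangle_iff _ hxL _ hbL _ hyL).2 this).notMem_outer hxb
  have around : ∀ v, J.graph.Adj b v →
      K.G.ClockwiseTriangle (f v) (f b) (f (J.rot b v)) := by
    intro v hv
    by_cases hvx : v = x
    · rw [hvx, hrot]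
      exact ht
    · exact hf _ _ _ (hE.near.triangle hv.symm fun h => hvx (hconn.eq_of_mem_outer h ho))
  -- Now every corner at `f b` is a finite triangle, so `f b` is interior in `K` and the degree of
  -- `b` in `J` equals its prescribed degree. This contradicts the last field of `Enhances`.
  have hN : K.G.graph.neighborSet (f b) = f '' J.graph.neighborSet b := by
    refine Set.Subset.antisymm ?_ ?_
    · refine K.G.neighborSet_subset_of_closed ht.adj.symm ⟨x, hbx, rfl⟩ ?_
      rintro _ ⟨v, hv, rfl⟩
      exact ⟨_, J.adj_rot hv, (around v hv).rot_eq.symm⟩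
    · rintro _ ⟨v, hv, rfl⟩
      exact (around v hv).adj.symm
  have hbK := hmaps (J.mem_verts_left hbx)
  have hint : ¬ K.G.OnInfinite (f b) := by
    rw [K.G.not_onInfinite_iff (SimpleGraph.ne_bot_iff_exists_adj.2 ⟨_, _, ht.adj⟩) hbK]
    intro p hp
    have : p ∈ K.G.graph.neighborSet (f b) := (K.G.adj_of_mem_outer hp).symm
    rw [hN] at this
    obtain ⟨v, hv, rfl⟩ := this
    exact (around v hv).notMem_outer hp
  refine hE.notMem_outer b hbL ?_ x hxb ho
  rw [hγ b hbL, K.gamma_interior _ hbK hint]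
  unfold PlaneDrawing.degree
  rw [hN, (hinj.mono (J.neighborSet_subset b)).ncard_image]

end PlaneConfiguration

/-! ### Subdrawings without chords -/

namespace PlaneDrawing

variable {α β : Type*}

theorem IsChordColoring.eq_of_forall_not_adj {G : PlaneDrawing α} {H : SimpleGraph α}
    {e : α × α} {φ : α × α → ZMod 2} (h : G.IsChordColoring H e φ) {x y y' : α}
    (hx : ∀ w, ¬ H.Adj x w) (h1 : x ≠ e.1) (h2 : x ≠ e.2) (hy : G.graph.Adj x y)
    (hy' : G.graph.Adj x y') : φ (x, y) = φ (x, y') := by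
  obtain ⟨n, rfl⟩ := G.exists_rot_pow hy hy'
  clear hy'
  induction n with
  | zero => rfl
  | succ n ih =>
    have := G.adj_rot_pow hy n
    rw [ih, h.cross_eq this (hx _) fun hs => ?_, ← h.along _ _ this.symm, pow_succ']
    · rfl
    · rcases Sym2.eq_iff.1 hs with ⟨h, -⟩ | ⟨h, -⟩
      · exact h1 h
      · exact h2 h

/-- A subdrawing `H` of a near-triangulation `G` is induced when no corner of the infinite region
of `H` is a corner of a finite region of `G`, and no chord of `H` can enclose vertices outside
`H`. -/
theorem IsSubdrawing.adj_of_forall_not_clockwiseTriangle {H G : PlaneDrawing α}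
    (hsub : H.IsSubdrawing G) (hnear : G.NearTriangulation)
    (htri : ∀ u v, H.graph.Adj u v → (u, v) ∉ H.outer →
      ∃ w, H.ClockwiseTriangle u v w ∧ G.ClockwiseTriangle u v w)
    (hear : ∀ x b, (x, b) ∈ H.outer → ¬ G.ClockwiseTriangle x b (H.rot b x))
    (hW : ∀ W : Set α, (∀ w ∈ W, w ∈ G.verts ∧ w ∉ H.verts ∧ ¬ G.OnInfinite w) →
      (∀ w ∈ W, ∀ y, G.graph.Adj w y → y ∉ H.verts → y ∈ W) → W = ∅)
    {u v : α} (hu : u ∈ H.verts) (hv : v ∈ H.verts) (huv : G.graph.Adj u v) :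
    H.graph.Adj u v := by
  have hle := hsub.graph_le
  have hcol : ∀ e : α × α, ∃ φ, e ∈ G.darts → e.1 ∈ H.verts → e.2 ∈ H.verts →
      G.IsChordColoring H.graph e φ := by
    intro e
    by_cases he : e ∈ G.darts ∧ e.1 ∈ H.verts ∧ e.2 ∈ H.verts
    · obtain ⟨φ, hφ⟩ := hsub.exists_isChordColoring he.1 he.2.1 he.2.2
      exact ⟨φ, fun _ _ _ => hφ⟩
    · exact ⟨0, fun h1 h2 h3 => absurd ⟨h1, h2, h3⟩ he⟩
  choose φ hφ using hcol
  have hH : H.graph ≠ ⊥ := fun h =>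
    huv.ne (H.eq_of_forall_adj id (by simp [h]) hu hv)
  have chordExt : ∀ a c, c ∈ H.verts → G.graph.Adj a c → ¬ H.graph.Adj a c →
      G.Exterior H.graph (a, c) := by
    intro a c hc hac hn
    obtain ⟨y, hy⟩ := H.exists_adj hH hc
    obtain ⟨z, hz⟩ := G.exists_lastHit hle hac.symm hy
    have hcz : H.graph.Adj c z := hz.mem
    by_cases ho : (z, c) ∈ H.outer
    · exact ((hsub.mem_outer_iff hcz.symm).1 ho).congr (.of_lastHit hle hz)
    · obtain ⟨w, h1, h2⟩ := htri z c hcz.symm ho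
      obtain rfl := hz.eq_of_apply_mem (by rw [h2.rot_eq]; exact h1.rotate.adj)
      exact absurd hcz.symm hn
  let inside : α × α → Set (α × α) := fun e =>
    {x | x ∈ G.darts ∧ G.Exterior H.graph x ∧ φ e x = 1}
  have main : ∀ n a c, a ∈ H.verts → c ∈ H.verts → G.graph.Adj a c → ¬ H.graph.Adj a c →
      (inside (a, c)).ncard = n → False := by
    intro n
    induction n using Nat.strong_induction_on with
    | _ n ih =>
    have oriented : ∀ ψ a c, a ∈ H.verts → c ∈ H.verts → G.graph.Adj a c → ¬ H.graph.Adj a c →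
        G.IsChordColoring H.graph (a, c) ψ → ψ (a, c) = 1 →
        {x | x ∈ G.darts ∧ G.Exterior H.graph x ∧ ψ x = 1}.ncard = n → False := by
      intro ψ a c ha hc hac hn hψ h1 hcard
      have hext := chordExt a c hc hac hn
      have notOuter : ∀ x, ψ x = 1 → x ∉ G.outer := by
        intro x hx h
        rw [hψ.outer _ h] at hx
        exact absurd hx (by decide)
      have ht := hnear.triangle hac (notOuter _ h1)
      generalize G.rot c a = b at ht
      have hmem := fun e => ht.mem_regionOf_iff (e := e)
      obtain ⟨n1, n2, n3⟩ := ht.ne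
      have inRegion : ∀ e ∈ regionOf G.rot (a, c), G.Exterior H.graph e ∧ ψ e = 1 := fun e he =>
        ⟨hext.congr (.of_mem_regionOf hac he), (hψ.eq_of_mem_regionOf hac he).trans h1⟩
      have hb : b ∈ H.verts := by
        by_contra hb
        -- These are the vertices outside `H` that the chord encloses.
        let W : Set α := {w | w ∈ G.verts ∧ w ∉ H.verts ∧ ∃ y, G.graph.Adj w y ∧
          G.Exterior H.graph (w, y) ∧ ψ (w, y) = 1}
        have noAdj : ∀ w ∈ W, ∀ y, ¬ H.graph.Adj w y := fun w hw y h =>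
          hw.2.1 (H.mem_verts_left h)
        have neEnds : ∀ w ∈ W, w ≠ a ∧ w ≠ c := fun w hw =>
          ⟨fun h => hw.2.1 (h ▸ ha), fun h => hw.2.1 (h ▸ hc)⟩
        -- A vertex of `W` has no edges of `H` and is not an end of the chord, so one enclosed
        -- corner makes all its corners enclosed. Hence it avoids the infinite region, and its
        -- neighbours outside `H` are enclosed too.
        have reverse : ∀ w ∈ W, ∀ y, G.graph.Adj w y →
            G.Exterior H.graph (y, w) ∧ ψ (y, w) = 1 := by
          intro w hw y hwy
          obtain ⟨y', hy', he, hψ'⟩ := hw.2.2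
          obtain ⟨hwa, hwc⟩ := neEnds w hw
          refine ⟨(he.congr (.of_forall_not_adj (noAdj w hw) hy' hwy)).congr
            (.cross hwy (noAdj w hw y)), ?_⟩
          rw [← hψ.cross_eq hwy (noAdj w hw y), ← hψ', hψ.eq_of_forall_not_adj (noAdj w hw)
            hwa hwc hwy hy']
          intro hs
          rcases Sym2.eq_iff.1 hs with ⟨h, -⟩ | ⟨h, -⟩
          · exact hwa h
          · exact hwc h
        have hempty := hW W (fun w hw => ⟨hw.1, hw.2.1, by
            rw [G.not_onInfinite_iff (SimpleGraph.ne_bot_iff_exists_adj.2 ⟨_, _, hac⟩) hw.1]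
            exact fun y hy => notOuter _ (reverse w hw y (G.adj_of_mem_outer hy).symm).2 hy⟩)
          (fun w hw y hwy hy => ⟨G.mem_verts_right hwy, hy, w, hwy.symm, reverse w hw y hwy⟩)
        have : b ∈ W := ⟨G.mem_verts_right ht.rotate.adj, hb, a, ht.rotate.rotate.adj,
          inRegion _ ((hmem _).2 (.inr (.inr rfl)))⟩
        rw [hempty] at this
        exact this
      have sub : ∀ p q, (p, q) ∈ regionOf G.rot (a, c) → s(a, c) ≠ s(p, q) → p ∈ H.verts →
          q ∈ H.verts → H.graph.Adj p q := by
        intro p q he hs hp hq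
        by_contra hch
        have hed := G.mem_darts_of_mem_regionOf (e := (a, c)) hac he
        have hφe := hφ _ hed hp hq
        refine ih _ ?_ p q hp hq hed hch rfl
        rw [← hcard]
        refine Set.ncard_lt_ncard ⟨?_, ?_⟩ (G.darts_finite.subset fun _ h => h.1)
        · rintro y ⟨hy1, hy2, hy3⟩
          exact ⟨hy1, hy2, hψ.le_of_eq_one hφe hac he hs hext h1 hy2 hy3⟩
        · intro h
          have : φ (p, q) (a, c) = 1 := (h ⟨hac, hext, h1⟩).2.2
          rw [hψ.eq_zero_of_eq_one hφe hac he hs hext h1] at this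
          exact absurd this (by decide)
      have hcb := sub c b ((hmem _).2 (.inr (.inl rfl))) (by
        rw [Sym2.eq_swap, Ne, Sym2.congr_right]
        exact n3.symm) hc hb
      have hba := sub b a ((hmem _).2 (.inr (.inr rfl))) (by
        rw [Sym2.eq_swap (a := b), Ne, Sym2.congr_right]
        exact n2) hb ha
      have hrot := ht.rotate.rot_eq
      -- Both other sides are edges of `H` and the triangle is exterior, so it fills an outer corner
      -- of `H` at `b`.
      refine hear c b ((hsub.mem_outer_iff hcb).2
        (inRegion _ ((hmem _).2 (.inr (.inl rfl)))).1) ?_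
      rw [hsub.rot_eq_of_adj hcb.symm (by rwa [hrot]), hrot]
      exact ht.rotate
    intro a c ha hc hac hn hcard
    have hcross := (hφ (a, c) hac ha hc).cross a c hac hn
    rw [if_pos rfl] at hcross
    have alg : ∀ p q : ZMod 2, p + q = 1 → p = 1 ∨ q = 1 := by decide
    rcases alg _ _ hcross with h | h
    · exact oriented _ a c ha hc hac hn (hφ (a, c) hac ha hc) h hcard
    · exact oriented _ c a hc ha hac.symm (fun h => hn h.symm) (hφ (a, c) hac ha hc).swap h hcard
  by_contra hn
  exact main _ u v hu hv huv hn rfl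

end PlaneDrawing

/-! ### Skeletons of axles -/

namespace Axle

open AxleVertex

variable {d : ℕ} {A : Axle d}

/-- The ordered pairs of consecutive vertices of the finite triangles of a skeleton. -/
def Arc (A : Axle d) : AxleVertex d → AxleVertex d → Prop
  | hub, hub => False
  | hub, rim j _ => j = 0
  | rim j _, hub => j = 0
  | rim 0 a, rim 0 b => b = a + 1 ∨ a = b + 1
  | rim 0 a, rim 1 b => b = a ∨ a = b + 1
  | rim 1 b, rim 0 a => a = b + 1 ∨ (a = b ∧ A.upper 0 b ≤ 8)
  | rim 1 a, rim 1 b => b = a + 1 ∧ A.upper 0 b = 5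
  | rim 0 a, rim (_ + 2) b => a = b
  | rim (_ + 2) b, rim 0 a => a = b
  | rim 1 a, rim (j + 2) b => j = 0 ∧ b = a + 1
  | rim (_ + 2) a, rim 1 b => b = a
  | rim (j + 2) a, rim (k + 2) b => b = a ∧ k = j + 1

theorem SkeletonTriangle.arc {x y z : AxleVertex d} (h : A.SkeletonTriangle x y z) :
    A.Arc x y ∧ A.Arc y z ∧ A.Arc z x := by
  induction h with
  | hub i => simp [Arc]
  | hat i => simp [Arc]
  | noFan i h => simp [Arc, h]
  | fanFirst i h h' => simp [Arc]
  | fanMiddle i j h h' h'' =>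
    obtain ⟨j, rfl⟩ := Nat.exists_eq_add_of_le' h
    simp [Arc]
  | fanLast i j h h' h'' =>
    obtain ⟨j, rfl⟩ := Nat.exists_eq_add_of_le' h
    simp [Arc, h'']
  | rotate x y z _ ih => exact ⟨ih.2.1, ih.2.2, ih.1⟩

/-- The spokes that are equal or adjacent to a vertex. -/
def Near (j : ZMod d) : AxleVertex d → Prop
  | hub => False
  | rim 0 a => j = a ∨ j = a + 1 ∨ a = j + 1
  | rim 1 a => j = a ∨ j = a + 1
  | rim (_ + 2) a => j = a

theorem near_of_arc {j : ZMod d} {y : AxleVertex d} (hy : y ≠ hub)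
    (h : A.Arc (rim 0 j) y ∨ A.Arc y (rim 0 j)) : Near j y := by
  match y, hy with
  | rim 0 a, _ => simp only [Arc, Near] at h ⊢; tauto
  | rim 1 a, _ => simp only [Arc, Near] at h ⊢; grind
  | rim (_ + 2) a, _ => simp only [Arc, Near] at h ⊢; tauto

/-- Indices follow the rim, so one step that avoids the hub stays well within the five listed
spokes; the wide bound matches the case of two steps in `mem_of_near_of_arc`. -/
theorem mem_of_near {j i : ZMod d} {k : ℕ} (h : Near j (rim k i)) :
    j ∈ ({i - 2, i - 1, i, i + 1, i + 2} : Set (ZMod d)) := by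
  simp only [Set.mem_insert_iff, Set.mem_singleton_iff]
  match k with
  | 0 => simp only [Near] at h; grind
  | 1 => simp only [Near] at h; grind
  | _ + 2 => simp only [Near] at h; grind

theorem mem_of_near_of_arc {j i : ZMod d} {k : ℕ} {y : AxleVertex d} (hy : y ≠ hub)
    (h : Near j y) (h' : A.Arc y (rim k i) ∨ A.Arc (rim k i) y) :
    j ∈ ({i - 2, i - 1, i, i + 1, i + 2} : Set (ZMod d)) := by
  simp only [Set.mem_insert_iff, Set.mem_singleton_iff]
  match y, hy, k with
  | rim 0 a, _, 0 => simp only [Arc, Near] at h h'; grind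
  | rim 0 a, _, 1 => simp only [Arc, Near] at h h'; grind
  | rim 0 a, _, _ + 2 => simp only [Arc, Near] at h h'; grind
  | rim 1 a, _, 0 => simp only [Arc, Near] at h h'; grind
  | rim 1 a, _, 1 => simp only [Arc, Near] at h h'; grind
  | rim 1 a, _, _ + 2 => simp only [Arc, Near] at h h'; grind
  | rim (_ + 2) a, _, 0 => simp only [Arc, Near] at h h'; grind
  | rim (_ + 2) a, _, 1 => simp only [Arc, Near] at h h'; grind
  | rim (_ + 2) a, _, _ + 2 => simp only [Arc, Near] at h h'; grind

theorem hub_mem : hub ∈ A.skeletonVerts := .inl rfl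

theorem spoke_mem (i : ZMod d) : rim 0 i ∈ A.skeletonVerts := .inr ⟨0, i, rfl, .inl (by omega)⟩

theorem hat_mem (i : ZMod d) : rim 1 i ∈ A.skeletonVerts := .inr ⟨1, i, rfl, .inl (by omega)⟩

theorem fan_mem_iff {i : ZMod d} {j : ℕ} : rim (j + 2) i ∈ A.skeletonVerts ↔
    A.upper 0 i ≤ 8 ∧ j + 6 ≤ A.upper 0 i := by
  constructor
  · rintro (h | ⟨_, _, h, h' | ⟨-, h'⟩⟩) <;> cases h
    · omega
    · omega
  · exact fun h => .inr ⟨j + 2, i, rfl, .inr ⟨by omega, h.1, by omega⟩⟩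

end Axle

namespace IsSkeleton

open AxleVertex Axle

variable {β : Type*} {d : ℕ} {K : PlaneConfiguration β} {A : Axle d} {lab : AxleVertex d → β}

theorem adj_of_triangle (h : IsSkeleton K A lab) {x y z : AxleVertex d}
    (hx : x ∈ A.skeletonVerts) (hy : y ∈ A.skeletonVerts) (ht : A.SkeletonTriangle x y z) :
    K.G.graph.Adj (lab x) (lab y) :=
  (h.adj_iff x hx y hy).2 ⟨z, .inl ht⟩

theorem arc_of_adj (h : IsSkeleton K A lab) {x y : AxleVertex d}
    (hx : x ∈ A.skeletonVerts) (hy : y ∈ A.skeletonVerts) (ha : K.G.graph.Adj (lab x) (lab y)) :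
    A.Arc x y ∨ A.Arc y x := by
  obtain ⟨z, ht | ht⟩ := (h.adj_iff x hx y hy).1 ha
  · exact .inl ht.arc.1
  · exact .inr ht.arc.1

/-- If the side of the edge `xy` met when going from `x` to `y` were finite, it would be a skeleton
triangle, and `Arc` allows for all of these. -/
theorem onInfinite_of_not_arc (h : IsSkeleton K A lab) {x y z : AxleVertex d}
    (hx : x ∈ A.skeletonVerts) (hy : y ∈ A.skeletonVerts) (ht : A.SkeletonTriangle y x z)
    (hn : ¬ A.Arc x y) : K.G.OnInfinite (lab x) := by
  have hadj := (h.adj_of_triangle hy hx ht).symm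
  refine ⟨h.bijOn.mapsTo hx, .inl ⟨lab y, ?_⟩⟩
  by_contra ho
  obtain ⟨w, hw⟩ := K.near _ _ hadj ho
  obtain ⟨z', hz', rfl⟩ := h.bijOn.surjOn (K.G.mem_verts_right hw.rotate.adj)
  exact hn ((h.triangle_iff x hx y hy z' hz').1 hw).arc.1

/-- Each hat or fan vertex has an edge with a triangle on one side only. For a hat, which edge this
is depends on whether the spoke has no fan, a nonempty fan, or upper bound 12. -/
theorem onInfinite_rim (h : IsSkeleton K A lab) (hd : 6 ≤ d) {j : ℕ} {i : ZMod d}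
    (hx : rim (j + 1) i ∈ A.skeletonVerts) : K.G.OnInfinite (lab (rim (j + 1) i)) := by
  have one_ne : (1 : ZMod d) ≠ 0 := by
    have : Fact (1 < d) := ⟨by omega⟩
    exact one_ne_zero
  have two_ne : (1 : ZMod d) + 1 ≠ 0 := by
    intro h
    have h' : ((2 : ℕ) : ZMod d) = 0 := by
      push_cast
      rw [← h]
      ring
    rw [ZMod.natCast_eq_zero_iff] at h'
    exact absurd (Nat.le_of_dvd (by omega) h') (by omega)
  have ne_succ : ¬ i = i + 1 := fun h => one_ne (left_eq_add.1 h)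
  have pred_ne : ¬ i - 1 = i := fun h => one_ne (sub_eq_self.1 h)
  have pred_ne_succ : ¬ i - 1 = i + 1 := fun h => two_ne (by
    rw [sub_eq_iff_eq_add, add_assoc] at h
    exact left_eq_add.1 h)
  match j with
  | 0 =>
    have hu := A.upper_mem 0 (by omega) i
    simp only [Set.mem_insert_iff, Set.mem_singleton_iff] at hu
    by_cases h5 : A.upper 0 i = 5
    · refine h.onInfinite_of_not_arc hx (hat_mem (i - 1)) (.rotate _ _ _ (.noFan i h5)) ?_
      exact fun h => pred_ne_succ h.1
    by_cases h8 : A.upper 0 i ≤ 8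
    · obtain ⟨k, hk⟩ := Nat.exists_eq_add_of_le' (show 6 ≤ A.upper 0 i by omega)
      refine h.onInfinite_of_not_arc hx (fan_mem_iff (j := k).2 ⟨h8, hk.ge⟩)
        (.rotate _ _ _ (.fanLast i (k + 2) (by omega) (by omega) h8)) ?_
      exact fun h => ne_succ h.2
    · refine h.onInfinite_of_not_arc hx (spoke_mem i) (.rotate _ _ _ (.hat i)) ?_
      exact fun h => h.elim ne_succ fun h => h8 h.2
  | 1 =>
    have hu := fan_mem_iff.1 hx
    refine h.onInfinite_of_not_arc hx (hat_mem (i - 1))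
      (.rotate _ _ _ (.fanFirst i (by omega) hu.1)) ?_
    exact pred_ne
  | j + 2 =>
    have hu := fan_mem_iff.1 hx
    refine h.onInfinite_of_not_arc hx (fan_mem_iff (j := j).2 ⟨hu.1, by omega⟩)
      (.rotate _ _ _ (.fanMiddle i (j + 2) (by omega) (by omega) hu.1)) ?_
    simp only [Arc]
    omega

/-- In the skeleton of an axle of degree at least six, no vertices are enclosed by a well-positioned
subconfiguration of radius at most two. -/
theorem eq_empty_of_wellPositioned (h : IsSkeleton K A lab) (hd : 6 ≤ d)
    {K₀ : PlaneConfiguration β} (hle : K₀.G.graph ≤ K.G.graph) (hV : K₀.G.verts ⊆ K.G.verts)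
    (hpos : WellPositioned lab K₀) {c : β} (hc : c ∈ K₀.G.verts)
    (hrad : ∀ u ∈ K₀.G.verts, u = c ∨ K₀.G.graph.Adj u c ∨
      ∃ m, K₀.G.graph.Adj u m ∧ K₀.G.graph.Adj m c) (W : Set β)
    (hW : ∀ w ∈ W, w ∈ K.G.verts ∧ w ∉ K₀.G.verts ∧ ¬ K.G.OnInfinite w)
    (hclosed : ∀ w ∈ W, ∀ y, K.G.graph.Adj w y → y ∉ K₀.G.verts → y ∈ W) : W = ∅ := by
  have hats : ∀ i, lab (rim 1 i) ∉ W := fun i hi =>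
    (hW _ hi).2.2 (h.onInfinite_rim hd (j := 0) (hat_mem i))
  -- A spoke in `W` has a hat outside `K₀`; by closure that hat would be in `W`, but hats are on the
  -- infinite region.
  have spokes : ∀ i, lab (rim 0 i) ∉ W := by
    intro i hi
    rcases hpos i (hW _ hi).2.1 with h' | h'
    · refine hats (i - 1) (hclosed _ hi _ (h.adj_of_triangle (hat_mem _) (spoke_mem _)
        (z := rim 0 (i - 1)) ?_).symm h')
      have := SkeletonTriangle.hat (A := A) (i - 1)
      rw [sub_add_cancel] at this
      exact .rotate _ _ _ (.rotate _ _ _ this)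
    · exact hats i (hclosed _ hi _ (h.adj_of_triangle (spoke_mem _) (hat_mem _)
        (.rotate _ _ _ (.hat i))) h')
  have hubs : lab hub ∉ W := by
    intro hhub
    have hin : ∀ i, lab (rim 0 i) ∈ K₀.G.verts := by
      intro i
      by_contra hi
      exact spokes i (hclosed _ hhub _ (h.adj_of_triangle hub_mem (spoke_mem _) (.hub i)) hi)
    have hlab : ∀ y ∈ K₀.G.verts, ∃ x ∈ A.skeletonVerts, x ≠ hub ∧ lab x = y := by
      intro y hy
      obtain ⟨x, hx, rfl⟩ := h.bijOn.surjOn (hV hy)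
      exact ⟨x, hx, fun hx => (hW _ hhub).2.1 (hx ▸ hy), rfl⟩
    obtain ⟨x, hx, hxh, rfl⟩ := hlab c hc
    obtain ⟨k, i, rfl⟩ : ∃ k i, x = rim k i := by
      cases x with
      | hub => exact absurd rfl hxh
      | rim k i => exact ⟨k, i, rfl⟩
    -- All spokes are in `K₀` and the hub is not, so each spoke is within two steps of the centre
    -- along paths avoiding the hub. That leaves room for five spokes only.
    have hall : ∀ j : ZMod d, j ∈ ({i - 2, i - 1, i, i + 1, i + 2} : Set (ZMod d)) := by
      intro j
      rcases hrad _ (hin j) with h' | h' | ⟨m, h', h''⟩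
      · have := h.bijOn.injOn (spoke_mem j) hx h'
        rw [rim.injEq] at this
        simp [this.2]
      · exact mem_of_near (near_of_arc hxh (h.arc_of_adj (spoke_mem j) hx (hle h')))
      · obtain ⟨y, hy, hyh, rfl⟩ := hlab m (K₀.G.mem_verts_right h')
        exact mem_of_near_of_arc hyh
          (near_of_arc hyh (h.arc_of_adj (spoke_mem j) hy (hle h')))
          (h.arc_of_adj hy hx (hle h''))
    have : NeZero d := ⟨by omega⟩
    have hcard := Finset.card_le_card (s := Finset.univ)
      (t := {i - 2, i - 1, i, i + 1, i + 2}) fun j _ => by simpa using hall j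
    rw [Finset.card_univ, ZMod.card] at hcard
    exact absurd (hcard.trans Finset.card_le_five) (by omega)
  refine Set.eq_empty_iff_forall_notMem.2 fun w hw => ?_
  obtain ⟨x, hx, rfl⟩ := h.bijOn.surjOn (hW w hw).1
  match x with
  | hub => exact hubs hw
  | rim 0 i => exact spokes i hw
  | rim (j + 1) i => exact (hW _ hw).2.2 (h.onInfinite_rim hd hx)

end IsSkeleton

theorem mainTheorem6 {α β : Type*} (L : PlaneConfiguration α) (K : PlaneConfiguration β)
    (J J' : PlaneDrawing α) (hJ : L.IsEnhancement J)
    (hJ'sub : J'.IsSubdrawing J) (hJ'verts : J'.verts = J.verts)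
    (hJ'near : J'.NearTriangulation) (hJ'conn : J'.TwoConnected)
    (f : α → β) (hf_maps : Set.MapsTo f J'.verts K.G.verts) (hf_inj : Set.InjOn f J'.verts)
    (hf_tri : ∀ u v w, J'.ClockwiseTriangle u v w → K.G.ClockwiseTriangle (f u) (f v) (f w))
    (hf_gamma : ∀ v ∈ L.G.verts, L.γ v = K.γ (f v)) :
    ∃ K₀ : PlaneConfiguration β,
      PlaneConfiguration.IsIso f L K₀ ∧ K₀.IsSubconfiguration K ∧
      (L.RadiusAtMostTwo →
        ∀ (d : ℕ) (A : Axle d) (lab : AxleVertex d → β), 6 ≤ d → IsSkeleton K A lab →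
          WellPositioned lab K₀ → K₀.IsInducedSubconfiguration K) := by
  have hE := hJ.enhances
  have hconn := hJ'conn.mono hJ'sub.graph_le hJ'verts
  rw [hJ'verts] at hf_maps hf_inj
  have hf := K.clockwiseTriangle_of_spanning hJ'sub hJ'verts hE.near hJ'near hJ'conn hf_maps hf_inj
    (fun b hb h => by
      obtain ⟨hbL, hdeg⟩ := hE.interior b hb h
      rw [hdeg, hf_gamma b hbL]) hf_tri
  -- The image takes all of `K.γ` as its degree function, which makes the condition on degrees in a
  -- subconfiguration immediate.
  obtain ⟨K₀, hiso, hγ⟩ := L.exists_isIso (f := f) (hf_inj.mono hE.verts_subset) K.γ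
    fun v hv => (hf_gamma v hv).symm
  have hsub := hE.isSubdrawing hconn hf_inj hf_maps hf hiso.1
  have hγ' : ∀ v ∈ K₀.G.verts, K₀.γ v = K.γ v := fun v _ => by rw [hγ]
  refine ⟨K₀, hiso, ⟨hsub, hγ'⟩, ?_⟩
  rintro ⟨c, hc, hrad⟩ d A lab hd hskel hpos
  refine ⟨⟨hsub, fun u hu v hv huv => ?_⟩, hγ'⟩
  refine hsub.adj_of_forall_not_clockwiseTriangle K.near ?_ ?_ ?_ hu hv huv
  · intro x y hxy ho
    obtain ⟨u, v, huv, rfl, rfl⟩ := hiso.1.exists_of_adj hxy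
    have ht := L.near.triangle huv fun h => ho ((hiso.1.outer_iff u v huv).1 h)
    exact ⟨_, hiso.1.clockwiseTriangle ht, hf _ _ _ ((hE.triangle_iff _
      (L.G.mem_verts_left huv) _ (L.G.mem_verts_right huv) _
      (L.G.mem_verts_right ht.rotate.adj)).1 ht)⟩
  · intro x y ho
    obtain ⟨u, v, huv, rfl, rfl⟩ := hiso.1.exists_of_adj (K₀.G.adj_of_mem_outer ho)
    rw [hiso.1.map_rot _ _ huv.symm]
    exact hE.not_clockwiseTriangle hconn hf_inj hf_maps hf hf_gamma
      ((hiso.1.outer_iff u v huv).2 ho)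
  · intro W hW hclosed
    refine hskel.eq_empty_of_wellPositioned hd hsub.graph_le hsub.verts_subset hpos
      (hiso.1.bijOn.mapsTo hc) ?_ W hW hclosed
    intro y hy
    obtain ⟨u, hu, rfl⟩ := hiso.1.bijOn.surjOn hy
    obtain ⟨p, -, hp⟩ := hrad u hu
    match p with
    | .nil => exact .inl rfl
    | .cons h .nil => exact .inr (.inl (hiso.1.adj h))
    | .cons h (.cons h' .nil) => exact .inr (.inr ⟨_, hiso.1.adj h, hiso.1.adj h'⟩)
    | .cons h (.cons h' (.cons h'' p)) => simp at hp
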